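/- Conventions. All algebras are associative algebras over $\mathbb{C}$, not necessarily unital, non-zero, with non-degenerate product; $M(B)$ is the multiplier algebra of $B$. Let $(A,\Delta)$ be a $^*$-algebraic quantum group: $A$ is a $^*$-algebra, $\Delta:A\to M(A\otimes A)$ is a non-degenerate coassociative $^*$-homomorphism, the maps $a\otimes b\mapsto \Delta(a)(1\otimes b),\ (a\otimes 1)\Delta(b),\ \Delta(a)(b\otimes 1),\ (1\otimes a)\Delta(b)$ are linear bijections of $A\otimes A$, and there is a non-zero positive functional $\varphi$ with $(\iota\otimes\varphi)(\Delta(a)(b\otimes 1))=\varphi(a)b$. Let $\varepsilon$ and $S$ be its counit and antipode, $\psi=\varphi\circ S$, let $\hat A=\{\varphi(\,\cdot\,a)\mid a\in A\}$ be the dual, with left integral $\hat\varphi(\psi(a\,\cdot\,))=\varepsilon(a)$, and let $\hat\delta$ be the modular element of $\hat A$, that is (as a functional on $A$) $\hat\varphi(\omega(\,\cdot\,y))=\hat\varphi(\omega)\hat\delta(y)$ for $\omega\in\hat A$, $y\in A$. Let $(X,\alpha)$ be a right $A$-Galois object such that $X$ is a $^*$-algebra and $\alpha$ is $^*$-preserving: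 $\alpha:X\to M(X\otimes A)$ is an injective $^*$-homomorphism with $\alpha(X)(1\otimes A)$, $(1\otimes A)\alpha(X)$ and $(X\otimes 1)\alpha(X)$ contained in $X\otimes A$ and $(\alpha\otimes\iota)\alpha=(\iota\otimes\Delta)\alpha$; the only $f\in M(X)$ with $\alpha(f)=f\otimes 1$ are the scalars; and $X\otimes X\to X\otimes A$, $x\otimes y\mapsto (x\otimes 1)\alpha(y)$, is bijective. Assume that the $^*$-algebra $X$ admits a non-zero positive functional (a functional $\omega$ is positive if $\omega(x^*x)\ge 0$ for all $x$). Then there is a non-zero positive functional $\psi_X$ on $X$ that is invariant, i.e. $(\psi_X\otimes\iota)\alpha(x)=\psi_X(x)1$ for all $x\in X$. Moreover, let $\psi_X$ be any non-zero invariant functional on $X$. Then (a) some non-zero scalar multiple of $\psi_X$ is positive; (b) there exist a functional $\varphi_X$ on $X$ with $(\iota\otimes\varphi)\alpha(x)=\varphi_X(x)1$, an invertible $\delta_X\in M(X)$ with $\varphi_X(x\delta_X)=\psi_X(x)$, an algebra automorphism $\sigma_X$ of $X$ with $\varphi_X(y\sigma_X(x))=\varphi_X(xy)$, and a linear map $\theta_X(x)=\sigma_X(\hat\delta\cdot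 x)$ where $\hat\delta\cdot x=(\iota\otimes\hat\delta)\alpha(x)\in X$; (c) for any such maps, $\varphi_X$ is positive, and there is a basis $\{x_i\}$ of $X$ such that every $x_i$ is an eigenvector of $\sigma_X$, of $\theta_X$, of left multiplication by $\delta_X$ and of right multiplication by $\delta_X$. -/

import Mathlib

open scoped TensorProduct ComplexOrder

noncomputable section

namespace StarGalois

section Multipliers

variable {B C : Type*}
variable [NonUnitalRing B] [Module ℂ B] [IsScalarTower ℂ B B] [SMulCommClass ℂ B B]
variable [NonUnitalRing C] [Module ℂ C] [IsScalarTower ℂ C C] [SMulCommClass ℂ C C]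

/-- The product of a (possibly non-unital) algebra is non-degenerate. -/
def Nondegenerate (B : Type*) [NonUnitalRing B] : Prop :=
  (∀ a : B, (∀ b : B, a * b = 0) → a = 0) ∧ (∀ b : B, (∀ a : B, a * b = 0) → b = 0)

/-- The multiplier algebra `M(B)`: pairs `(l, r)` of linear maps with `a * l b = r a * b`;
one reads `l b` as `m b` and `r a` as `a m`. The second component lives in the opposite algebra, so
that `a (m n) = (a m) n`. -/
def Multiplier (B : Type*) [NonUnitalRing B] [Module ℂ B] [IsScalarTower ℂ B B]
    [SMulCommClass ℂ B B] :
    Subalgebra ℂ (Module.End ℂ B × (Module.End ℂ B)ᵐᵒᵖ) where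
  carrier := {m | ∀ a b : B, a * m.1 b = m.2.unop a * b}
  mul_mem' := by
    intro m n hm hn a b
    have h1 := hm a (n.1 b)
    have h2 := hn (m.2.unop a) b
    simpa using h1.trans h2
  add_mem' := by
    intro m n hm hn a b
    simpa [mul_add, add_mul] using congrArg₂ (· + ·) (hm a b) (hn a b)
  algebraMap_mem' := by
    intro c a b
    simpa [Algebra.algebraMap_eq_smul_one] using
      (mul_smul_comm c a b).trans (smul_mul_assoc c a b).symm

namespace Multiplier

/-- `m.left b` is `m b`. -/
def left (m : Multiplier B) : B →ₗ[ℂ] B := m.1.1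

/-- `m.right a` is `a m`. -/
def right (m : Multiplier B) : B →ₗ[ℂ] B := m.1.2.unop

theorem mul_left_eq (m : Multiplier B) (a b : B) : a * left m b = right m a * b := m.2 a b

/-- The multiplier with given left and right action. -/
def mk (l r : B →ₗ[ℂ] B) (h : ∀ a b : B, a * l b = r a * b) : Multiplier B :=
  ⟨(l, MulOpposite.op r), h⟩

/-- The canonical map `B → M(B)`. -/
def incl (b : B) : Multiplier B :=
  mk (LinearMap.mulLeft ℂ b) (LinearMap.mulRight ℂ b) (by intro x y; simp [mul_assoc])

/-- The multiplier `m ⊗ n` of `B ⊗ C`. -/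
def tensor (m : Multiplier B) (n : Multiplier C) : Multiplier (B ⊗[ℂ] C) :=
  mk (TensorProduct.map (left m) (left n)) (TensorProduct.map (right m) (right n)) (by
    intro s t
    induction s with
    | zero => simp
    | add s₁ s₂ h₁ h₂ => simp [add_mul, h₁, h₂]
    | tmul x y =>
      induction t with
      | zero => simp
      | add t₁ t₂ h₁ h₂ => rw [map_add, mul_add, mul_add, h₁, h₂]
      | tmul z w => simp [mul_left_eq])

/-- The involution of `M(B)`: `m⋆ b = (b⋆ m)⋆` and `b m⋆ = (m b⋆)⋆`. -/
instance [StarRing B] [StarModule ℂ B] : Star (Multiplier B) where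
  star m := mk
    { toFun := fun b => star (right m (star b))
      map_add' := by intro x y; simp
      map_smul' := by intro c x; simp }
    { toFun := fun b => star (left m (star b))
      map_add' := by intro x y; simp
      map_smul' := by intro c x; simp }
    (by
      intro a b
      have h := congrArg star (mul_left_eq m (star b) (star a))
      simpa using h.symm)

end Multiplier

/-- A functional `ω` on a `*`-algebra is positive if `ω (x⋆ x) ≥ 0` for all `x`. -/
def IsPositive [StarRing B] (ω : B →ₗ[ℂ] ℂ) : Prop := ∀ x : B, 0 ≤ ω (star x * x)

end Multipliers

section Slices

variable {U V : Type*} [AddCommGroup U] [Module ℂ U] [AddCommGroup V] [Module ℂ V]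

/-- `ι ⊗ ω : U ⊗ V → U`. -/
def sliceRight (ω : V →ₗ[ℂ] ℂ) : U ⊗[ℂ] V →ₗ[ℂ] U :=
  (TensorProduct.rid ℂ U).toLinearMap ∘ₗ LinearMap.lTensor U ω

/-- `ω ⊗ ι : U ⊗ V → V`. -/
def sliceLeft (ω : U →ₗ[ℂ] ℂ) : U ⊗[ℂ] V →ₗ[ℂ] V :=
  (TensorProduct.lid ℂ V).toLinearMap ∘ₗ LinearMap.rTensor V ω

/-- `T₁₂` on `U ⊗ V ⊗ V`. -/
def leg12 (T : U ⊗[ℂ] V →ₗ[ℂ] U ⊗[ℂ] V) : U ⊗[ℂ] (V ⊗[ℂ] V) →ₗ[ℂ] U ⊗[ℂ] (V ⊗[ℂ] V) :=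
  (TensorProduct.assoc ℂ U V V).toLinearMap ∘ₗ LinearMap.rTensor V T ∘ₗ
    (TensorProduct.assoc ℂ U V V).symm.toLinearMap

/-- `T₂₃` on `U ⊗ V ⊗ V`. -/
def leg23 (U : Type*) [AddCommGroup U] [Module ℂ U] (T : V ⊗[ℂ] V →ₗ[ℂ] V ⊗[ℂ] V) :
    U ⊗[ℂ] (V ⊗[ℂ] V) →ₗ[ℂ] U ⊗[ℂ] (V ⊗[ℂ] V) :=
  LinearMap.lTensor U T

/-- `T₁₃` on `U ⊗ V ⊗ V`. -/
def leg13 (T : U ⊗[ℂ] V →ₗ[ℂ] U ⊗[ℂ] V) : U ⊗[ℂ] (V ⊗[ℂ] V) →ₗ[ℂ] U ⊗[ℂ] (V ⊗[ℂ] V) :=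
  leg23 U (TensorProduct.comm ℂ V V).toLinearMap ∘ₗ leg12 T ∘ₗ
    leg23 U (TensorProduct.comm ℂ V V).toLinearMap

/-- `(α ⊗ ι)α = (ι ⊗ Δ)α`, written with right coverings. Here `T (x ⊗ a) = α(x)(1 ⊗ a)` and
`D (a ⊗ b) = Δ(a)(1 ⊗ b)`. Applied to `x ⊗ p ⊗ q`, the left hand side is
`((α ⊗ ι)α)(x) (1 ⊗ Δ(p)(1 ⊗ q))`, and the right hand side is
`(ι ⊗ Δ)(α(x)(1 ⊗ p)) (1 ⊗ 1 ⊗ q) = ((ι ⊗ Δ)α)(x) (1 ⊗ Δ(p)(1 ⊗ q))`. -/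
def CoveredCoassoc (T : U ⊗[ℂ] V →ₗ[ℂ] U ⊗[ℂ] V) (D : V ⊗[ℂ] V →ₗ[ℂ] V ⊗[ℂ] V) : Prop :=
  leg12 T ∘ₗ leg13 T ∘ₗ leg23 U D = leg23 U D ∘ₗ leg12 T

end Slices

open Multiplier

/-- A regular multiplier Hopf `*`-algebra. The four linear bijections of `A ⊗ A` are determined by
the comultiplication through the equation that follows each of them. -/
structure MultiplierHopfStarAlgebra (A : Type*) [NonUnitalRing A] [Module ℂ A]
    [IsScalarTower ℂ A A] [SMulCommClass ℂ A A] [StarRing A] [StarModule ℂ A] where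
  nondegenerate : Nondegenerate A
  comul : A →ₙₐ[ℂ] Multiplier (A ⊗[ℂ] A)
  comul_left_nondeg :
    Submodule.span ℂ {t : A ⊗[ℂ] A | ∃ a s, t = left (comul a) s} = ⊤
  comul_right_nondeg :
    Submodule.span ℂ {t : A ⊗[ℂ] A | ∃ a s, t = right (comul a) s} = ⊤
  TΔ2 : A ⊗[ℂ] A ≃ₗ[ℂ] A ⊗[ℂ] A
  TΔ2_spec : ∀ a b, incl (TΔ2 (a ⊗ₜ b)) = comul a * tensor 1 (incl b)
  T1Δ : A ⊗[ℂ] A ≃ₗ[ℂ] A ⊗[ℂ] A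
  T1Δ_spec : ∀ a b, incl (T1Δ (a ⊗ₜ b)) = tensor (incl a) 1 * comul b
  TΔ1 : A ⊗[ℂ] A ≃ₗ[ℂ] A ⊗[ℂ] A
  TΔ1_spec : ∀ a b, incl (TΔ1 (a ⊗ₜ b)) = comul a * tensor (incl b) 1
  T2Δ : A ⊗[ℂ] A ≃ₗ[ℂ] A ⊗[ℂ] A
  T2Δ_spec : ∀ a b, incl (T2Δ (a ⊗ₜ b)) = tensor 1 (incl a) * comul b
  coassoc : CoveredCoassoc TΔ2.toLinearMap TΔ2.toLinearMap
  comul_star : ∀ a, comul (star a) = star (comul a)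

/-- A `*`-algebraic quantum group, with a fixed non-zero positive left invariant functional. -/
structure StarAlgebraicQuantumGroup (A : Type*) [NonUnitalRing A] [Module ℂ A]
    [IsScalarTower ℂ A A] [SMulCommClass ℂ A A] [StarRing A] [StarModule ℂ A]
    extends MultiplierHopfStarAlgebra A where
  haar : A →ₗ[ℂ] ℂ
  haar_ne_zero : haar ≠ 0
  haar_leftInvariant : ∀ a b, sliceRight haar (TΔ1 (a ⊗ₜ b)) = haar a • b
  haar_positive : IsPositive haar

namespace StarAlgebraicQuantumGroup

variable {A : Type*} [NonUnitalRing A] [Module ℂ A] [IsScalarTower ℂ A A] [SMulCommClass ℂ A A]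
  [StarRing A] [StarModule ℂ A]

/-- `ε` is the counit: a homomorphism with `(ε ⊗ ι)(Δ(a)(1 ⊗ b)) = ab = (ι ⊗ ε)((a ⊗ 1)Δ(b))`. -/
def IsCounit (Q : StarAlgebraicQuantumGroup A) (ε : A →ₗ[ℂ] ℂ) : Prop :=
  (∀ a b, ε (a * b) = ε a * ε b) ∧
  (∀ a b, sliceLeft ε (Q.TΔ2 (a ⊗ₜ b)) = a * b) ∧
  (∀ a b, sliceRight ε (Q.T1Δ (a ⊗ₜ b)) = a * b)

/-- `S` is the antipode (with respect to the counit `ε`): a linear anti-automorphism with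
`S(a₍₁₎)a₍₂₎b = ε(a)b` and `a b₍₁₎S(b₍₂₎) = ε(b)a`. -/
def IsAntipode (Q : StarAlgebraicQuantumGroup A) (ε : A →ₗ[ℂ] ℂ) (S : A ≃ₗ[ℂ] A) : Prop :=
  (∀ a b, S (a * b) = S b * S a) ∧
  (∀ a b, LinearMap.mul' ℂ A (LinearMap.rTensor A S.toLinearMap (Q.TΔ2 (a ⊗ₜ b))) = ε a • b) ∧
  (∀ a b, LinearMap.mul' ℂ A (LinearMap.lTensor A S.toLinearMap (Q.T1Δ (a ⊗ₜ b))) = ε b • a)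

/-- The underlying space of the dual: the functionals `φ(· a)` with `a ∈ A`. -/
def dual (Q : StarAlgebraicQuantumGroup A) : Submodule ℂ (A →ₗ[ℂ] ℂ) :=
  LinearMap.range ((LinearMap.mul ℂ A).flip.compr₂ Q.haar)

/-- `Φ` is the left integral of the dual: `Φ(ψ(a ·)) = ε(a)`, where `ψ = φ ∘ S`. -/
def IsDualIntegral (Q : StarAlgebraicQuantumGroup A) (ε : A →ₗ[ℂ] ℂ) (S : A ≃ₗ[ℂ] A)
    (Φ : Q.dual →ₗ[ℂ] ℂ) : Prop :=
  ∀ (a : A) (ω : Q.dual), (∀ x, ω.1 x = Q.haar (S (a * x))) → Φ ω = ε a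

/-- `d` is the modular element of the dual, `(Φ ⊗ ι)Δ̂(ω) = Φ(ω) d`. Elements of the multiplier
algebra of the dual are viewed as functionals on `A`; as `Δ̂(ω)(x ⊗ y) = ω(xy)`, the left hand side
is the functional sending `y` to `Φ(ω(· y))`. -/
def IsDualModularElement (Q : StarAlgebraicQuantumGroup A) (Φ : Q.dual →ₗ[ℂ] ℂ)
    (d : A →ₗ[ℂ] ℂ) : Prop :=
  ∀ (ω ω' : Q.dual) (y : A), (∀ x, ω'.1 x = ω.1 (x * y)) → Φ ω' = Φ ω * d y

end StarAlgebraicQuantumGroup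

/-- A right Galois object `(X, α)` for `A` such that `X` is a `*`-algebra and `α` is
`*`-preserving. The maps `T₁`, `T₂` and `V` are determined by the coaction. As the algebra of
coinvariants consists of the scalars only, the Galois map `V` is defined on the tensor product
of `X` with itself over the base field. -/
structure StarGaloisObject {A : Type*} [NonUnitalRing A] [Module ℂ A]
    [IsScalarTower ℂ A A] [SMulCommClass ℂ A A] [StarRing A] [StarModule ℂ A]
    (Q : StarAlgebraicQuantumGroup A)
    (X : Type*) [NonUnitalRing X] [Module ℂ X]
    [IsScalarTower ℂ X X] [SMulCommClass ℂ X X] [StarRing X] [StarModule ℂ X] where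
  nondegenerate : Nondegenerate X
  coaction : X →ₙₐ[ℂ] Multiplier (X ⊗[ℂ] A)
  coaction_injective : Function.Injective coaction
  T₁ : X ⊗[ℂ] A →ₗ[ℂ] X ⊗[ℂ] A
  T₁_spec : ∀ x a, incl (T₁ (x ⊗ₜ a)) = coaction x * tensor 1 (incl a)
  T₂ : X ⊗[ℂ] A →ₗ[ℂ] X ⊗[ℂ] A
  T₂_spec : ∀ x a, incl (T₂ (x ⊗ₜ a)) = tensor 1 (incl a) * coaction x
  coassoc : CoveredCoassoc T₁ Q.TΔ2.toLinearMap
  coaction_star : ∀ x, coaction (star x) = star (coaction x)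
  /-- Every `f ∈ M(X)` with `α(f) = f ⊗ 1` is a scalar. -/
  coinvariants : ∀ f : Multiplier X,
    (∀ x, coaction (left f x) = tensor f 1 * coaction x) →
    (∀ x, coaction (right f x) = coaction x * tensor f 1) →
    ∃ c : ℂ, f = algebraMap ℂ (Multiplier X) c
  /-- The coaction is reduced, and the Galois map `x ⊗ y ↦ (x ⊗ 1)α(y)` is bijective. -/
  V : X ⊗[ℂ] X ≃ₗ[ℂ] X ⊗[ℂ] A
  V_spec : ∀ x y, incl (V (x ⊗ₜ y)) = tensor (incl x) 1 * coaction y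

namespace StarGaloisObject

variable {A : Type*} [NonUnitalRing A] [Module ℂ A] [IsScalarTower ℂ A A] [SMulCommClass ℂ A A]
  [StarRing A] [StarModule ℂ A] {Q : StarAlgebraicQuantumGroup A}
  {X : Type*} [NonUnitalRing X] [Module ℂ X] [IsScalarTower ℂ X X] [SMulCommClass ℂ X X]
  [StarRing X] [StarModule ℂ X]

/-- `(ω ⊗ ι)α(x) = ω(x)1` in `M(A)`, for all `x`. -/
def IsInvariant (G : StarGaloisObject Q X) (ω : X →ₗ[ℂ] ℂ) : Prop :=
  ∀ x a, sliceLeft ω (G.T₁ (x ⊗ₜ a)) = ω x • a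

/-- The structure maps of a Galois object belonging to an invariant functional `ψX`, each with the
property that determines it. Equalities in `M(X)` are tested by multiplying from the left with
elements of `X`. -/
structure StructureMaps (G : StarGaloisObject Q X) (ψX : X →ₗ[ℂ] ℂ) where
  /-- the functional with `(ι ⊗ φ)α(x) = φX(x)1` -/
  φX : X →ₗ[ℂ] ℂ
  φX_spec : ∀ z x, sliceRight Q.haar (G.V (z ⊗ₜ x)) = φX x • z
  /-- the modular element: `φX(x δX) = ψX(x)` -/
  δX : (Multiplier X)ˣ
  δX_spec : ∀ x, φX (right δX.1 x) = ψX x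
  /-- the modular automorphism of `φX` -/
  σX : X ≃ₗ[ℂ] X
  σX_mul : ∀ x y, σX (x * y) = σX x * σX y
  σX_spec : ∀ x y, φX (y * σX x) = φX (x * y)
  /-- the counit of `A` -/
  ε : A →ₗ[ℂ] ℂ
  ε_spec : Q.IsCounit ε
  /-- the antipode of `A` -/
  S : A ≃ₗ[ℂ] A
  S_spec : Q.IsAntipode ε S
  /-- the left integral of the dual of `A` -/
  dualIntegral : Q.dual →ₗ[ℂ] ℂ
  dualIntegral_spec : Q.IsDualIntegral ε S dualIntegral
  /-- the modular element of the dual of `A`, as a functional on `A` -/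
  dualδ : A →ₗ[ℂ] ℂ
  dualδ_spec : Q.IsDualModularElement dualIntegral dualδ
  /-- the action of `dualδ` on `X`, that is `x ↦ (ι ⊗ dualδ)α(x)` -/
  dualδAct : X →ₗ[ℂ] X
  dualδAct_spec : ∀ z x, z * dualδAct x = sliceRight dualδ (G.V (z ⊗ₜ x))

/-- `θX(x) = σX(δ̂ · x)`. -/
def StructureMaps.θX {G : StarGaloisObject Q X} {ψX : X →ₗ[ℂ] ℂ} (D : G.StructureMaps ψX) :
    X →ₗ[ℂ] X :=
  D.σX.toLinearMap ∘ₗ D.dualδAct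

end StarGaloisObject

end StarGalois

end

/-! Write h for φ_X. The form h(y⋆x) makes X a pre-Hilbert space on which multiplication by δ_X, σ_X
and the action K of the dual modular element are symmetric up to scalars. The proof shows that
suitable combinations of these maps are locally finite, hence diagonalizable, and that the scalars
by which they fail to commute are all 1.

Functionals. The multiplier (ι ⊗ φ)α(x) is coinvariant, hence a scalar h(x) (`exists_leftInv`). For
a positive ω the functional ω ⊗ φ is positive by the Schur product theorem, and its value on the
square of α(x)(z ⊗ 1) is ω(z⋆z)h(x⋆x); so h is positive (`LeftInv.positive`). Faithfulness of φ
passes to h, and the form is definite. Averaging with the right integral of A gives an invariant ψ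
(`exists_rightInv`), unique up to a scalar (`rightInv_unique`). The functionals h(· v) and ψ(· w)
form the same space, whence δ_X; the modular automorphism of φ on A induces σ_X.

Local finiteness. By `LeftInv.mul_actL` and `LeftInv.actR_mul`, slicing (u ⊗ c)α(y) or α(y)(u ⊗ c)
with φ gives a slice of a tensor that does not depend on y. Write x ⊗ a = Σ α(v)(u ⊗ 1) and replace
v by δ_X²ᵐv. As α(δ_X v) = (δ_X ⊗ δ)α(v), slicing with φ(a⋆ ·) gives φ(a⋆δ²ᵐa) δ_X²ᵐx. This is a
non-zero multiple of δ_X²ᵐx, yet it lies in one finite-dimensional space for all m. A variant treats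
K⁻¹. For σ_X one uses N = σ_X σ_ψ K instead, with σ_ψ the modular automorphism of ψ: it is
multiplicative and commutes with the action of functionals on A. A symmetric, locally finite map is
spanned by eigenvectors (`le_iSup_eigenspace`).

Scalars and signs. If uδ_X = ζu and δ_X w = λw, then the slices of (u ⊗ 1)α(w) are eigenvectors of δ
with eigenvalue λ/ζ, and δ is positive; so λ/ζ > 0 (`div_pos_of_eigenvectors`). Hence a multiple of
ψ is positive. This and the positivity of σ_X force the commutation scalars to be 1 (`dualMod_δ`,
`h_l`).

Conclusion. Left and right multiplication by δ_X, K⁻¹ and N commute and are jointly diagonalizable.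
On a joint eigenvector σ_X² is a positive scalar, and positivity of σ_X makes the vector an
eigenvector of σ_X.

The coaction lemmas are stated for `Coact`, which covers both X and A coacting on itself by Δ; the
condition on coinvariants enters only in `exists_leftInv`. -/

set_option linter.unusedSectionVars false
noncomputable section
namespace StarGalois
open Multiplier LinearMap

/-! ### Slices of tensors and separating families -/

section SliceLemmas

variable {U V U' V' : Type*} [AddCommGroup U] [Module ℂ U] [AddCommGroup V] [Module ℂ V]
  [AddCommGroup U'] [Module ℂ U'] [AddCommGroup V'] [Module ℂ V']

@[simp] theorem sliceRight_tmul (f : V →ₗ[ℂ] ℂ) (u : U) (v : V) :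
    sliceRight f (u ⊗ₜ[ℂ] v) = f v • u := by simp [sliceRight]

@[simp] theorem sliceLeft_tmul (f : U →ₗ[ℂ] ℂ) (u : U) (v : V) :
    sliceLeft f (u ⊗ₜ[ℂ] v) = f u • v := by simp [sliceLeft]

theorem sliceRight_rTensor (f : V →ₗ[ℂ] ℂ) (g : U →ₗ[ℂ] U') (t : U ⊗[ℂ] V) :
    sliceRight f (rTensor V g t) = g (sliceRight f t) := by
  induction t with
  | zero => simp
  | add s t hs ht => simp [hs, ht]
  | tmul u v => simp

theorem sliceRight_lTensor (f : V' →ₗ[ℂ] ℂ) (g : V →ₗ[ℂ] V') (t : U ⊗[ℂ] V) :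
    sliceRight f (lTensor U g t) = sliceRight (f ∘ₗ g) t := by
  induction t with
  | zero => simp
  | add s t hs ht => simp [hs, ht]
  | tmul u v => simp

theorem sliceLeft_lTensor (f : U →ₗ[ℂ] ℂ) (g : V →ₗ[ℂ] V') (t : U ⊗[ℂ] V) :
    sliceLeft f (lTensor U g t) = g (sliceLeft f t) := by
  induction t with
  | zero => simp
  | add s t hs ht => simp [hs, ht]
  | tmul u v => simp

theorem sliceLeft_rTensor (f : U' →ₗ[ℂ] ℂ) (g : U →ₗ[ℂ] U') (t : U ⊗[ℂ] V) :
    sliceLeft f (rTensor V g t) = sliceLeft (f ∘ₗ g) t := by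
  induction t with
  | zero => simp
  | add s t hs ht => simp [hs, ht]
  | tmul u v => simp

theorem apply_sliceRight (ω : U →ₗ[ℂ] ℂ) (f : V →ₗ[ℂ] ℂ) (t : U ⊗[ℂ] V) :
    ω (sliceRight f t) = f (sliceLeft ω t) := by
  induction t with
  | zero => simp
  | add s t hs ht => simp [hs, ht]
  | tmul u v => simp [mul_comm]

theorem exists_functional_ne_zero {u : U} (hu : u ≠ 0) : ∃ ω : U →ₗ[ℂ] ℂ, ω u = 1 :=
by
  have h := (Module.forall_dual_apply_eq_zero_iff ℂ u).not.mpr hu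
  push Not at h
  obtain ⟨f, hf⟩ := h
  exact ⟨(f u)⁻¹ • f, by simp [hf]⟩

theorem eq_zero_of_functional {u : U} (h : ∀ ω : U →ₗ[ℂ] ℂ, ω u = 0) : u = 0 := by
  by_contra hu
  obtain ⟨ω, hω⟩ := exists_functional_ne_zero hu
  simp [h ω] at hω

/-- The coordinates of `t` with respect to a basis of `U` are its slices along the coordinate
functionals. -/
theorem eq_zero_of_sliceLeft {t : U ⊗[ℂ] V} (h : ∀ ω : U →ₗ[ℂ] ℂ, sliceLeft ω t = 0) : t = 0 := by
  classical
  let b := Module.Basis.ofVectorSpace ℂ U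
  have key : ∀ (i) (s : U ⊗[ℂ] V),
      TensorProduct.equivFinsuppOfBasisLeft b s i = sliceLeft (b.coord i) s := by
    intro i s
    induction s with
    | zero => simp
    | add s t hs ht => simp [hs, ht]
    | tmul u v => simp
  apply (TensorProduct.equivFinsuppOfBasisLeft (N := V) b).injective
  ext i
  rw [key, h, map_zero]
  rfl

/-- A separating family of functionals on the second factor separates the tensor product. -/
theorem eq_zero_of_sliceRight {ι : Type*} {f : ι → V →ₗ[ℂ] ℂ}
    (hf : ∀ v, (∀ i, f i v = 0) → v = 0) {t : U ⊗[ℂ] V} (h : ∀ i, sliceRight (f i) t = 0) :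
    t = 0 := by
  apply eq_zero_of_sliceLeft
  intro ω
  apply hf
  intro i
  rw [← apply_sliceRight, h, map_zero]

theorem eq_of_sliceRight {ι : Type*} {f : ι → V →ₗ[ℂ] ℂ}
    (hf : ∀ v, (∀ i, f i v = 0) → v = 0) {s t : U ⊗[ℂ] V}
    (h : ∀ i, sliceRight (f i) s = sliceRight (f i) t) : s = t := by
  rw [← sub_eq_zero]
  apply eq_zero_of_sliceRight hf
  intro i
  rw [map_sub, h, sub_self]

theorem eq_of_forall_sliceRight {s t : U ⊗[ℂ] V}
    (h : ∀ f : V →ₗ[ℂ] ℂ, sliceRight f s = sliceRight f t) : s = t :=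
  eq_of_sliceRight (f := id) (fun _ hv => eq_zero_of_functional hv) h

theorem eq_of_forall_sliceLeft {s t : U ⊗[ℂ] V}
    (h : ∀ f : U →ₗ[ℂ] ℂ, sliceLeft f s = sliceLeft f t) : s = t := by
  rw [← sub_eq_zero]
  apply eq_zero_of_sliceLeft
  intro ω
  rw [map_sub, h, sub_self]

/-- With `g` the family of multiplications, separating by non-degeneracy, an identity of tensors may
be checked after covering one leg. -/
theorem eq_of_lTensor {ι : Type*} {g : ι → V →ₗ[ℂ] V'}
    (hg : ∀ v, (∀ i, g i v = 0) → v = 0) {s t : U ⊗[ℂ] V}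
    (h : ∀ i, lTensor U (g i) s = lTensor U (g i) t) : s = t := by
  rw [← sub_eq_zero]
  apply eq_zero_of_sliceLeft
  intro ω
  apply hg
  intro i
  rw [← sliceLeft_lTensor, map_sub, h, sub_self, map_zero]

theorem eq_of_rTensor {ι : Type*} {g : ι → U →ₗ[ℂ] U'}
    (hg : ∀ v, (∀ i, g i v = 0) → v = 0) {s t : U ⊗[ℂ] V}
    (h : ∀ i, rTensor V (g i) s = rTensor V (g i) t) : s = t := by
  apply eq_of_forall_sliceRight
  intro f
  rw [← sub_eq_zero, ← map_sub]
  apply hg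
  intro i
  rw [← sliceRight_rTensor, map_sub, h, sub_self, map_zero]

theorem tmul_ne_zero {u : U} {v : V} (hu : u ≠ 0) (hv : v ≠ 0) : u ⊗ₜ[ℂ] v ≠ 0 := by
  obtain ⟨ω, hω⟩ := exists_functional_ne_zero hu
  intro h
  have := congrArg (sliceLeft ω) h
  simp [hω, hv] at this

/-- All slices of a tensor lie in one finite-dimensional subspace. -/
theorem exists_finiteDimensional_sliceRight (t : U ⊗[ℂ] V) :
    ∃ F : Submodule ℂ U, FiniteDimensional ℂ F ∧ ∀ f : V →ₗ[ℂ] ℂ, sliceRight f t ∈ F := by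
  induction t with
  | zero => exact ⟨⊥, inferInstance, by simp⟩
  | add s t hs ht =>
    obtain ⟨F, hF, h⟩ := hs
    obtain ⟨F', hF', h'⟩ := ht
    refine ⟨F ⊔ F', inferInstance, fun f => ?_⟩
    rw [map_add]
    exact add_mem (Submodule.mem_sup_left (h f)) (Submodule.mem_sup_right (h' f))
  | tmul u v =>
    refine ⟨ℂ ∙ u, inferInstance, fun f => ?_⟩
    rw [sliceRight_tmul]
    exact Submodule.smul_mem _ _ (Submodule.mem_span_singleton_self u)

end SliceLemmas

/-! ### Non-degeneracy and multipliers -/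

section MultiplierLemmas

variable {B C : Type*}
variable [NonUnitalRing B] [Module ℂ B] [IsScalarTower ℂ B B] [SMulCommClass ℂ B B]
variable [NonUnitalRing C] [Module ℂ C] [IsScalarTower ℂ C C] [SMulCommClass ℂ C C]

theorem Nondegenerate.mulRight_sep (h : Nondegenerate B) :
    ∀ v : B, (∀ b, mulRight ℂ b v = 0) → v = 0 := fun v hv => h.1 v hv

theorem Nondegenerate.mulLeft_sep (h : Nondegenerate B) :
    ∀ v : B, (∀ b, mulLeft ℂ b v = 0) → v = 0 := fun v hv => h.2 v hv

theorem Nondegenerate.eq_of_mul_right (h : Nondegenerate B) {a b : B}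
    (hab : ∀ c, a * c = b * c) : a = b := by
  rw [← sub_eq_zero]
  exact h.1 _ fun c => by rw [sub_mul, hab, sub_self]

theorem Nondegenerate.eq_of_mul_left (h : Nondegenerate B) {a b : B}
    (hab : ∀ c, c * a = c * b) : a = b := by
  rw [← sub_eq_zero]
  exact h.2 _ fun c => by rw [mul_sub, hab, sub_self]

theorem mul_tmul_eq (s : B ⊗[ℂ] C) (b : B) (c : C) :
    s * (b ⊗ₜ c) = lTensor B (mulRight ℂ c) (rTensor C (mulRight ℂ b) s) := by
  induction s with
  | zero => simp
  | add s t hs ht => simp only [add_mul, hs, ht, map_add]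
  | tmul x y => simp

theorem tmul_mul_eq (s : B ⊗[ℂ] C) (b : B) (c : C) :
    (b ⊗ₜ c) * s = lTensor B (mulLeft ℂ c) (rTensor C (mulLeft ℂ b) s) := by
  induction s with
  | zero => simp
  | add s t hs ht => simp only [mul_add, hs, ht, map_add]
  | tmul x y => simp

theorem Nondegenerate.tensor (hB : Nondegenerate B) (hC : Nondegenerate C) :
    Nondegenerate (B ⊗[ℂ] C) := by
  constructor
  · intro s hs
    apply eq_of_rTensor hB.mulRight_sep
    intro b
    apply eq_of_lTensor hC.mulRight_sep
    intro c
    rw [← mul_tmul_eq, hs]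
    simp
  · intro s hs
    apply eq_of_rTensor hB.mulLeft_sep
    intro b
    apply eq_of_lTensor hC.mulLeft_sep
    intro c
    rw [← tmul_mul_eq, hs]
    simp

@[simp] theorem left_mul (m n : Multiplier B) (b : B) : left (m * n) b = left m (left n b) := rfl
@[simp] theorem right_mul (m n : Multiplier B) (b : B) : right (m * n) b = right n (right m b) := rfl
@[simp] theorem left_one (b : B) : left (1 : Multiplier B) b = b := rfl
@[simp] theorem right_one (b : B) : right (1 : Multiplier B) b = b := rfl
@[simp] theorem left_incl (a b : B) : left (incl a) b = a * b := rfl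
@[simp] theorem right_incl (a b : B) : right (incl a) b = b * a := rfl
@[simp] theorem left_mk (l r : B →ₗ[ℂ] B) (h) : left (mk l r h) = l := rfl
@[simp] theorem right_mk (l r : B →ₗ[ℂ] B) (h) : right (mk l r h) = r := rfl

theorem left_tensor_incl_one (b : B) (t : B ⊗[ℂ] C) :
    left (tensor (incl b) (1 : Multiplier C)) t = rTensor C (mulLeft ℂ b) t := rfl
theorem right_tensor_incl_one (b : B) (t : B ⊗[ℂ] C) :
    right (tensor (incl b) (1 : Multiplier C)) t = rTensor C (mulRight ℂ b) t := rfl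
theorem left_tensor_one_incl (c : C) (t : B ⊗[ℂ] C) :
    left (tensor (1 : Multiplier B) (incl c)) t = lTensor B (mulLeft ℂ c) t := rfl
theorem right_tensor_one_incl (c : C) (t : B ⊗[ℂ] C) :
    right (tensor (1 : Multiplier B) (incl c)) t = lTensor B (mulRight ℂ c) t := rfl

theorem multiplier_ext {m n : Multiplier B} (hl : ∀ b, left m b = left n b)
    (hr : ∀ b, right m b = right n b) : m = n := by
  apply Subtype.ext
  apply Prod.ext
  · exact LinearMap.ext hl
  · apply MulOpposite.unop_injective
    exact LinearMap.ext hr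

theorem left_apply_mul (h : Nondegenerate B) (m : Multiplier B) (a b : B) :
    left m (a * b) = left m a * b := by
  apply h.eq_of_mul_left
  intro c
  rw [mul_left_eq, ← mul_assoc, ← mul_assoc, mul_left_eq]

end MultiplierLemmas

end StarGalois
end

/-! ### Coactions with bijective Galois map and their covered identities -/

noncomputable section
namespace StarGalois
open Multiplier LinearMap

variable {A : Type*} [NonUnitalRing A] [Module ℂ A] [IsScalarTower ℂ A A] [SMulCommClass ℂ A A]
  [StarRing A] [StarModule ℂ A]
  {X : Type*} [NonUnitalRing X] [Module ℂ X] [IsScalarTower ℂ X X] [SMulCommClass ℂ X X]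
  [StarRing X] [StarModule ℂ X]

/-- A reduced coaction on a `*`-algebra whose Galois map is bijective, without a condition on the
coinvariants. -/
structure Coact (Q : StarAlgebraicQuantumGroup A) (X : Type*) [NonUnitalRing X] [Module ℂ X]
    [IsScalarTower ℂ X X] [SMulCommClass ℂ X X] [StarRing X] [StarModule ℂ X] where
  nondegenerate : Nondegenerate X
  coaction : X →ₙₐ[ℂ] Multiplier (X ⊗[ℂ] A)
  T₁ : X ⊗[ℂ] A →ₗ[ℂ] X ⊗[ℂ] A
  T₁_spec : ∀ x a, incl (T₁ (x ⊗ₜ a)) = coaction x * tensor 1 (incl a)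
  T₂ : X ⊗[ℂ] A →ₗ[ℂ] X ⊗[ℂ] A
  T₂_spec : ∀ x a, incl (T₂ (x ⊗ₜ a)) = tensor 1 (incl a) * coaction x
  coassoc : CoveredCoassoc T₁ Q.TΔ2.toLinearMap
  coaction_star : ∀ x, coaction (star x) = star (coaction x)
  V : X ⊗[ℂ] X ≃ₗ[ℂ] X ⊗[ℂ] A
  V_spec : ∀ x y, incl (V (x ⊗ₜ y)) = tensor (incl x) 1 * coaction y

/-- The coaction underlying a Galois object. -/
def StarGaloisObject.toCoact {Q : StarAlgebraicQuantumGroup A} (G : StarGaloisObject Q X) :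
    Coact Q X where
  nondegenerate := G.nondegenerate
  coaction := G.coaction
  T₁ := G.T₁
  T₁_spec := G.T₁_spec
  T₂ := G.T₂
  T₂_spec := G.T₂_spec
  coassoc := G.coassoc
  coaction_star := G.coaction_star
  V := G.V
  V_spec := G.V_spec

/-- The coaction of a quantum group on itself by the comultiplication. -/
def StarAlgebraicQuantumGroup.self (Q : StarAlgebraicQuantumGroup A) : Coact Q A where
  nondegenerate := Q.nondegenerate
  coaction := Q.comul
  T₁ := Q.TΔ2.toLinearMap
  T₁_spec := Q.TΔ2_spec
  T₂ := Q.T2Δ.toLinearMap ∘ₗ (TensorProduct.comm ℂ A A).toLinearMap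
  T₂_spec := fun x a => Q.T2Δ_spec a x
  coassoc := Q.coassoc
  coaction_star := Q.comul_star
  V := Q.T1Δ
  V_spec := Q.T1Δ_spec

namespace Coact

variable {Q : StarAlgebraicQuantumGroup A} (P : Coact Q X)

theorem nondeg (P : Coact Q X) : Nondegenerate (X ⊗[ℂ] A) := P.nondegenerate.tensor Q.nondegenerate

/-- Left multiplication by `α(x)`. -/
def L (x : X) : X ⊗[ℂ] A →ₗ[ℂ] X ⊗[ℂ] A := left (P.coaction x)

/-- Right multiplication by `α(x)`. -/
def R (x : X) : X ⊗[ℂ] A →ₗ[ℂ] X ⊗[ℂ] A := right (P.coaction x)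

theorem mul_L (x : X) (s t : X ⊗[ℂ] A) : s * P.L x t = P.R x s * t := mul_left_eq _ s t

theorem L_mul (x y : X) (t : X ⊗[ℂ] A) : P.L (x * y) t = P.L x (P.L y t) := by
  simp [L, map_mul]

theorem L_apply_mul (x : X) (s t : X ⊗[ℂ] A) : P.L x (s * t) = P.L x s * t :=
  left_apply_mul P.nondeg _ s t

theorem T₁_mul (x : X) (a : A) (t : X ⊗[ℂ] A) :
    P.T₁ (x ⊗ₜ a) * t = P.L x (lTensor X (mulLeft ℂ a) t) :=
  congrArg (fun m => left m t) (P.T₁_spec x a)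

theorem T₂_mul (x : X) (a : A) (t : X ⊗[ℂ] A) :
    P.T₂ (x ⊗ₜ a) * t = lTensor X (mulLeft ℂ a) (P.L x t) :=
  congrArg (fun m => left m t) (P.T₂_spec x a)

theorem V_mul (z x : X) (t : X ⊗[ℂ] A) :
    P.V (z ⊗ₜ x) * t = rTensor A (mulLeft ℂ z) (P.L x t) :=
  congrArg (fun m => left m t) (P.V_spec z x)

theorem mul_V (z x : X) (t : X ⊗[ℂ] A) :
    t * P.V (z ⊗ₜ x) = P.R x (rTensor A (mulRight ℂ z) t) :=
  congrArg (fun m => right m t) (P.V_spec z x)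

end Coact

section TensorMul

theorem lTensor_mulLeft_mul (a : A) (s t : X ⊗[ℂ] A) :
    lTensor X (mulLeft ℂ a) s * t = lTensor X (mulLeft ℂ a) (s * t) := by
  induction s with
  | zero => simp
  | add s s' hs hs' => simp only [map_add, add_mul, hs, hs']
  | tmul x b =>
    induction t with
    | zero => simp
    | add t t' ht ht' => simp only [map_add, mul_add, ht, ht']
    | tmul y c => simp [mul_assoc]

theorem rTensor_mulLeft_mul (z : X) (s t : X ⊗[ℂ] A) :
    rTensor A (mulLeft ℂ z) s * t = rTensor A (mulLeft ℂ z) (s * t) := by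
  induction s with
  | zero => simp
  | add s s' hs hs' => simp only [map_add, add_mul, hs, hs']
  | tmul x b =>
    induction t with
    | zero => simp
    | add t t' ht ht' => simp only [map_add, mul_add, ht, ht']
    | tmul y c => simp [mul_assoc]

theorem lTensor_mulRight_mul (a : A) (s t : X ⊗[ℂ] A) :
    lTensor X (mulRight ℂ a) s * t = s * lTensor X (mulLeft ℂ a) t := by
  induction s with
  | zero => simp
  | add s s' hs hs' => simp only [map_add, add_mul, hs, hs']
  | tmul x b =>
    induction t with
    | zero => simp
    | add t t' ht ht' => simp only [map_add, mul_add, ht, ht']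
    | tmul y c => simp [mul_assoc]

theorem rTensor_mulRight_mul (z : X) (s t : X ⊗[ℂ] A) :
    rTensor A (mulRight ℂ z) s * t = s * rTensor A (mulLeft ℂ z) t := by
  induction s with
  | zero => simp
  | add s s' hs hs' => simp only [map_add, add_mul, hs, hs']
  | tmul x b =>
    induction t with
    | zero => simp
    | add t t' ht ht' => simp only [map_add, mul_add, ht, ht']
    | tmul y c => simp [mul_assoc]

theorem lTensor_rTensor_comm {U V U' V' : Type*} [AddCommGroup U] [Module ℂ U] [AddCommGroup V]
    [Module ℂ V] [AddCommGroup U'] [Module ℂ U'] [AddCommGroup V'] [Module ℂ V']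
    (f : U →ₗ[ℂ] U') (g : V →ₗ[ℂ] V') (t : U ⊗[ℂ] V) :
    lTensor U' g (rTensor V f t) = rTensor V' f (lTensor U g t) := by
  induction t with
  | zero => simp
  | add s t hs ht => simp only [map_add, hs, ht]
  | tmul x y => simp

end TensorMul

namespace Coact

variable {Q : StarAlgebraicQuantumGroup A} (P : Coact Q X)

/-- Products such as (z ⊗ 1)α(x) live in X ⊗ A only through `V`, `T₁`, `T₂`. Multiplying by an
arbitrary `u` turns the identities between them into associativity in the multiplier algebra. -/
theorem ext_mul (P : Coact Q X) {s t : X ⊗[ℂ] A} (h : ∀ u, s * u = t * u) : s = t :=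
  P.nondeg.eq_of_mul_right h

theorem R_tmul (x z : X) (c : A) :
    P.R x (z ⊗ₜ c) = lTensor X (mulLeft ℂ c) (P.V (z ⊗ₜ x)) := by
  apply P.ext_mul
  intro u
  rw [← mul_L, lTensor_mulLeft_mul, V_mul, tmul_mul_eq]

theorem R_V (y z x : X) : P.R y (P.V (z ⊗ₜ x)) = P.V (z ⊗ₜ (x * y)) := by
  apply P.ext_mul
  intro u
  rw [← mul_L, V_mul, V_mul, L_mul]

theorem lmul_T₁ (z x : X) (a : A) :
    rTensor A (mulLeft ℂ z) (P.T₁ (x ⊗ₜ a)) = lTensor X (mulRight ℂ a) (P.V (z ⊗ₜ x)) := by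
  apply P.ext_mul
  intro u
  rw [rTensor_mulLeft_mul, T₁_mul, lTensor_mulRight_mul, V_mul]

theorem lmul_T₂ (z x : X) (a : A) :
    rTensor A (mulLeft ℂ z) (P.T₂ (x ⊗ₜ a)) = lTensor X (mulLeft ℂ a) (P.V (z ⊗ₜ x)) := by
  apply P.ext_mul
  intro u
  rw [rTensor_mulLeft_mul, T₂_mul, lTensor_mulLeft_mul, V_mul, lTensor_rTensor_comm]

theorem lmul_T₁_eq (x : X) (a b : A) :
    lTensor X (mulLeft ℂ b) (P.T₁ (x ⊗ₜ a)) = lTensor X (mulRight ℂ a) (P.T₂ (x ⊗ₜ b)) := by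
  apply P.ext_mul
  intro u
  rw [lTensor_mulLeft_mul, T₁_mul, lTensor_mulRight_mul, T₂_mul]

theorem R_T₂ (x y : X) (a : A) : P.R y (P.T₂ (x ⊗ₜ a)) = P.T₂ ((x * y) ⊗ₜ a) := by
  apply P.ext_mul
  intro u
  rw [← mul_L, T₂_mul, T₂_mul, L_mul]

theorem L_T₁ (x y : X) (a : A) : P.L x (P.T₁ (y ⊗ₜ a)) = P.T₁ ((x * y) ⊗ₜ a) := by
  apply P.ext_mul
  intro u
  rw [← L_apply_mul, T₁_mul, T₁_mul, L_mul]

/-- The map `z ⊗ x ↦ α(x)(z ⊗ 1)`. -/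
def V' : X ⊗[ℂ] X ≃ₗ[ℂ] X ⊗[ℂ] A where
  toFun t := star (P.V (star t))
  map_add' s t := by simp
  map_smul' c t := by simp
  invFun t := star (P.V.symm (star t))
  left_inv t := by simp
  right_inv t := by simp

theorem V'_tmul (z x : X) : P.V' (z ⊗ₜ x) = star (P.V (star z ⊗ₜ star x)) := rfl

theorem R_star (x : X) (t : X ⊗[ℂ] A) : P.R (star x) t = star (P.L x (star t)) := by
  simp only [R, L, P.coaction_star]
  rfl

theorem star_rTensor_mulRight (z : X) (t : X ⊗[ℂ] A) :
    star (rTensor A (mulRight ℂ z) t) = rTensor A (mulLeft ℂ (star z)) (star t) := by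
  induction t with
  | zero => simp
  | add s t hs ht => simp only [map_add, star_add, hs, ht]
  | tmul x y => simp

theorem star_lTensor_mulRight (a : A) (t : X ⊗[ℂ] A) :
    star (lTensor X (mulRight ℂ a) t) = lTensor X (mulLeft ℂ (star a)) (star t) := by
  induction t with
  | zero => simp
  | add s t hs ht => simp only [map_add, star_add, hs, ht]
  | tmul x y => simp

theorem V'_mul (z x : X) (t : X ⊗[ℂ] A) :
    P.V' (z ⊗ₜ x) * t = P.L x (rTensor A (mulLeft ℂ z) t) := by
  apply star_injective
  rw [star_mul, V'_tmul, star_star, mul_V, R_star, star_rTensor_mulRight]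
  simp

theorem L_tmul (x z : X) (c : A) :
    P.L x (z ⊗ₜ c) = lTensor X (mulRight ℂ c) (P.V' (z ⊗ₜ x)) := by
  apply P.ext_mul
  intro u
  rw [← L_apply_mul, lTensor_mulRight_mul, V'_mul, tmul_mul_eq, lTensor_rTensor_comm]

theorem L_V' (y z x : X) : P.L y (P.V' (z ⊗ₜ x)) = P.V' (z ⊗ₜ (y * x)) := by
  apply P.ext_mul
  intro u
  rw [← L_apply_mul, V'_mul, V'_mul, L_mul]

/-- Both sides are (w ⊗ 1)α(x)(z ⊗ 1). This is the bridge between `V` and its conjugate `V'`. -/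
theorem lmul_V' (w z x : X) :
    rTensor A (mulLeft ℂ w) (P.V' (z ⊗ₜ x)) = rTensor A (mulRight ℂ z) (P.V (w ⊗ₜ x)) := by
  apply P.ext_mul
  intro u
  rw [rTensor_mulLeft_mul, V'_mul, rTensor_mulRight_mul, V_mul]

theorem T₁_rmul (z x : X) (a : A) :
    rTensor A (mulRight ℂ z) (P.T₁ (x ⊗ₜ a)) = lTensor X (mulRight ℂ a) (P.V' (z ⊗ₜ x)) := by
  apply P.ext_mul
  intro u
  rw [rTensor_mulRight_mul, T₁_mul, lTensor_mulRight_mul, V'_mul, lTensor_rTensor_comm]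

theorem V_mul_left (w z x : X) :
    P.V ((w * z) ⊗ₜ x) = rTensor A (mulLeft ℂ w) (P.V (z ⊗ₜ x)) := by
  apply P.ext_mul
  intro u
  rw [rTensor_mulLeft_mul, V_mul, V_mul]
  simp [mulLeft_mul, rTensor_comp]

theorem star_T₁ (x : X) (a : A) : star (P.T₁ (x ⊗ₜ a)) = P.T₂ (star x ⊗ₜ star a) := by
  apply P.nondeg.eq_of_mul_left
  intro u
  have h : u * P.T₂ (star x ⊗ₜ star a) = P.R (star x) (lTensor X (mulRight ℂ (star a)) u) :=
    congrArg (fun m => right m u) (P.T₂_spec (star x) (star a))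
  rw [h, R_star, star_lTensor_mulRight, star_star, ← T₁_mul, star_mul, star_star]

theorem star_T₂ (x : X) (a : A) : star (P.T₂ (x ⊗ₜ a)) = P.T₁ (star x ⊗ₜ star a) := by
  have := P.star_T₁ (star x) (star a)
  rw [star_star, star_star] at this
  rw [← this, star_star]

end Coact
end StarGalois
end

/-! ### The action of functionals on X -/

noncomputable section
namespace StarGalois
open Multiplier LinearMap

variable {A : Type*} [NonUnitalRing A] [Module ℂ A] [IsScalarTower ℂ A A] [SMulCommClass ℂ A A]
  [StarRing A] [StarModule ℂ A]
  {X : Type*} [NonUnitalRing X] [Module ℂ X] [IsScalarTower ℂ X X] [SMulCommClass ℂ X X]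
  [StarRing X] [StarModule ℂ X]

namespace Coact

variable {Q : StarAlgebraicQuantumGroup A} (P : Coact Q X)

/-- The action `x ↦ (ι ⊗ ρ)(α(x)(1 ⊗ b))` of the functional `ρ(· b)`. -/
def actR (ρ : A →ₗ[ℂ] ℂ) (b : A) : X →ₗ[ℂ] X :=
  sliceRight ρ ∘ₗ P.T₁ ∘ₗ (TensorProduct.mk ℂ X A).flip b

theorem actR_apply (ρ : A →ₗ[ℂ] ℂ) (b : A) (x : X) :
    P.actR ρ b x = sliceRight ρ (P.T₁ (x ⊗ₜ b)) := rfl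

/-- The action `x ↦ (ι ⊗ ρ)((1 ⊗ b)α(x))` of the functional `ρ(b ·)`. -/
def actL (ρ : A →ₗ[ℂ] ℂ) (b : A) : X →ₗ[ℂ] X :=
  sliceRight ρ ∘ₗ P.T₂ ∘ₗ (TensorProduct.mk ℂ X A).flip b

theorem actL_apply (ρ : A →ₗ[ℂ] ℂ) (b : A) (x : X) :
    P.actL ρ b x = sliceRight ρ (P.T₂ (x ⊗ₜ b)) := rfl

theorem slice_assoc_tmul {U V W : Type*} [AddCommGroup U] [Module ℂ U] [AddCommGroup V]
    [Module ℂ V] [AddCommGroup W] [Module ℂ W] (ρ : W →ₗ[ℂ] ℂ) (w : U ⊗[ℂ] V) (c : W) :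
    lTensor U (sliceRight ρ) (TensorProduct.assoc ℂ U V W (w ⊗ₜ c)) = ρ c • w := by
  induction w with
  | zero => simp
  | add s t hs ht => simp only [TensorProduct.add_tmul, map_add, hs, ht, smul_add]
  | tmul u v => simp

theorem slice_leg12_leg13 (ρ : A →ₗ[ℂ] ℂ) (x : X) (r s : A) :
    lTensor X (sliceRight ρ) (leg12 P.T₁ (leg13 P.T₁ (x ⊗ₜ (r ⊗ₜ s)))) =
      P.T₁ (P.actR ρ s x ⊗ₜ r) := by
  have h : ∀ u : X ⊗[ℂ] A, lTensor X (sliceRight ρ) (leg12 P.T₁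
      (leg23 X (TensorProduct.comm ℂ A A).toLinearMap (TensorProduct.assoc ℂ X A A (u ⊗ₜ r)))) =
      P.T₁ (sliceRight ρ u ⊗ₜ r) := by
    intro u
    induction u with
    | zero => simp
    | add s t hs ht => simp only [TensorProduct.add_tmul, map_add, hs, ht]
    | tmul y c =>
      simp only [leg23, leg12, LinearMap.comp_apply, LinearEquiv.coe_coe, sliceRight_tmul,
        TensorProduct.assoc_tmul, lTensor_tmul, TensorProduct.comm_tmul,
        TensorProduct.assoc_symm_tmul, rTensor_tmul, slice_assoc_tmul]
      rw [← TensorProduct.smul_tmul', map_smul]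
  have h2 := h (P.T₁ (x ⊗ₜ s))
  rw [← actR_apply] at h2
  rw [← h2]
  simp [leg13, leg12, leg23]

theorem slice_leg23_leg12 (ρ : A →ₗ[ℂ] ℂ) (x : X) (p q : A) :
    lTensor X (sliceRight ρ) (leg23 X Q.TΔ2.toLinearMap (leg12 P.T₁ (x ⊗ₜ (p ⊗ₜ q)))) =
      lTensor X (Q.self.actR ρ q) (P.T₁ (x ⊗ₜ p)) := by
  have h : ∀ w : X ⊗[ℂ] A, lTensor X (sliceRight ρ) (lTensor X Q.TΔ2.toLinearMap
      (TensorProduct.assoc ℂ X A A (w ⊗ₜ q))) = lTensor X (Q.self.actR ρ q) w := by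
    intro w
    induction w with
    | zero => simp
    | add s t hs ht => simp only [TensorProduct.add_tmul, map_add, hs, ht]
    | tmul y c => rfl
  rw [← h]
  simp [leg12, leg23]

theorem sliceRight_L_tmul (ρ : A →ₗ[ℂ] ℂ) (x z : X) (c : A) :
    sliceRight ρ (P.L x (z ⊗ₜ c)) = P.actR ρ c x * z := by
  rw [L_tmul, ← T₁_rmul, sliceRight_rTensor]
  rfl

/-- `α((ι ⊗ f)α(x)) = (ι ⊗ f▹)α(x)` for `f = ρ(· a)`. -/
theorem V_actR (ρ : A →ₗ[ℂ] ℂ) (a : A) (z x : X) :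
    P.V (z ⊗ₜ P.actR ρ a x) = lTensor X (Q.self.actR ρ a) (P.V (z ⊗ₜ x)) := by
  -- `M` and `N (P.V (z ⊗ₜ x))` are the two sides of the claim, followed by right multiplication of
  -- the second leg by `r`, as functions of `r ⊗ s` with `s` in place of `a`. Coassociativity
  -- compares them on the range of `Q.TΔ2`, which is everything; `r` is cancelled at the end.
  let M : A ⊗[ℂ] A →ₗ[ℂ] X ⊗[ℂ] A := rTensor A (mulLeft ℂ z) ∘ₗ lTensor X (sliceRight ρ) ∘ₗ
    leg12 P.T₁ ∘ₗ leg13 P.T₁ ∘ₗ TensorProduct.mk ℂ X (A ⊗[ℂ] A) x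
  have hM : ∀ r s, M (r ⊗ₜ s) = lTensor X (mulRight ℂ r) (P.V (z ⊗ₜ P.actR ρ s x)) := by
    intro r s
    rw [← lmul_T₁, ← slice_leg12_leg13]
    rfl
  have hMD : ∀ p q, M (Q.TΔ2 (p ⊗ₜ q)) =
      lTensor X (Q.self.actR ρ q ∘ₗ mulRight ℂ p) (P.V (z ⊗ₜ x)) := by
    intro p q
    have h := congrArg (fun F => rTensor A (mulLeft ℂ z) (lTensor X (sliceRight ρ)
      (F (x ⊗ₜ (p ⊗ₜ q))))) P.coassoc
    simp only [LinearMap.comp_apply] at h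
    have h2 := lTensor_rTensor_comm (mulLeft ℂ z) (Q.self.actR ρ q) (P.T₁ (x ⊗ₜ p))
    rw [slice_leg23_leg12, ← h2, lmul_T₁] at h
    rw [lTensor_comp]
    exact h
  let N : X ⊗[ℂ] A → A ⊗[ℂ] A →ₗ[ℂ] X ⊗[ℂ] A := fun w => TensorProduct.lift
    (LinearMap.mk₂ ℂ (fun r s => lTensor X (mulRight ℂ r ∘ₗ Q.self.actR ρ s) w)
      (by
        intro r r' s
        rw [show mulRight ℂ (r + r') = mulRight ℂ r + mulRight ℂ r' by ext; simp [mul_add],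
          LinearMap.add_comp, lTensor_add]
        rfl)
      (by
        intro c r s
        rw [show mulRight ℂ (c • r) = c • mulRight ℂ r by ext; simp [mul_smul_comm],
          LinearMap.smul_comp, lTensor_smul]
        rfl)
      (by
        intro r s s'
        rw [show Q.self.actR ρ (s + s') = Q.self.actR ρ s + Q.self.actR ρ s' by
          ext; simp [actR_apply, TensorProduct.tmul_add], LinearMap.comp_add, lTensor_add]
        rfl)
      (by
        intro c r s
        rw [show Q.self.actR ρ (c • s) = c • Q.self.actR ρ s by
          ext; simp [actR_apply, TensorProduct.tmul_smul], LinearMap.comp_smul, lTensor_smul]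
        rfl))
  have hN : ∀ w r s, N w (r ⊗ₜ s) = lTensor X (mulRight ℂ r ∘ₗ Q.self.actR ρ s) w := by
    intro w r s
    rfl
  have hNt : ∀ (u : X) (b : A) t, N (u ⊗ₜ b) t = u ⊗ₜ sliceRight ρ (Q.self.L b t) := by
    intro u b t
    induction t with
    | zero => simp
    | add s t hs ht => simp only [map_add, hs, ht, TensorProduct.tmul_add]
    | tmul r s => rw [hN, sliceRight_L_tmul]; rfl
  have hND : ∀ w p q, N w (Q.TΔ2 (p ⊗ₜ q)) = lTensor X (Q.self.actR ρ q ∘ₗ mulRight ℂ p) w := by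
    intro w p q
    induction w with
    | zero => simpa using hNt 0 0 (Q.TΔ2 (p ⊗ₜ q))
    | add w w' h h' =>
      rw [map_add, ← h, ← h']
      generalize Q.TΔ2 (p ⊗ₜ q) = t
      induction t with
      | zero => simp
      | add s t hs ht => simp only [map_add, hs, ht]; abel
      | tmul r s => simp only [hN, map_add]
    | tmul u b =>
      rw [hNt]
      -- Multiplicativity of Δ: Δ(b)Δ(p)(1 ⊗ q) = Δ(bp)(1 ⊗ q).
      have := Q.self.L_T₁ b p q
      change Q.self.L b (Q.TΔ2 (p ⊗ₜ q)) = _ at this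
      rw [this]
      rfl
  have hMN : M = N (P.V (z ⊗ₜ x)) := by
    have : M ∘ₗ Q.TΔ2.toLinearMap = N (P.V (z ⊗ₜ x)) ∘ₗ Q.TΔ2.toLinearMap := by
      apply TensorProduct.ext'
      intro p q
      exact (hMD p q).trans (hND _ p q).symm
    exact (LinearMap.cancel_right Q.TΔ2.surjective).mp this
  apply eq_of_lTensor Q.nondegenerate.mulRight_sep
  intro r
  rw [← hM, hMN, hN, lTensor_comp, LinearMap.comp_apply]

/-- The map `b ↦ Δ(b)(1 ⊗ a)`. -/
def _root_.StarGalois.StarAlgebraicQuantumGroup.comulR (Q : StarAlgebraicQuantumGroup A) (a : A) :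
    A →ₗ[ℂ] A ⊗[ℂ] A := Q.TΔ2.toLinearMap ∘ₗ (TensorProduct.mk ℂ A A).flip a

/-- The map `x ↦ (z ⊗ 1)α(x)`. -/
def Vl (z : X) : X →ₗ[ℂ] X ⊗[ℂ] A := P.V.toLinearMap ∘ₗ TensorProduct.mk ℂ X X z

/-- `((z ⊗ 1)α ⊗ ι)(α(x)(1 ⊗ a)) = (z ⊗ 1 ⊗ 1)(ι ⊗ Δ)(α(x))(1 ⊗ 1 ⊗ a)`. -/
theorem assoc_Vl_T₁ (z x : X) (a : A) :
    TensorProduct.assoc ℂ X A A (rTensor A (P.Vl z) (P.T₁ (x ⊗ₜ a))) =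
      lTensor X (Q.comulR a) (P.V (z ⊗ₜ x)) := by
  apply (TensorProduct.assoc ℂ X A A).symm.injective
  rw [LinearEquiv.symm_apply_apply]
  apply eq_of_forall_sliceRight
  intro ρ
  rw [sliceRight_rTensor]
  change P.V (z ⊗ₜ P.actR ρ a x) = _
  rw [V_actR]
  generalize P.V (z ⊗ₜ x) = w
  induction w with
  | zero => simp
  | add s t hs ht => simp only [map_add, hs, ht]
  | tmul u b =>
    simp only [lTensor_tmul]
    change u ⊗ₜ sliceRight ρ (Q.comulR a b) = _
    generalize Q.comulR a b = t
    induction t with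
    | zero => simp
    | add s t hs ht => simp only [map_add, TensorProduct.tmul_add, hs, ht]
    | tmul p q => simp

/-- `f ▹ x = K x`, where `f ▹ x = (ι ⊗ f)α(x)`. -/
def Acts (f : A →ₗ[ℂ] ℂ) (K : X →ₗ[ℂ] X) : Prop :=
  ∀ z x, z * K x = sliceRight f (P.V (z ⊗ₜ x))

theorem acts_actR (ρ : A →ₗ[ℂ] ℂ) (b : A) : P.Acts (ρ ∘ₗ mulRight ℂ b) (P.actR ρ b) := by
  intro z x
  rw [← sliceRight_lTensor, ← lmul_T₁, sliceRight_rTensor]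
  rfl

theorem acts_actL (ρ : A →ₗ[ℂ] ℂ) (b : A) : P.Acts (ρ ∘ₗ mulLeft ℂ b) (P.actL ρ b) := by
  intro z x
  rw [← sliceRight_lTensor, ← lmul_T₂, sliceRight_rTensor]
  rfl

variable {P}

theorem Acts.unique {f : A →ₗ[ℂ] ℂ} {K K' : X →ₗ[ℂ] X} (h : P.Acts f K) (h' : P.Acts f K') :
    K = K' := by
  ext x
  apply P.nondegenerate.eq_of_mul_left
  intro z
  rw [h, h']

theorem Acts.mul_right {f : A →ₗ[ℂ] ℂ} {K : X →ₗ[ℂ] X} (h : P.Acts f K) (x z : X) :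
    K x * z = sliceRight f (P.V' (z ⊗ₜ x)) := by
  apply P.nondegenerate.eq_of_mul_left
  intro w
  rw [← mul_assoc, h]
  change _ = mulLeft ℂ w _
  rw [← sliceRight_rTensor, lmul_V', sliceRight_rTensor]
  rfl

/-- The functional `a ↦ conj (f a⋆)`. -/
def conjF {B : Type*} [AddCommGroup B] [Module ℂ B] [StarAddMonoid B] [StarModule ℂ B]
    (f : B →ₗ[ℂ] ℂ) : B →ₗ[ℂ] ℂ where
  toFun a := star (f (star a))
  map_add' := by intro x y; simp
  map_smul' := by intro c x; simp

/-- The map `x ↦ (K x⋆)⋆`. -/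
def conjM {B : Type*} [AddCommGroup B] [Module ℂ B] [StarAddMonoid B] [StarModule ℂ B]
    (K : B →ₗ[ℂ] B) : B →ₗ[ℂ] B where
  toFun a := star (K (star a))
  map_add' := by intro x y; simp
  map_smul' := by intro c x; simp

theorem sliceRight_conjF (f : A →ₗ[ℂ] ℂ) (t : X ⊗[ℂ] A) :
    sliceRight (conjF f) t = star (sliceRight f (star t)) := by
  induction t with
  | zero => simp
  | add s t hs ht => simp only [map_add, star_add, hs, ht]
  | tmul x y => simp [conjF]

theorem sliceLeft_conjF (f : X →ₗ[ℂ] ℂ) (t : X ⊗[ℂ] A) :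
    sliceLeft (conjF f) t = star (sliceLeft f (star t)) := by
  induction t with
  | zero => simp
  | add s t hs ht => simp only [map_add, star_add, hs, ht]
  | tmul x y => simp [conjF]

theorem Acts.conj {f : A →ₗ[ℂ] ℂ} {K : X →ₗ[ℂ] X} (h : P.Acts f K) :
    P.Acts (conjF f) (conjM K) := by
  intro z x
  apply star_injective
  have := h.mul_right (star x) (star z)
  rw [V'_tmul, star_star, star_star] at this
  rw [sliceRight_conjF, star_star, ← this]
  simp [conjM]

/-- The functionals `ρ(· b)` and `ρ(b ·)`. -/
def Adm (f : A →ₗ[ℂ] ℂ) : Prop :=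
  (∃ ρ b, f = ρ ∘ₗ mulRight ℂ b) ∨ (∃ ρ b, f = ρ ∘ₗ mulLeft ℂ b)

variable (P)

/-- The action `f ▹ x = (ι ⊗ f)α(x)`. -/
def act (f : A →ₗ[ℂ] ℂ) : X →ₗ[ℂ] X :=
  -- The value 0 is a default. For functionals satisfying `Adm` the action exists by `acts_act`.
  open Classical in if h : ∃ K, P.Acts f K then h.choose else 0

variable {P}

theorem Acts.act_eq {f : A →ₗ[ℂ] ℂ} {K : X →ₗ[ℂ] X} (h : P.Acts f K) : P.act f = K := by
  have h' : ∃ K, P.Acts f K := ⟨K, h⟩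
  rw [act, dif_pos h']
  exact h'.choose_spec.unique h

variable (P)

theorem acts_act {f : A →ₗ[ℂ] ℂ} (hf : Adm f) : P.Acts f (P.act f) := by
  obtain ⟨ρ, b, rfl⟩ | ⟨ρ, b, rfl⟩ := hf
  · rw [(P.acts_actR ρ b).act_eq]
    exact P.acts_actR ρ b
  · rw [(P.acts_actL ρ b).act_eq]
    exact P.acts_actL ρ b

/-- Covering the first leg on the other side turns `V'` into `V` by `lmul_V'`, and this commutes
with maps of the second leg. -/
theorem V'_act_of_V {K : X →ₗ[ℂ] X} {k : A →ₗ[ℂ] A}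
    (h : ∀ z x, P.V (z ⊗ₜ K x) = lTensor X k (P.V (z ⊗ₜ x))) (z x : X) :
    P.V' (z ⊗ₜ K x) = lTensor X k (P.V' (z ⊗ₜ x)) := by
  apply eq_of_rTensor P.nondegenerate.mulLeft_sep
  intro w
  rw [lmul_V', h, ← lTensor_rTensor_comm, ← lTensor_rTensor_comm, lmul_V']

theorem V_act_of_V' {K : X →ₗ[ℂ] X} {k : A →ₗ[ℂ] A}
    (h : ∀ z x, P.V' (z ⊗ₜ K x) = lTensor X k (P.V' (z ⊗ₜ x))) (z x : X) :
    P.V (z ⊗ₜ K x) = lTensor X k (P.V (z ⊗ₜ x)) := by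
  apply eq_of_rTensor P.nondegenerate.mulRight_sep
  intro w
  rw [← lmul_V', h, ← lTensor_rTensor_comm, ← lTensor_rTensor_comm, lmul_V']

theorem star_lTensor (k : A →ₗ[ℂ] A) (t : X ⊗[ℂ] A) :
    star (lTensor X k t) = lTensor X (conjM k) (star t) := by
  induction t with
  | zero => simp
  | add s t hs ht => simp only [map_add, star_add, hs, ht]
  | tmul x y => simp [conjM]

theorem actL_eq_conjM (ρ : A →ₗ[ℂ] ℂ) (b : A) :
    P.actL ρ b = conjM (P.actR (conjF ρ) (star b)) := by
  ext x
  apply star_injective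
  simp only [conjM, LinearMap.coe_mk, AddHom.coe_mk, star_star]
  rw [actR_apply, actL_apply, sliceRight_conjF, star_T₁, star_star, star_star]

theorem V_actL (ρ : A →ₗ[ℂ] ℂ) (a : A) (z x : X) :
    P.V (z ⊗ₜ P.actL ρ a x) = lTensor X (Q.self.actL ρ a) (P.V (z ⊗ₜ x)) := by
  apply P.V_act_of_V'
  intro z x
  apply star_injective
  rw [V'_tmul, star_star, V'_tmul, star_lTensor, star_star]
  have h := P.V_actR (conjF ρ) (star a) (star z) (star x)
  have hk : ∀ k : A →ₗ[ℂ] A, conjM (conjM k) = k := fun k => by ext; simp [conjM]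
  rw [actL_eq_conjM, actL_eq_conjM, hk, ← h]
  simp [conjM]

/-- Colinearity of the action. It reduces statements on X to statements on A and makes actions
compose by convolution. -/
theorem V_act {f : A →ₗ[ℂ] ℂ} (hf : Adm f) (z x : X) :
    P.V (z ⊗ₜ P.act f x) = lTensor X (Q.self.act f) (P.V (z ⊗ₜ x)) := by
  obtain ⟨ρ, b, rfl⟩ | ⟨ρ, b, rfl⟩ := hf
  · rw [(P.acts_actR ρ b).act_eq, (Q.self.acts_actR ρ b).act_eq, V_actR]
  · rw [(P.acts_actL ρ b).act_eq, (Q.self.acts_actL ρ b).act_eq, V_actL]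

variable {P}

/-- `f ▹ (g ▹ x) = (f * g) ▹ x`. -/
theorem Acts.comp {f g : A →ₗ[ℂ] ℂ} {K : X →ₗ[ℂ] X} (h : P.Acts f K) (hg : Adm g) :
    P.Acts (f ∘ₗ Q.self.act g) (K ∘ₗ P.act g) := by
  intro z x
  rw [LinearMap.comp_apply, h, V_act P hg, sliceRight_lTensor]

variable (P)

/-- A functional that vanishes on products vanishes. -/
theorem eq_zero_of_mul_eq_zero (P : Coact Q X) [Nontrivial A] (ω : X →ₗ[ℂ] ℂ) (h : ∀ x y, ω (x * y) = 0) :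
    ω = 0 := by
  -- Covered by `a` on the right, the slice becomes the slice of `P.T₁ (x ⊗ₜ a)` along ω(z ·), which
  -- is zero. Surjectivity of `V` then gives the claim.
  have h1 : ∀ z x, sliceLeft ω (P.V (z ⊗ₜ x)) = 0 := by
    intro z x
    apply Q.nondegenerate.1
    intro a
    change mulRight ℂ a _ = 0
    rw [← sliceLeft_lTensor, ← lmul_T₁, sliceLeft_rTensor,
      show ω ∘ₗ mulLeft ℂ z = 0 from LinearMap.ext fun y => h z y]
    simp [sliceLeft]
  have h2 : sliceLeft ω ∘ₗ P.V.toLinearMap = (0 : X ⊗[ℂ] X →ₗ[ℂ] A) :=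
    TensorProduct.ext' fun z x => h1 z x
  obtain ⟨a, ha⟩ := exists_ne (0 : A)
  ext x
  have h3 := LinearMap.congr_fun h2 (P.V.symm (x ⊗ₜ a))
  simpa [ha] using h3

/-- Both α and the character `d` are multiplicative. -/
theorem act_multiplicative {d : A →ₗ[ℂ] ℂ} (hd : ∀ a b, d (a * b) = d a * d b) {K : X →ₗ[ℂ] X}
    (hK : P.Acts d K) (x y : X) : K (x * y) = K x * K y := by
  apply P.nondegenerate.eq_of_mul_left
  intro z
  rw [hK, ← R_V, ← mul_assoc, hK z x]
  generalize P.V (z ⊗ₜ x) = t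
  induction t with
  | zero => simp
  | add s t hs ht => simp only [map_add, add_mul, hs, ht]
  | tmul u c =>
    rw [R_tmul, sliceRight_lTensor, show d ∘ₗ mulLeft ℂ c = d c • d by ext; simp [hd],
      sliceRight_tmul, smul_mul_assoc, hK u y]
    generalize P.V (u ⊗ₜ y) = t
    induction t with
    | zero => simp
    | add s t hs ht => simp only [map_add, smul_add, hs, ht]
    | tmul u c => simp [mul_smul]

end Coact
end StarGalois
end

/-! ### The counit -/

noncomputable section
namespace StarGalois
open Multiplier LinearMap

variable {A : Type*} [NonUnitalRing A] [Module ℂ A] [IsScalarTower ℂ A A] [SMulCommClass ℂ A A]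
  [StarRing A] [StarModule ℂ A]
  {X : Type*} [NonUnitalRing X] [Module ℂ X] [IsScalarTower ℂ X X] [SMulCommClass ℂ X X]
  [StarRing X] [StarModule ℂ X]

namespace StarAlgebraicQuantumGroup

variable (Q : StarAlgebraicQuantumGroup A)

theorem nontrivial (Q : StarAlgebraicQuantumGroup A) : Nontrivial A := by
  by_contra h
  rw [not_nontrivial_iff_subsingleton] at h
  exact Q.haar_ne_zero (LinearMap.ext fun a => by rw [Subsingleton.elim a 0]; simp)

theorem exists_haar_eq_one : ∃ q, Q.haar q = 1 := by
  by_contra! h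
  apply Q.haar_ne_zero
  ext a
  by_contra ha
  exact h ((Q.haar a)⁻¹ • a) (by
    rw [map_smul, smul_eq_mul]
    exact inv_mul_cancel₀ ha)

theorem V'_self (a b : A) : Q.self.V' (b ⊗ₜ a) = Q.TΔ1 (a ⊗ₜ b) := by
  apply Q.self.ext_mul
  intro u
  rw [Coact.V'_mul]
  exact (congrArg (fun m => left m u) (Q.TΔ1_spec a b)).symm

theorem haar_V' (z x : A) : sliceRight Q.haar (Q.self.V' (z ⊗ₜ x)) = Q.haar x • z := by
  rw [V'_self, Q.haar_leftInvariant]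

end StarAlgebraicQuantumGroup

namespace Coact

variable {Q : StarAlgebraicQuantumGroup A} (P : Coact Q X)

theorem leftInvariant_V_of_V' {ρ : A →ₗ[ℂ] ℂ} {ω : X →ₗ[ℂ] ℂ}
    (h : ∀ z x, sliceRight ρ (P.V' (z ⊗ₜ x)) = ω x • z) (z x : X) :
    sliceRight ρ (P.V (z ⊗ₜ x)) = ω x • z := by
  apply P.nondegenerate.eq_of_mul_right
  intro w
  change mulRight ℂ w _ = _
  rw [← sliceRight_rTensor, ← lmul_V', sliceRight_rTensor, h]
  simp [smul_mul_assoc]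

theorem leftInvariant_V'_of_V {ρ : A →ₗ[ℂ] ℂ} {ω : X →ₗ[ℂ] ℂ}
    (h : ∀ z x, sliceRight ρ (P.V (z ⊗ₜ x)) = ω x • z) (z x : X) :
    sliceRight ρ (P.V' (z ⊗ₜ x)) = ω x • z := by
  apply P.nondegenerate.eq_of_mul_left
  intro w
  change mulLeft ℂ w _ = _
  rw [← sliceRight_rTensor, lmul_V', sliceRight_rTensor, h]
  simp [mul_smul_comm]

theorem slice_assoc_rTensor {U U' V W : Type*} [AddCommGroup U] [Module ℂ U] [AddCommGroup U']
    [Module ℂ U'] [AddCommGroup V] [Module ℂ V] [AddCommGroup W] [Module ℂ W]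
    (ρ : W →ₗ[ℂ] ℂ) (F : U →ₗ[ℂ] U' ⊗[ℂ] V) (t : U ⊗[ℂ] W) :
    lTensor U' (sliceRight ρ) (TensorProduct.assoc ℂ U' V W (rTensor W F t)) =
      F (sliceRight ρ t) := by
  induction t with
  | zero => simp
  | add s t hs ht => simp only [map_add, hs, ht]
  | tmul u w => rw [rTensor_tmul, slice_assoc_tmul, sliceRight_tmul, map_smul]

/-- The map `u ⊗ c ↦ (u ⊗ c ⊗ 1)(ι ⊗ Δ)α(x)`. -/
def mulVl (x : X) : X ⊗[ℂ] A →ₗ[ℂ] X ⊗[ℂ] (A ⊗[ℂ] A) :=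
  lTensor X (Q.self.V.toLinearMap ∘ₗ (TensorProduct.comm ℂ A A).toLinearMap) ∘ₗ
    (TensorProduct.assoc ℂ X A A).toLinearMap ∘ₗ
    rTensor A (P.V.toLinearMap ∘ₗ (TensorProduct.mk ℂ X X).flip x)

theorem mulVl_tmul (x u : X) (c : A) :
    P.mulVl x (u ⊗ₜ c) = lTensor X (Q.self.Vl c) (P.V (u ⊗ₜ x)) := by
  simp only [mulVl, LinearMap.comp_apply, rTensor_tmul, LinearEquiv.coe_coe, flip_apply,
    TensorProduct.mk_apply]
  generalize P.V (u ⊗ₜ x) = t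
  induction t with
  | zero => simp
  | add s t hs ht => simp only [map_add, TensorProduct.add_tmul, hs, ht]
  | tmul u w => simp [Vl]

theorem lTensor_mulVl_tmul (f : A →ₗ[ℂ] ℂ) (x u : X) (c : A) :
    lTensor X (sliceRight f) (P.mulVl x (u ⊗ₜ c)) =
      lTensor X (sliceRight f ∘ₗ Q.self.Vl c) (P.V (u ⊗ₜ x)) := by
  rw [mulVl_tmul, ← LinearMap.comp_apply, ← lTensor_comp]

theorem eq_of_lTensor_sliceRight {U V W ι : Type*} [AddCommGroup U] [Module ℂ U] [AddCommGroup V]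
    [Module ℂ V] [AddCommGroup W] [Module ℂ W] {f : ι → W →ₗ[ℂ] ℂ}
    (hf : ∀ v, (∀ i, f i v = 0) → v = 0) {s t : U ⊗[ℂ] (V ⊗[ℂ] W)}
    (h : ∀ i, lTensor U (sliceRight (f i)) s = lTensor U (sliceRight (f i)) t) : s = t :=
  eq_of_lTensor (g := fun i => sliceRight (f i)) (fun _ hv => eq_zero_of_sliceRight hf hv) h

/-- `(α ⊗ ι)((z ⊗ 1)α(x)) = (α(z) ⊗ 1)(ι ⊗ Δ)α(x)`, covered by `v`. -/
theorem assoc_Vl_V (v z x : X) :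
    TensorProduct.assoc ℂ X A A (rTensor A (P.Vl v) (P.V (z ⊗ₜ x))) =
      P.mulVl x (P.V (v ⊗ₜ z)) := by
  apply eq_of_lTensor_sliceRight
    (f := fun i : (A →ₗ[ℂ] ℂ) × A => i.1 ∘ₗ mulRight ℂ i.2)
  · intro v hv
    exact Q.nondegenerate.1 v fun b => eq_zero_of_functional fun ω => hv (ω, b)
  rintro ⟨ρ, a⟩
  rw [slice_assoc_rTensor, ← P.acts_actR ρ a]
  change P.V (v ⊗ₜ _) = _
  rw [← R_V]
  generalize P.V (v ⊗ₜ z) = t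
  induction t with
  | zero => simp
  | add s t hs ht => simp only [map_add, hs, ht]
  | tmul u c =>
    rw [R_tmul, V_actR, lTensor_mulVl_tmul, ← LinearMap.comp_apply, ← lTensor_comp]
    congr 2
    ext b
    exact Q.self.acts_actR ρ a c b

theorem V_slice_V (f : A →ₗ[ℂ] ℂ) (v z x : X) :
    P.V (v ⊗ₜ sliceRight f (P.V (z ⊗ₜ x))) =
      lTensor X (sliceRight f) (P.mulVl x (P.V (v ⊗ₜ z))) := by
  rw [← assoc_Vl_V, slice_assoc_rTensor]
  rfl

end Coact

namespace StarAlgebraicQuantumGroup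

open Coact

variable (Q : StarAlgebraicQuantumGroup A)

theorem haar_V (z x : A) : sliceRight Q.haar (Q.self.V (z ⊗ₜ x)) = Q.haar x • z :=
  Q.self.leftInvariant_V_of_V' Q.haar_V' z x

/-- The inverse canonical maps followed by multiplication, `E` and `F`, ought to be ε ⊗ ι and ι ⊗ ε.
Coassociativity gives `s ⊗ E (b ⊗ q) = F (s ⊗ b) ⊗ q`, and this forces both to come from a single
functional of `b`. -/
theorem exists_counit : ∃ ε : A →ₗ[ℂ] ℂ,
    (∀ a b, sliceLeft ε (Q.TΔ2 (a ⊗ₜ b)) = a * b) ∧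
    (∀ a b, sliceRight ε (Q.T1Δ (a ⊗ₜ b)) = a * b) := by
  let E : A ⊗[ℂ] A →ₗ[ℂ] A := mul' ℂ A ∘ₗ Q.TΔ2.symm.toLinearMap
  let F : A ⊗[ℂ] A →ₗ[ℂ] A := mul' ℂ A ∘ₗ Q.T1Δ.symm.toLinearMap
  have hE : ∀ a b, E (Q.TΔ2 (a ⊗ₜ b)) = a * b := fun a b => by simp [E]
  have hF : ∀ a b, F (Q.T1Δ (a ⊗ₜ b)) = a * b := fun a b => by simp [F]
  have h1 : ∀ c (t : A ⊗[ℂ] A), lTensor A E (TensorProduct.assoc ℂ A A A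
      (rTensor A (Q.self.Vl c) t)) = rTensor A (mulLeft ℂ c) t := by
    intro c t
    obtain ⟨s, rfl⟩ := Q.TΔ2.surjective t
    induction s with
    | zero => simp
    | add s t hs ht => simp only [map_add, hs, ht]
    | tmul x a =>
      have h2 := Q.self.assoc_Vl_T₁ c x a
      have h3 := Q.self.lmul_T₁ c x a
      change _ = lTensor A (mulRight ℂ a) (Q.T1Δ _) at h3
      change rTensor A (mulLeft ℂ c) (Q.TΔ2 _) = _ at h3
      change TensorProduct.assoc ℂ A A A (rTensor A (Q.self.Vl c) (Q.TΔ2 (x ⊗ₜ a))) = _ at h2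
      rw [h2, h3, ← LinearMap.comp_apply, ← lTensor_comp]
      congr 2
      ext b
      exact hE b a
  have h2 : ∀ s b q, s ⊗ₜ[ℂ] E (b ⊗ₜ q) = F (s ⊗ₜ b) ⊗ₜ[ℂ] q := by
    intro s b q
    have : ∀ w : A ⊗[ℂ] A, lTensor A E (TensorProduct.assoc ℂ A A A (w ⊗ₜ q)) = F w ⊗ₜ[ℂ] q := by
      intro w
      obtain ⟨s, rfl⟩ := Q.T1Δ.surjective w
      induction s with
      | zero => simp
      | add s t hs ht => simp only [map_add, TensorProduct.add_tmul, hs, ht]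
      | tmul c p =>
        rw [hF]
        exact h1 c (p ⊗ₜ q)
    simpa using this (s ⊗ₜ b)
  have := Q.nontrivial
  obtain ⟨s, hs⟩ := exists_ne (0 : A)
  obtain ⟨ω, hω⟩ := exists_functional_ne_zero hs
  let ε : A →ₗ[ℂ] ℂ := ω ∘ₗ F ∘ₗ TensorProduct.mk ℂ A A s
  have hεE : ∀ b q, E (b ⊗ₜ q) = ε b • q := by
    intro b q
    have := congrArg (sliceLeft ω) (h2 s b q)
    simpa [hω, ε] using this
  have hεF : ∀ s b, F (s ⊗ₜ b) = ε b • s := by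
    intro s' b
    have := congrArg (sliceRight ω) (h2 s' b s)
    rw [hεE] at this
    simpa [hω] using this.symm
  refine ⟨ε, fun a b => ?_, fun a b => ?_⟩
  · rw [← hE]
    generalize Q.TΔ2 (a ⊗ₜ b) = t
    induction t with
    | zero => simp
    | add s t hs ht => simp only [map_add, hs, ht]
    | tmul p q => simp [hεE]
  · rw [← hF]
    generalize Q.T1Δ (a ⊗ₜ b) = t
    induction t with
    | zero => simp
    | add s t hs ht => simp only [map_add, hs, ht]
    | tmul p q => simp [hεF]

/-- The counit. -/
def counit : A →ₗ[ℂ] ℂ := Q.exists_counit.choose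

theorem counit_T₁ (a b : A) : sliceLeft Q.counit (Q.self.T₁ (a ⊗ₜ b)) = a * b :=
  Q.exists_counit.choose_spec.1 a b

theorem counit_V (a b : A) : sliceRight Q.counit (Q.self.V (a ⊗ₜ b)) = a * b :=
  Q.exists_counit.choose_spec.2 a b

theorem T₁_surjective : Function.Surjective Q.self.T₁ := Q.TΔ2.surjective

theorem counit_V' (p x : A) : sliceLeft Q.counit (Q.self.V' (p ⊗ₜ x)) = Q.counit p • x := by
  have h : ∀ t, sliceLeft Q.counit (Q.self.L x t) = x * sliceLeft Q.counit t := by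
    intro t
    obtain ⟨s, rfl⟩ := Q.T₁_surjective t
    induction s with
    | zero => simp
    | add s t hs ht => simp only [map_add, mul_add, hs, ht]
    | tmul y b => rw [L_T₁, counit_T₁, counit_T₁, mul_assoc]
  apply Q.nondegenerate.eq_of_mul_right
  intro q
  have := h (p ⊗ₜ q)
  rw [L_tmul, sliceLeft_lTensor, sliceLeft_tmul, mul_smul_comm] at this
  rw [smul_mul_assoc, ← this]
  rfl

theorem counit_mul (u p : A) : Q.counit (u * p) = Q.counit u * Q.counit p := by
  have h : ∀ t : A ⊗[ℂ] A, sliceLeft (Q.counit ∘ₗ mulRight ℂ p) t =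
      Q.counit p • sliceLeft Q.counit t := by
    intro t
    obtain ⟨s, rfl⟩ := Q.T₁_surjective t
    induction s with
    | zero => simp
    | add s t hs ht => simp only [map_add, smul_add, hs, ht]
    | tmul x q =>
      rw [← sliceLeft_rTensor, T₁_rmul, sliceLeft_lTensor, counit_V', counit_T₁]
      simp
  have := Q.nontrivial
  obtain ⟨s, hs⟩ := exists_ne (0 : A)
  have := h (u ⊗ₜ s)
  simp only [sliceLeft_tmul, LinearMap.comp_apply, mulRight_apply, smul_smul] at this
  rw [smul_left_injective ℂ hs this, mul_comm]

theorem isCounit_counit : Q.IsCounit Q.counit := ⟨Q.counit_mul, Q.counit_T₁, Q.counit_V⟩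

theorem functional_eq_of_sliceRight {U : Type*} [AddCommGroup U] [Module ℂ U] [Nontrivial U]
    {f g : A →ₗ[ℂ] ℂ} (h : ∀ t : U ⊗[ℂ] A, sliceRight f t = sliceRight g t) : f = g := by
  obtain ⟨s, hs⟩ := exists_ne (0 : U)
  ext b
  have := h (s ⊗ₜ b)
  simp only [sliceRight_tmul] at this
  exact smul_left_injective ℂ hs this

theorem functional_ext_V {f g : A →ₗ[ℂ] ℂ}
    (h : ∀ a b, sliceRight f (Q.self.V (a ⊗ₜ b)) = sliceRight g (Q.self.V (a ⊗ₜ b))) : f = g := by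
  have := Q.nontrivial
  apply functional_eq_of_sliceRight (U := A)
  intro t
  obtain ⟨s, rfl⟩ := Q.self.V.surjective t
  induction s with
  | zero => simp
  | add s t hs ht => simp only [map_add, hs, ht]
  | tmul a b => exact h a b

theorem IsCounit.eq_counit {Q : StarAlgebraicQuantumGroup A} {ε : A →ₗ[ℂ] ℂ} (h : Q.IsCounit ε) :
    ε = Q.counit :=
  Q.functional_ext_V fun a b => (h.2.2 a b).trans (Q.counit_V a b).symm

theorem counit_star (a : A) : Q.counit (star a) = star (Q.counit a) := by
  have h : conjF Q.counit = Q.counit := by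
    apply Q.functional_ext_V
    intro a b
    have h1 : Q.self.Acts Q.counit LinearMap.id := fun z x => (Q.counit_V z x).symm
    rw [← h1.conj, ← h1]
    simp [conjM]
  have h2 := LinearMap.congr_fun h a
  rw [← h2]
  simp [conjF]

end StarAlgebraicQuantumGroup

namespace Coact

variable {Q : StarAlgebraicQuantumGroup A} (P : Coact Q X)

/-- By coassociativity and the counit property in A, the two candidates for zx have the same image
under (v ⊗ 1)α(·), and `V` is injective. -/
theorem acts_counit [Nontrivial X] : P.Acts Q.counit LinearMap.id := by
  intro z x
  obtain ⟨v, hv⟩ := exists_ne (0 : X)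
  have h : P.V (v ⊗ₜ sliceRight Q.counit (P.V (z ⊗ₜ x))) = P.V (v ⊗ₜ (z * x)) := by
    rw [V_slice_V, ← R_V]
    generalize P.V (v ⊗ₜ z) = t
    induction t with
    | zero => simp
    | add s t hs ht => simp only [map_add, hs, ht]
    | tmul u c =>
      rw [R_tmul, lTensor_mulVl_tmul]
      congr 2
      ext b
      exact Q.counit_V c b
  have h2 := P.V.injective h
  have h3 : v ⊗ₜ[ℂ] (sliceRight Q.counit (P.V (z ⊗ₜ x)) - z * x) = 0 := by
    rw [TensorProduct.tmul_sub, h2, sub_self]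
  by_contra h4
  exact tmul_ne_zero hv (sub_ne_zero.mpr fun h5 => h4 h5.symm) h3

/-- The element `Σ (f_{bᵢ} ▹ y) ⊗ pᵢ`, where `Δ(a)(q ⊗ 1) = Σ pᵢ ⊗ bᵢ`. -/
def flipAct (y : X) : A ⊗[ℂ] A →ₗ[ℂ] X ⊗[ℂ] A :=
  TensorProduct.lift ((TensorProduct.mk ℂ X A).flip.compl₂
    (sliceRight Q.haar ∘ₗ P.T₁ ∘ₗ TensorProduct.mk ℂ X A y))

theorem flipAct_tmul (y : X) (p b : A) :
    P.flipAct y (p ⊗ₜ b) = P.actR Q.haar b y ⊗ₜ p := rfl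

/-- Left invariance of φ produces an explicit preimage under `T₁`. For A coacting on itself this
computes the inverse of `TΔ2`, from which the antipode is read off. -/
theorem T₁_flipAct (y : X) (q a : A) :
    P.T₁ (P.flipAct y (Q.self.V' (q ⊗ₜ a))) = P.actR Q.haar a y ⊗ₜ q := by
  apply eq_of_rTensor P.nondegenerate.mulLeft_sep
  intro z
  apply eq_of_forall_sliceLeft
  intro ω
  have h : ∀ t, sliceLeft ω (rTensor A (mulLeft ℂ z) (P.T₁ (P.flipAct y t))) =
      sliceRight Q.haar (Q.self.L (sliceLeft ω (P.V (z ⊗ₜ y))) t) := by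
    intro t
    induction t with
    | zero => simp
    | add s t hs ht => simp only [map_add, hs, ht]
    | tmul p c =>
      rw [flipAct_tmul, lmul_T₁, V_actR, sliceLeft_lTensor, sliceLeft_lTensor, sliceRight_L_tmul]
      rfl
  rw [h, L_V', Q.haar_V', rTensor_tmul, mulLeft_apply, P.acts_actR, sliceLeft_tmul,
    apply_sliceRight]
  rfl

end Coact
end StarGalois
end

/-! ### The antipode, faithfulness of the left integral, and the right integral -/

noncomputable section
namespace StarGalois
open Multiplier LinearMap

variable {A : Type*} [NonUnitalRing A] [Module ℂ A] [IsScalarTower ℂ A A] [SMulCommClass ℂ A A]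
  [StarRing A] [StarModule ℂ A]
  {X : Type*} [NonUnitalRing X] [Module ℂ X] [IsScalarTower ℂ X X] [SMulCommClass ℂ X X]
  [StarRing X] [StarModule ℂ X]

namespace StarAlgebraicQuantumGroup

open Coact

variable (Q : StarAlgebraicQuantumGroup A)

theorem counit_actR (ρ : A →ₗ[ℂ] ℂ) (b y : A) : Q.counit (Q.self.actR ρ b y) = ρ (y * b) := by
  rw [actR_apply, apply_sliceRight, counit_T₁]

/-- The map `y ⊗ a ↦ (ι ⊗ φ)((1 ⊗ y)Δ(a))`. -/
def antipodeAux : A ⊗[ℂ] A →ₗ[ℂ] A :=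
  sliceRight Q.haar ∘ₗ Q.self.T₂ ∘ₗ (TensorProduct.comm ℂ A A).toLinearMap

theorem antipodeAux_tmul (y a : A) : Q.antipodeAux (y ⊗ₜ a) = Q.self.actL Q.haar y a := rfl

theorem T₁_eq (t : A ⊗[ℂ] A) : Q.self.T₁ t = Q.TΔ2 t := rfl

theorem antipodeAux_mul (t : A ⊗[ℂ] A) (q : A) : Q.antipodeAux t * q =
    sliceLeft Q.counit (Q.TΔ2.symm (sliceRight Q.haar (Q.TΔ2 t) ⊗ₜ q)) := by
  induction t with
  | zero => simp
  | add s t hs ht => simp only [map_add, add_mul, TensorProduct.add_tmul, hs, ht]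
  | tmul y a =>
    have h : sliceRight Q.haar (Q.TΔ2 (y ⊗ₜ a)) ⊗ₜ[ℂ] q =
        Q.TΔ2 (Q.self.flipAct y (Q.self.V' (q ⊗ₜ a))) := (Q.self.T₁_flipAct y q a).symm
    rw [h, LinearEquiv.symm_apply_apply, antipodeAux_tmul, (Q.self.acts_actL Q.haar y).mul_right]
    generalize Q.self.V' (q ⊗ₜ a) = s
    induction s with
    | zero => simp
    | add s t hs ht => simp only [map_add, hs, ht]
    | tmul p b => simp [flipAct_tmul, counit_actR]

/-- The right hand side defines a priori only a left multiplier in `q`. Normalising with φ(q₀) = 1,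
`antipodeAux_mul` exhibits it as left multiplication by an element of A. -/
theorem exists_antipode : ∃ S : A →ₗ[ℂ] A,
    ∀ p q, S p * q = sliceLeft Q.counit (Q.TΔ2.symm (p ⊗ₜ q)) := by
  obtain ⟨q₀, hq₀⟩ := Q.exists_haar_eq_one
  refine ⟨Q.antipodeAux ∘ₗ Q.TΔ2.symm.toLinearMap ∘ₗ (TensorProduct.mk ℂ A A).flip q₀,
    fun p q => ?_⟩
  simp only [LinearMap.comp_apply, LinearEquiv.coe_coe, flip_apply, TensorProduct.mk_apply]
  rw [antipodeAux_mul, LinearEquiv.apply_symm_apply, sliceRight_tmul, hq₀, one_smul]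

/-- The antipode as a linear map. -/
def antipodeMap : A →ₗ[ℂ] A := Q.exists_antipode.choose

theorem antipodeMap_mul (p q : A) :
    Q.antipodeMap p * q = sliceLeft Q.counit (Q.TΔ2.symm (p ⊗ₜ q)) :=
  Q.exists_antipode.choose_spec p q

/-- The classical formula S((ι ⊗ φ)(Δ(y)(1 ⊗ a))) = (ι ⊗ φ)((1 ⊗ y)Δ(a)). By `induction_actR` such
elements span A, so it determines S. -/
theorem antipodeMap_actR (a y : A) :
    Q.antipodeMap (Q.self.actR Q.haar a y) = Q.self.actL Q.haar y a := by
  apply Q.nondegenerate.eq_of_mul_right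
  intro q
  rw [antipodeMap_mul, ← antipodeAux_tmul, antipodeAux_mul]
  rfl

theorem mul'_antipodeMap (t : A ⊗[ℂ] A) :
    mul' ℂ A (rTensor A Q.antipodeMap t) = sliceLeft Q.counit (Q.TΔ2.symm t) := by
  induction t with
  | zero => simp
  | add s t hs ht => simp only [map_add, hs, ht]
  | tmul p q => simp [antipodeMap_mul]

theorem mul'_antipodeMap_T₁ (a b : A) :
    mul' ℂ A (rTensor A Q.antipodeMap (Q.self.T₁ (a ⊗ₜ b))) = Q.counit a • b := by
  rw [mul'_antipodeMap, T₁_eq, LinearEquiv.symm_apply_apply, sliceLeft_tmul]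

theorem mul'_rTensor_lTensor_mulRight (S : A →ₗ[ℂ] A) (q : A) (t : A ⊗[ℂ] A) :
    mul' ℂ A (rTensor A S (lTensor A (mulRight ℂ q) t)) = mul' ℂ A (rTensor A S t) * q := by
  induction t with
  | zero => simp
  | add s t hs ht => simp only [map_add, add_mul, hs, ht]
  | tmul p q => simp [mul_assoc]

theorem mul'_antipodeMap_V' (p x : A) :
    mul' ℂ A (rTensor A Q.antipodeMap (Q.self.V' (p ⊗ₜ x))) = Q.counit x • Q.antipodeMap p := by
  have h : ∀ t, mul' ℂ A (rTensor A Q.antipodeMap (Q.self.L x t)) =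
      Q.counit x • mul' ℂ A (rTensor A Q.antipodeMap t) := by
    intro t
    obtain ⟨s, rfl⟩ := Q.T₁_surjective t
    induction s with
    | zero => simp
    | add s t hs ht => simp only [map_add, smul_add, hs, ht]
    | tmul y b =>
      rw [L_T₁, mul'_antipodeMap_T₁, mul'_antipodeMap_T₁, counit_mul, mul_smul]
  apply Q.nondegenerate.eq_of_mul_right
  intro q
  have := h (p ⊗ₜ q)
  rw [L_tmul, mul'_rTensor_lTensor_mulRight] at this
  rw [this]
  simp [smul_mul_assoc]

theorem antipodeMap_apply_mul (u p : A) :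
    Q.antipodeMap (u * p) = Q.antipodeMap p * Q.antipodeMap u := by
  have h : ∀ t : A ⊗[ℂ] A, mul' ℂ A (rTensor A (Q.antipodeMap ∘ₗ mulRight ℂ p) t) =
      Q.antipodeMap p * mul' ℂ A (rTensor A Q.antipodeMap t) := by
    intro t
    obtain ⟨s, rfl⟩ := Q.T₁_surjective t
    induction s with
    | zero => simp
    | add s t hs ht => simp only [map_add, mul_add, hs, ht]
    | tmul x q =>
      rw [rTensor_comp, LinearMap.comp_apply, T₁_rmul, mul'_rTensor_lTensor_mulRight,
        mul'_antipodeMap_V', mul'_antipodeMap_T₁]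
      simp [smul_mul_assoc, mul_smul_comm]
  apply Q.nondegenerate.eq_of_mul_right
  intro q
  have := h (u ⊗ₜ q)
  simpa [mul_assoc] using this

theorem sliceRight_T₁_surjective (b : A) :
    ∃ t, sliceRight Q.haar (Q.self.T₁ t) = b := by
  obtain ⟨q₀, hq₀⟩ := Q.exists_haar_eq_one
  obtain ⟨t, ht⟩ := Q.T₁_surjective (b ⊗ₜ q₀)
  exact ⟨t, by rw [ht, sliceRight_tmul, hq₀, one_smul]⟩

/-- Every element is a sum of elements `(ι ⊗ φ)(Δ(y)(1 ⊗ a))`. -/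
theorem induction_actR {p : A → Prop} (zero : p 0) (add : ∀ a b, p a → p b → p (a + b))
    (actR : ∀ a y, p (Q.self.actR Q.haar a y)) (b : A) : p b := by
  obtain ⟨t, rfl⟩ := Q.sliceRight_T₁_surjective b
  induction t with
  | zero => simpa using zero
  | add s t hs ht => rw [map_add, map_add]; exact add _ _ hs ht
  | tmul y a => exact actR a y

theorem mul'_antipodeMap_V (z x : A) :
    mul' ℂ A (lTensor A Q.antipodeMap (Q.self.V (z ⊗ₜ x))) = Q.counit x • z := by
  induction x using Q.induction_actR with
  | zero => simp
  | add s t hs ht => simp only [map_add, TensorProduct.tmul_add, hs, ht, add_smul]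
  | actR a y =>
    rw [V_actR, counit_actR, ← haar_V, ← R_V]
    generalize Q.self.V (z ⊗ₜ y) = t
    induction t with
    | zero => simp
    | add s t hs ht => simp only [map_add, hs, ht]
    | tmul u c =>
      rw [R_tmul, sliceRight_lTensor, ← Q.self.acts_actL]
      simp [antipodeMap_actR]

theorem conjM_antipodeMap_V' (z x : A) :
    mul' ℂ A (rTensor A (conjM Q.antipodeMap) (TensorProduct.comm ℂ A A
      (Q.self.V' (z ⊗ₜ x)))) = Q.counit x • z := by
  apply star_injective
  have h := Q.mul'_antipodeMap_V (star z) (star x)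
  rw [star_smul, ← counit_star, ← h, V'_tmul]
  generalize Q.self.V (star z ⊗ₜ star x) = t
  induction t with
  | zero => simp
  | add s t hs ht => simp only [map_add, star_add, hs, ht]
  | tmul u c => simp [conjM]

theorem eq_zero_of_antipodeMap_mul {c : A} (h : ∀ p, Q.antipodeMap p * c = 0) : c = 0 := by
  apply Q.nondegenerate.2
  intro a
  obtain ⟨b, hb⟩ : ∃ b, Q.counit b = 1 := by
    obtain ⟨q, hq⟩ := Q.exists_haar_eq_one
    by_contra! hb
    have h0 : Q.counit = 0 := by
      ext b
      by_contra h1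
      exact hb ((Q.counit b)⁻¹ • b) (by rw [map_smul, smul_eq_mul]; exact inv_mul_cancel₀ h1)
    have h1 := Q.counit_V
    simp only [h0] at h1
    have : ∀ x y : A, x * y = 0 := fun x y => by rw [← h1]; simp [sliceRight]
    have : q = 0 := Q.nondegenerate.1 q (this q)
    simp [this] at hq
  have h1 := Q.mul'_antipodeMap_V a b
  rw [hb, one_smul] at h1
  rw [← h1]
  generalize Q.self.V (a ⊗ₜ b) = t
  induction t with
  | zero => simp
  | add s t hs ht => simp only [map_add, add_mul, hs, ht, add_zero]
  | tmul u c => simp [mul_assoc, h]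

/-- Applying S to the conjugated antipode identity and using anti-multiplicativity shows that b ↦
S(S(b⋆)⋆) satisfies the same identity as b ↦ b. Bijectivity of S is thus a consequence of the
involution. -/
theorem antipodeMap_conjM (b : A) : Q.antipodeMap (conjM Q.antipodeMap b) = b := by
  have h : ∀ t : A ⊗[ℂ] A, mul' ℂ A (TensorProduct.map Q.antipodeMap
      (Q.antipodeMap ∘ₗ conjM Q.antipodeMap) t) = mul' ℂ A (rTensor A Q.antipodeMap t) := by
    intro t
    obtain ⟨s, rfl⟩ := Q.self.V'.surjective t
    induction s with
    | zero => simp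
    | add s t hs ht => simp only [map_add, hs, ht]
    | tmul z x =>
      rw [mul'_antipodeMap_V', ← map_smul, ← Q.conjM_antipodeMap_V' z x]
      generalize Q.self.V' (z ⊗ₜ x) = t
      induction t with
      | zero => simp
      | add s t hs ht => simp only [map_add, hs, ht]
      | tmul u c => simp [antipodeMap_apply_mul]
  rw [← sub_eq_zero]
  apply Q.eq_zero_of_antipodeMap_mul
  intro p
  have := h (p ⊗ₜ b)
  simp only [TensorProduct.map_tmul, rTensor_tmul, mul'_apply, LinearMap.comp_apply] at this
  rw [mul_sub, this, sub_self]

theorem conjM_antipodeMap (b : A) : conjM Q.antipodeMap (Q.antipodeMap b) = b := by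
  have h := Q.antipodeMap_conjM (star b)
  apply star_injective
  rw [← h]
  simp [conjM]

/-- The antipode. -/
def antipode : A ≃ₗ[ℂ] A where
  toFun := Q.antipodeMap
  map_add' := map_add _
  map_smul' := map_smul _
  invFun := conjM Q.antipodeMap
  left_inv := Q.conjM_antipodeMap
  right_inv := Q.antipodeMap_conjM

theorem isAntipode_antipode : Q.IsAntipode Q.counit Q.antipode :=
  ⟨Q.antipodeMap_apply_mul, Q.mul'_antipodeMap_T₁, Q.mul'_antipodeMap_V⟩

theorem IsAntipode.eq_antipode {Q : StarAlgebraicQuantumGroup A} {S : A ≃ₗ[ℂ] A}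
    (h : Q.IsAntipode Q.counit S) : S = Q.antipode := by
  ext p
  apply Q.nondegenerate.eq_of_mul_right
  intro q
  have : ∀ t, mul' ℂ A (rTensor A S.toLinearMap t) = mul' ℂ A (rTensor A Q.antipodeMap t) := by
    intro t
    obtain ⟨s, rfl⟩ := Q.TΔ2.surjective t
    induction s with
    | zero => simp
    | add s t hs ht => simp only [map_add, hs, ht]
    | tmul z x => exact (h.2.1 z x).trans (Q.mul'_antipodeMap_T₁ z x).symm
  exact this (p ⊗ₜ q)

theorem antipode_mul (a b : A) : Q.antipode (a * b) = Q.antipode b * Q.antipode a :=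
  Q.antipodeMap_apply_mul a b

theorem antipode_symm_mul (a b : A) :
    Q.antipode.symm (a * b) = Q.antipode.symm b * Q.antipode.symm a := by
  apply Q.antipode.injective
  simp [antipode_mul]

theorem antipode_actR (a y : A) :
    Q.antipode (Q.self.actR Q.haar a y) = Q.self.actL Q.haar y a := Q.antipodeMap_actR a y

theorem mul'_antipode_V' (p x : A) :
    mul' ℂ A (rTensor A Q.antipode.toLinearMap (Q.self.V' (p ⊗ₜ x))) =
      Q.counit x • Q.antipode p := Q.mul'_antipodeMap_V' p x

theorem haar_eq_zero_of_mul_eq_zero (h : ∀ a b, Q.haar (a * b) = 0) : False := by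
  have := Q.nontrivial
  exact Q.haar_ne_zero (Q.self.eq_zero_of_mul_eq_zero _ h)

end StarAlgebraicQuantumGroup

/-- A tensor is a combination of tensors whose second leg is one of its slices. -/
theorem mem_of_forall_sliceLeft {U V W : Type*} [AddCommGroup U] [Module ℂ U] [AddCommGroup V]
    [Module ℂ V] [AddCommGroup W] [Module ℂ W] (G : U ⊗[ℂ] V →ₗ[ℂ] W) (p : Submodule ℂ W)
    (t : U ⊗[ℂ] V) (h : ∀ (u : U) (ω : U →ₗ[ℂ] ℂ), G (u ⊗ₜ sliceLeft ω t) ∈ p) : G t ∈ p := by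
  classical
  let b := Module.Basis.ofVectorSpace ℂ U
  obtain ⟨s, rfl⟩ := (TensorProduct.equivFinsuppOfBasisLeft (N := V) b).symm.surjective t
  have key : ∀ i, sliceLeft (b.coord i) ((TensorProduct.equivFinsuppOfBasisLeft b).symm s) = s i := by
    intro i
    rw [TensorProduct.equivFinsuppOfBasisLeft_symm_apply]
    simp [Finsupp.sum, Finsupp.single_apply, eq_comm]
  rw [TensorProduct.equivFinsuppOfBasisLeft_symm_apply, Finsupp.sum, map_sum]
  refine Submodule.sum_mem _ fun i _ => ?_
  rw [← key i]
  exact h _ _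

namespace StarAlgebraicQuantumGroup

open Coact

variable (Q : StarAlgebraicQuantumGroup A)

/-- The left integral is faithful. -/
theorem eq_zero_of_haar_mul_left {y : A} (h : ∀ a, Q.haar (a * y) = 0) : y = 0 := by
  -- The left kernel of φ. The antipode formula shows that φ(c ·) acts by zero on `N`, so the slices
  -- of Δ(y) stay in `N` for y in `N`.
  let N : Submodule ℂ A := ⨅ c, LinearMap.ker (Q.haar ∘ₗ mulLeft ℂ c)
  have hN : ∀ y, y ∈ N ↔ ∀ c, Q.haar (c * y) = 0 := fun y => by simp [N]
  have hN0 : ∀ y ∈ N, ∀ c, Q.self.actL Q.haar c y = 0 := by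
    intro y hy c
    rw [← antipode_actR, actR_apply]
    have : sliceRight Q.haar (Q.self.T₁ (c ⊗ₜ y)) = 0 := by
      apply Q.nondegenerate.2
      intro z
      change z * Q.self.actR Q.haar y c = 0
      rw [Q.self.acts_actR, show Q.haar ∘ₗ mulRight ℂ y = 0 from LinearMap.ext ((hN y).1 hy)]
      simp [sliceRight]
    rw [this, map_zero]
  have hV' : ∀ y ∈ N, ∀ z (ω : A →ₗ[ℂ] ℂ), sliceLeft ω (Q.self.V' (z ⊗ₜ y)) ∈ N := by
    intro y hy z ω
    rw [hN]
    intro c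
    have := congrArg ω ((Q.self.acts_actL Q.haar c).mul_right y z)
    rw [hN0 y hy, zero_mul, map_zero, apply_sliceRight] at this
    exact this.symm
  have hV : ∀ y ∈ N, ∀ z (ω : A →ₗ[ℂ] ℂ), sliceLeft ω (Q.self.V (z ⊗ₜ y)) ∈ N := by
    intro y hy z ω
    rw [hN]
    intro c
    have := congrArg ω (Q.self.acts_actL Q.haar c z y)
    rw [hN0 y hy, mul_zero, map_zero, apply_sliceRight] at this
    exact this.symm
  have hε : ∀ y ∈ N, Q.counit y = 0 := by
    intro y hy
    by_contra hy0
    apply Q.haar_eq_zero_of_mul_eq_zero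
    have hmem : ∀ z, z ∈ N := by
      intro z
      -- If ε(y) ≠ 0, the antipode identity recovers an arbitrary `z` from slices of Δ(y) multiplied
      -- from the left by elements S(u). Then `N` would be all of A, and φ would vanish on products.
      have h1 : mul' ℂ A (rTensor A Q.antipode.toLinearMap
          (Q.self.V' (Q.antipode.symm z ⊗ₜ y))) ∈ N := by
        apply mem_of_forall_sliceLeft (mul' ℂ A ∘ₗ rTensor A Q.antipode.toLinearMap)
        intro u ω
        have h2 := hV' y hy (Q.antipode.symm z) ω
        rw [hN] at h2 ⊢
        intro c
        simp only [LinearMap.comp_apply, rTensor_tmul, mul'_apply, ← mul_assoc]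
        exact h2 _
      rw [mul'_antipode_V', LinearEquiv.apply_symm_apply] at h1
      have := N.smul_mem (Q.counit y)⁻¹ h1
      rwa [smul_smul, inv_mul_cancel₀ hy0, one_smul] at this
    intro a b
    exact (hN b).1 (hmem b) a
  apply Q.nondegenerate.2
  intro z
  rw [← counit_V, ← Submodule.mem_bot ℂ]
  apply mem_of_forall_sliceLeft
  intro u ω
  rw [sliceRight_tmul, hε _ (hV y ((hN y).2 h) z ω), zero_smul]
  exact Submodule.zero_mem _

/-- The functional `φ ∘ S` is right invariant if `φ` is left invariant. -/
theorem invariant_comp_antipode {ρ : A →ₗ[ℂ] ℂ}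
    (h : ∀ z x, sliceRight ρ (Q.self.V' (z ⊗ₜ x)) = ρ x • z) (x a : A) :
    sliceLeft (ρ ∘ₗ Q.antipode.toLinearMap) (Q.self.T₁ (x ⊗ₜ a)) = ρ (Q.antipode x) • a := by
  -- Every tensor is `T₁⁻¹ (b ⊗ q)` with `b` a sum of elements `actR a y`, for which `T₁_flipAct`
  -- gives the preimage explicitly.
  have key : ∀ t, sliceLeft (ρ ∘ₗ Q.antipode.toLinearMap) (Q.self.T₁ t) =
      sliceLeft (ρ ∘ₗ Q.antipode.toLinearMap) t := by
    intro t
    obtain ⟨s, hs⟩ : ∃ s, Q.TΔ2.symm s = t := Q.TΔ2.symm.surjective t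
    subst hs
    rw [T₁_eq, LinearEquiv.apply_symm_apply]
    induction s with
    | zero => simp
    | add s t hs ht => simp only [map_add, hs, ht]
    | tmul b q =>
      induction b using Q.induction_actR with
      | zero => simp
      | add s t hs ht => simp only [map_add, TensorProduct.add_tmul, hs, ht]
      | actR a y =>
        rw [← T₁_flipAct, T₁_eq, LinearEquiv.symm_apply_apply, ← T₁_eq, T₁_flipAct, sliceLeft_tmul]
        simp only [LinearMap.comp_apply, LinearEquiv.coe_coe, antipode_actR]
        rw [← h, V'_act_of_V Q.self (Q.self.V_actL Q.haar y)]
        generalize Q.self.V' (q ⊗ₜ a) = t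
        induction t with
        | zero => simp
        | add s t hs ht => simp only [map_add, hs, ht]
        | tmul u c => simp [flipAct_tmul, antipode_actR]
  rw [key, sliceLeft_tmul]
  rfl

end StarAlgebraicQuantumGroup
end StarGalois
end

/-! ### Positive functionals, invariant functionals and strong invariance -/

noncomputable section
namespace StarGalois
open Multiplier LinearMap

variable {A : Type*} [NonUnitalRing A] [Module ℂ A] [IsScalarTower ℂ A A] [SMulCommClass ℂ A A]
  [StarRing A] [StarModule ℂ A]
  {X : Type*} [NonUnitalRing X] [Module ℂ X] [IsScalarTower ℂ X X] [SMulCommClass ℂ X X]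
  [StarRing X] [StarModule ℂ X]

section Positive

theorem IsPositive.conj_apply {ω : X →ₗ[ℂ] ℂ} (h : IsPositive ω) (x y : X) :
    ω (star y * x) = star (ω (star x * y)) := by
  have key : ∀ c : ℂ, (c * ω (star x * y) + star c * ω (star y * x)).im = 0 := by
    intro c
    have h1 := (Complex.nonneg_iff.mp (h (x + c • y))).2
    have hx := (Complex.nonneg_iff.mp (h x)).2
    have hy := (Complex.nonneg_iff.mp (h (c • y))).2
    have h2 : star (x + c • y) * (x + c • y) = star x * x + star (c • y) * (c • y) +
        (c • (star x * y) + star c • (star y * x)) := by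
      simp only [star_add, star_smul, add_mul, mul_add, mul_smul_comm, smul_mul_assoc, smul_add]
      abel
    rw [h2, map_add, map_add, Complex.add_im, Complex.add_im, ← hx, ← hy] at h1
    simpa using h1.symm
  have h1 := key 1
  have hI := key Complex.I
  simp only [one_mul, star_one, Complex.add_im, Complex.mul_im, Complex.I_re, Complex.I_im,
    Complex.star_def, Complex.conj_I, Complex.neg_re, Complex.neg_im] at h1 hI
  apply Complex.ext
  · simp only [Complex.star_def, Complex.conj_re]
    linarith
  · simp only [Complex.star_def, Complex.conj_im]
    linarith

theorem IsPositive.posSemidef {ω : X →ₗ[ℂ] ℂ} (h : IsPositive ω) {n : ℕ} (u : Fin n → X) :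
    (Matrix.of fun i j => ω (star (u i) * u j)).PosSemidef := by
  apply Matrix.PosSemidef.of_dotProduct_mulVec_nonneg
  · ext i j
    simp only [Matrix.conjTranspose_apply, Matrix.of_apply]
    exact (h.conj_apply _ _).symm
  · intro x
    have := h (∑ i, x i • u i)
    convert this using 1
    simp only [dotProduct, Matrix.mulVec, Matrix.of_apply, star_sum, Finset.sum_mul,
      Finset.mul_sum, map_sum, star_smul, smul_mul_assoc, mul_smul_comm, map_smul, smul_eq_mul,
      Pi.star_apply]
    rw [Finset.sum_comm]
    refine Finset.sum_congr rfl fun i _ => Finset.sum_congr rfl fun j _ => ?_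
    ring

/-- The tensor product of positive functionals is positive. -/
theorem IsPositive.tensor {ω : X →ₗ[ℂ] ℂ} {ρ : A →ₗ[ℂ] ℂ} (h : IsPositive ω) (h' : IsPositive ρ)
    (t : X ⊗[ℂ] A) : 0 ≤ ω (sliceRight ρ (star t * t)) := by
  obtain ⟨n, u, a, rfl⟩ : ∃ (n : ℕ) (u : Fin n → X) (a : Fin n → A), t = ∑ i, u i ⊗ₜ[ℂ] a i := by
    induction t with
    | zero => exact ⟨0, Fin.elim0, Fin.elim0, by simp⟩
    | tmul x a => exact ⟨1, fun _ => x, fun _ => a, by simp⟩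
    | add s t hs ht =>
      obtain ⟨n, u, a, rfl⟩ := hs
      obtain ⟨m, v, b, rfl⟩ := ht
      exact ⟨n + m, Fin.append u v, Fin.append a b, by simp [Fin.sum_univ_add]⟩
  -- Schur product theorem: the Hadamard product of the two Gram matrices is positive semidefinite,
  -- and the value sought is its quadratic form at the all-ones vector.
  have := ((h.posSemidef u).hadamard (h'.posSemidef a)).dotProduct_mulVec_nonneg (fun _ => 1)
  convert this using 1
  simp only [dotProduct, Matrix.mulVec, Matrix.of_apply, star_sum, Finset.sum_mul,
    Finset.mul_sum, map_sum, TensorProduct.star_tmul, Algebra.TensorProduct.tmul_mul_tmul,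
    sliceRight_tmul, map_smul, smul_eq_mul, Pi.star_apply, star_one, one_mul, mul_one,
    Matrix.hadamard_apply]
  rw [Finset.sum_comm]
  refine Finset.sum_congr rfl fun i _ => Finset.sum_congr rfl fun j _ => ?_
  ring

end Positive

theorem eq_of_sliceLeft {U V ι : Type*} [AddCommGroup U] [Module ℂ U] [AddCommGroup V]
    [Module ℂ V] {f : ι → U →ₗ[ℂ] ℂ} (hf : ∀ v, (∀ i, f i v = 0) → v = 0) {s t : U ⊗[ℂ] V}
    (h : ∀ i, sliceLeft (f i) s = sliceLeft (f i) t) : s = t := by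
  apply eq_of_forall_sliceRight
  intro g
  rw [← sub_eq_zero, ← map_sub]
  apply hf
  intro i
  rw [apply_sliceRight, map_sub, h, sub_self, map_zero]

namespace Coact

variable {Q : StarAlgebraicQuantumGroup A}

/-- On products this is hermitian symmetry of the form; a functional vanishing on products vanishes,
so no unit is needed. -/
theorem star_apply_of_positive (P : Coact Q X) {ω : X →ₗ[ℂ] ℂ} (h : IsPositive ω) (x : X) :
    ω (star x) = star (ω x) := by
  have := Q.nontrivial
  have h1 : conjF ω - ω = 0 := by
    apply P.eq_zero_of_mul_eq_zero
    intro x y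
    have := h.conj_apply y (star x)
    rw [star_star] at this
    simp [conjF, this]
  have h2 := LinearMap.congr_fun (sub_eq_zero.mp h1) (star x)
  simpa [conjF] using h2.symm

end Coact

namespace StarAlgebraicQuantumGroup

variable (Q : StarAlgebraicQuantumGroup A)

theorem haar_star (a : A) : Q.haar (star a) = star (Q.haar a) :=
  Q.self.star_apply_of_positive Q.haar_positive a

theorem eq_zero_of_haar_mul_right {y : A} (h : ∀ a, Q.haar (y * a) = 0) : y = 0 := by
  apply star_injective
  rw [star_zero]
  apply Q.eq_zero_of_haar_mul_left
  intro a
  have := h (star a)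
  rw [← star_star (y * star a), haar_star] at this
  simpa using this

end StarAlgebraicQuantumGroup

namespace Coact

variable {Q : StarAlgebraicQuantumGroup A} (P : Coact Q X)

/-- `h` is the functional with `(ι ⊗ φ)α(x) = h(x)1`. -/
def LeftInv (h : X →ₗ[ℂ] ℂ) : Prop :=
  ∀ z x, sliceRight Q.haar (P.V (z ⊗ₜ x)) = h x • z

/-- `(ψ ⊗ ι)α(x) = ψ(x)1`. -/
def RightInv (ψ : X →ₗ[ℂ] ℂ) : Prop :=
  ∀ x a, sliceLeft ψ (P.T₁ (x ⊗ₜ a)) = ψ x • a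

variable {P}

namespace LeftInv

variable {h : X →ₗ[ℂ] ℂ}

theorem V' (H : P.LeftInv h) (z x : X) : sliceRight Q.haar (P.V' (z ⊗ₜ x)) = h x • z :=
  P.leftInvariant_V'_of_V H z x

/-- Write u ⊗ c as a sum of (z ⊗ 1)α(x); then (u ⊗ c)α(y) is a sum of (z ⊗ 1)α(xy), on which φ gives
h(xy)z. On the right, `y` enters only through the functional applied to a fixed tensor: this is the
source of faithfulness and of local finiteness. -/
theorem mul_actL (H : P.LeftInv h) (u y : X) (c : A) :
    u * P.actL Q.haar c y = sliceRight (h ∘ₗ mulRight ℂ y) (P.V.symm (u ⊗ₜ c)) := by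
  have key : ∀ t, sliceRight Q.haar (P.R y (P.V t)) = sliceRight (h ∘ₗ mulRight ℂ y) t := by
    intro t
    induction t with
    | zero => simp
    | add s t hs ht => simp only [map_add, hs, ht]
    | tmul z x => rw [R_V, H]; simp
  rw [← key, LinearEquiv.apply_symm_apply, R_tmul, sliceRight_lTensor, ← P.acts_actL]

theorem actR_mul (H : P.LeftInv h) (u y : X) (c : A) :
    P.actR Q.haar c y * u = sliceRight (h ∘ₗ mulLeft ℂ y) (P.V'.symm (u ⊗ₜ c)) := by
  have key : ∀ t, sliceRight Q.haar (P.L y (P.V' t)) = sliceRight (h ∘ₗ mulLeft ℂ y) t := by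
    intro t
    induction t with
    | zero => simp
    | add s t hs ht => simp only [map_add, hs, ht]
    | tmul z x => rw [L_V', H.V']; simp
  rw [← key, LinearEquiv.apply_symm_apply, L_tmul, sliceRight_lTensor,
    ← (P.acts_actR Q.haar c).mul_right]

variable [Nontrivial X]

/-- If h(· y) = 0, all slices of (u ⊗ 1)α(y) along φ(c ·) vanish by `mul_actL`. These functionals
separate A because φ is faithful, and `V` is injective. -/
theorem left_faithful (H : P.LeftInv h) {y : X} (hy : ∀ x, h (x * y) = 0) : y = 0 := by
  obtain ⟨u, hu⟩ := exists_ne (0 : X)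
  have h1 : P.V (u ⊗ₜ y) = 0 := by
    apply eq_zero_of_sliceRight (f := fun c => Q.haar ∘ₗ mulLeft ℂ c)
      (fun v hv => Q.eq_zero_of_haar_mul_left hv)
    intro c
    rw [← P.acts_actL, H.mul_actL, show h ∘ₗ mulRight ℂ y = 0 from LinearMap.ext hy]
    simp [sliceRight]
  by_contra hne
  exact tmul_ne_zero hu hne (P.V.injective (by rw [h1, map_zero]))

theorem right_faithful (H : P.LeftInv h) {y : X} (hy : ∀ x, h (y * x) = 0) : y = 0 := by
  obtain ⟨u, hu⟩ := exists_ne (0 : X)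
  have h1 : P.V' (u ⊗ₜ y) = 0 := by
    apply eq_zero_of_sliceRight (f := fun c => Q.haar ∘ₗ mulRight ℂ c)
      (fun v hv => Q.eq_zero_of_haar_mul_right hv)
    intro c
    rw [← (P.acts_actR Q.haar c).mul_right, H.actR_mul,
      show h ∘ₗ mulLeft ℂ y = 0 from LinearMap.ext hy]
    simp [sliceRight]
  by_contra hne
  exact tmul_ne_zero hu hne (P.V'.injective (by rw [h1, map_zero]))

theorem ext_left (H : P.LeftInv h) {y y' : X} (hy : ∀ x, h (x * y) = h (x * y')) : y = y' := by
  rw [← sub_eq_zero]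
  exact H.left_faithful fun x => by rw [mul_sub, map_sub, hy, sub_self]

theorem ext_right (H : P.LeftInv h) {y y' : X} (hy : ∀ x, h (y * x) = h (y' * x)) : y = y' := by
  rw [← sub_eq_zero]
  exact H.right_faithful fun x => by rw [sub_mul, map_sub, hy, sub_self]

theorem exists_mul_eq_one (H : P.LeftInv h) : ∃ x y, h (x * y) = 1 := by
  obtain ⟨u, hu⟩ := exists_ne (0 : X)
  by_contra! hne
  apply hu
  apply H.left_faithful
  intro x
  by_contra hx
  exact hne ((h (x * u))⁻¹ • x) u (by
    rw [smul_mul_assoc, map_smul, smul_eq_mul]; exact inv_mul_cancel₀ hx)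

end LeftInv

theorem RightInv.T₂ {ψ : X →ₗ[ℂ] ℂ} (hψ : P.RightInv ψ) (x : X) (a : A) :
    sliceLeft ψ (P.T₂ (x ⊗ₜ a)) = ψ x • a := by
  apply Q.nondegenerate.eq_of_mul_right
  intro b
  change mulRight ℂ b _ = _
  rw [← sliceLeft_lTensor, ← lmul_T₁_eq, sliceLeft_lTensor, hψ]
  simp [smul_mul_assoc]

theorem RightInv.conj {ψ : X →ₗ[ℂ] ℂ} (hψ : P.RightInv ψ) : P.RightInv (conjF ψ) := by
  intro x a
  rw [sliceLeft_conjF, star_T₁, hψ.T₂]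
  simp [conjF]

variable (P)

theorem antipode_symm_T₁ (p b : A) : mul' ℂ A (rTensor A Q.antipode.symm.toLinearMap
    (TensorProduct.comm ℂ A A (Q.self.T₁ (p ⊗ₜ Q.antipode b)))) = Q.counit p • b := by
  apply Q.nondegenerate.eq_of_mul_right
  intro z
  have h1 : ∀ t : A ⊗[ℂ] A, mul' ℂ A (rTensor A Q.antipode.symm.toLinearMap
      (TensorProduct.comm ℂ A A t)) * z = mul' ℂ A (rTensor A Q.antipode.symm.toLinearMap
      (TensorProduct.comm ℂ A A (rTensor A (mulRight ℂ z) t))) := by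
    intro t
    induction t with
    | zero => simp
    | add s t hs ht => simp only [map_add, add_mul, hs, ht]
    | tmul u c => simp [mul_assoc]
  have h2 : ∀ t : A ⊗[ℂ] A, mul' ℂ A (rTensor A Q.antipode.symm.toLinearMap
      (TensorProduct.comm ℂ A A (lTensor A (mulRight ℂ (Q.antipode b)) t))) =
      b * mul' ℂ A (rTensor A Q.antipode.symm.toLinearMap (TensorProduct.comm ℂ A A t)) := by
    intro t
    induction t with
    | zero => simp
    | add s t hs ht => simp only [map_add, mul_add, hs, ht]
    | tmul u c => simp [Q.antipode_symm_mul, mul_assoc]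
  rw [h1, T₁_rmul, h2]
  have h3 : mul' ℂ A (rTensor A Q.antipode.symm.toLinearMap (TensorProduct.comm ℂ A A
    (Q.self.V' (z ⊗ₜ p)))) = Q.counit p • z := Q.conjM_antipodeMap_V' z p
  rw [h3, mul_smul_comm, smul_mul_assoc]

/-- This uses S⁻¹(p₍₂₎S(b))p₍₁₎ = ε(p)b after coassociativity. It inverts `T₂` explicitly and gives
its surjectivity. -/
theorem T₂_antipode_symm_T₁ [Nontrivial X] (x : X) (b : A) :
    P.T₂ (lTensor X Q.antipode.symm.toLinearMap (P.T₁ (x ⊗ₜ Q.antipode b))) = x ⊗ₜ b := by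
  apply eq_of_rTensor P.nondegenerate.mulLeft_sep
  intro z
  have h1 : ∀ t : X ⊗[ℂ] A, rTensor A (mulLeft ℂ z)
      (P.T₂ (lTensor X Q.antipode.symm.toLinearMap t)) =
      lTensor X (mul' ℂ A ∘ₗ rTensor A Q.antipode.symm.toLinearMap ∘ₗ
        (TensorProduct.comm ℂ A A).toLinearMap)
        (TensorProduct.assoc ℂ X A A (rTensor A (P.Vl z) t)) := by
    intro t
    induction t with
    | zero => simp
    | add s t hs ht => simp only [map_add, hs, ht]
    | tmul y c =>
      rw [lTensor_tmul, lmul_T₂, rTensor_tmul]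
      change _ = lTensor X _ (TensorProduct.assoc ℂ X A A (P.V (z ⊗ₜ y) ⊗ₜ c))
      generalize P.V (z ⊗ₜ y) = s
      induction s with
      | zero => simp
      | add s t hs ht => simp only [map_add, TensorProduct.add_tmul, hs, ht]
      | tmul u c => simp
  rw [h1, assoc_Vl_T₁, ← LinearMap.comp_apply, ← lTensor_comp]
  rw [show (mul' ℂ A ∘ₗ rTensor A Q.antipode.symm.toLinearMap ∘ₗ
        (TensorProduct.comm ℂ A A).toLinearMap) ∘ₗ Q.comulR (Q.antipode b) =
      Q.counit.smulRight b from LinearMap.ext fun p => antipode_symm_T₁ p b]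
  rw [rTensor_tmul, mulLeft_apply, show z * x = z * (LinearMap.id : X →ₗ[ℂ] X) x from rfl, P.acts_counit]
  generalize P.V (z ⊗ₜ x) = s
  induction s with
  | zero => simp
  | add s t hs ht => simp only [map_add, TensorProduct.add_tmul, hs, ht]
  | tmul u c => simp [TensorProduct.smul_tmul]

theorem T₂_surjective [Nontrivial X] (t : X ⊗[ℂ] A) : ∃ s, P.T₂ s = t := by
  induction t with
  | zero => exact ⟨0, map_zero _⟩
  | add s t hs ht =>
    obtain ⟨s', rfl⟩ := hs
    obtain ⟨t', rfl⟩ := ht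
    exact ⟨s' + t', map_add _ _ _⟩
  | tmul x b => exact ⟨_, P.T₂_antipode_symm_T₁ x b⟩

theorem T₁_surjective [Nontrivial X] (t : X ⊗[ℂ] A) : ∃ s, P.T₁ s = t := by
  obtain ⟨s, hs⟩ := P.T₂_surjective (star t)
  refine ⟨star s, ?_⟩
  have : ∀ s, P.T₁ (star s) = star (P.T₂ s) := by
    intro s
    induction s with
    | zero => simp
    | add s t hs ht => simp only [star_add, map_add, hs, ht]
    | tmul x a => rw [star_T₂, TensorProduct.star_tmul]
  rw [this, hs, star_star]

/-- Strong invariance. -/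
theorem mul_sliceLeft_V [Nontrivial X] {ω : X →ₗ[ℂ] ℂ} {r : A →ₗ[ℂ] A}
    (hω : ∀ x a, sliceLeft ω (P.T₂ (x ⊗ₜ a)) = ω x • r a) (a : A) (x y : X) :
    a * sliceLeft ω (P.V (x ⊗ₜ y)) =
      r (a * Q.antipode.symm (sliceLeft ω (P.V' (y ⊗ₜ x)))) := by
  -- The map `r` is the identity for a right invariant functional and `Q.δr` for a left invariant
  -- one, so both forms of strong invariance result.
  have h1 : ∀ s, sliceLeft ω (P.R y (P.T₂ s)) = r (sliceLeft ω (rTensor A (mulRight ℂ y) s)) := by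
    intro s
    induction s with
    | zero => simp
    | add s t hs ht => simp only [map_add, hs, ht]
    | tmul x a => rw [R_T₂, hω]; simp
  have h2 := h1 (lTensor X Q.antipode.symm.toLinearMap (P.T₁ (x ⊗ₜ Q.antipode a)))
  rw [T₂_antipode_symm_T₁, R_tmul, sliceLeft_lTensor, ← lTensor_rTensor_comm, T₁_rmul,
    sliceLeft_lTensor, sliceLeft_lTensor] at h2
  simpa [Q.antipode_symm_mul] using h2

variable {P}

theorem RightInv.sliceLeft_V [Nontrivial X] {ψ : X →ₗ[ℂ] ℂ} (hψ : P.RightInv ψ) (x y : X) :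
    sliceLeft ψ (P.V (x ⊗ₜ y)) = Q.antipode.symm (sliceLeft ψ (P.V' (y ⊗ₜ x))) := by
  apply Q.nondegenerate.eq_of_mul_left
  intro a
  exact P.mul_sliceLeft_V (r := LinearMap.id) hψ.T₂ a x y

theorem Acts.apply_mul_left {f : A →ₗ[ℂ] ℂ} {K : X →ₗ[ℂ] X} (hK : P.Acts f K) (ω : X →ₗ[ℂ] ℂ)
    (x y : X) : ω (x * K y) = f (sliceLeft ω (P.V (x ⊗ₜ y))) := by
  rw [hK, apply_sliceRight]

theorem Acts.apply_mul_right {f : A →ₗ[ℂ] ℂ} {K : X →ₗ[ℂ] X} (hK : P.Acts f K) (ω : X →ₗ[ℂ] ℂ)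
    (x y : X) : ω (K x * y) = f (sliceLeft ω (P.V' (y ⊗ₜ x))) := by
  rw [hK.mul_right, apply_sliceRight]

/-- An invariant functional moves the action of f to the other factor at the cost of S⁻¹. -/
theorem RightInv.act [Nontrivial X] {ψ : X →ₗ[ℂ] ℂ} (hψ : P.RightInv ψ) {f : A →ₗ[ℂ] ℂ}
    {K K' : X →ₗ[ℂ] X} (hK : P.Acts f K) (hK' : P.Acts (f ∘ₗ Q.antipode.symm.toLinearMap) K')
    (x y : X) : ψ (x * K y) = ψ (K' x * y) := by
  rw [hK.apply_mul_left, hK'.apply_mul_right, hψ.sliceLeft_V]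
  rfl

end Coact
end StarGalois
end

/-! ### Modular automorphisms, comparison of the two integrals, uniqueness and existence -/

noncomputable section
namespace StarGalois
open Multiplier LinearMap

variable {A : Type*} [NonUnitalRing A] [Module ℂ A] [IsScalarTower ℂ A A] [SMulCommClass ℂ A A]
  [StarRing A] [StarModule ℂ A]
  {X : Type*} [NonUnitalRing X] [Module ℂ X] [IsScalarTower ℂ X X] [SMulCommClass ℂ X X]
  [StarRing X] [StarModule ℂ X]

/-- Two injective linear maps with the same range differ by a linear automorphism. -/
theorem exists_equiv_of_range {U W : Type*} [AddCommGroup U] [Module ℂ U] [AddCommGroup W]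
    [Module ℂ W] {β γ : U →ₗ[ℂ] W} (hβ : Function.Injective β) (hγ : Function.Injective γ)
    (h : ∀ v, ∃ w, β v = γ w) (h' : ∀ v, ∃ w, γ v = β w) :
    ∃ e : U ≃ₗ[ℂ] U, ∀ v, β (e v) = γ v := by
  have hr : LinearMap.range γ = LinearMap.range β := by
    apply le_antisymm
    · rintro _ ⟨v, rfl⟩
      obtain ⟨w, hw⟩ := h' v
      exact ⟨w, hw.symm⟩
    · rintro _ ⟨v, rfl⟩
      obtain ⟨w, hw⟩ := h v
      exact ⟨w, hw.symm⟩
  refine ⟨LinearEquiv.ofInjective γ hγ ≪≫ₗ LinearEquiv.ofEq _ _ hr ≪≫ₗ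
    (LinearEquiv.ofInjective β hβ).symm, fun v => ?_⟩
  have h1 := LinearEquiv.apply_symm_apply (LinearEquiv.ofInjective β hβ)
    (LinearEquiv.ofEq _ _ hr (LinearEquiv.ofInjective γ hγ v))
  exact congrArg Subtype.val h1

namespace StarAlgebraicQuantumGroup

variable (Q : StarAlgebraicQuantumGroup A)

/-- The right integral `φ ∘ S`. -/
def rightHaar : A →ₗ[ℂ] ℂ := Q.haar ∘ₗ Q.antipode.toLinearMap

theorem rightHaar_apply (a : A) : Q.rightHaar a = Q.haar (Q.antipode a) := rfl

theorem rightHaar_ne_zero : Q.rightHaar ≠ 0 := by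
  intro h
  apply Q.haar_ne_zero
  ext a
  have := LinearMap.congr_fun h (Q.antipode.symm a)
  simpa [rightHaar] using this

theorem leftInv_haar : Q.self.LeftInv Q.haar := Q.haar_V

theorem rightInv_rightHaar : Q.self.RightInv Q.rightHaar := Q.invariant_comp_antipode Q.haar_V'

end StarAlgebraicQuantumGroup

theorem exists_eq_one_of_ne_zero {U : Type*} [AddCommGroup U] [Module ℂ U] {ω : U →ₗ[ℂ] ℂ}
    (h : ω ≠ 0) : ∃ u, ω u = 1 := by
  by_contra! hne
  apply h
  ext a
  by_contra ha
  exact hne ((ω a)⁻¹ • a) (by rw [map_smul, smul_eq_mul]; exact inv_mul_cancel₀ ha)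

namespace Coact

variable {Q : StarAlgebraicQuantumGroup A} {P : Coact Q X} [Nontrivial X] {h ψ : X →ₗ[ℂ] ℂ}

/-- As `t` varies, the elements next to `y` on either side run through all of X. Hence the
functionals h(· v) and ψ(· w) form the same space, which is what produces the modular element. -/
theorem LeftInv.mul_sliceLeft_V'_symm (H : P.LeftInv h) (hψ : P.RightInv ψ) (t : X ⊗[ℂ] A)
    (y : X) : h (y * sliceLeft ψ (P.V'.symm t)) =
      ψ (y * sliceRight Q.rightHaar (P.T₂ (lTensor X Q.antipode.symm.toLinearMap t))) := by
  induction t with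
  | zero => simp
  | add s t hs ht => simp only [map_add, mul_add, hs, ht]
  | tmul u c =>
    have h1 := apply_sliceRight ψ (h ∘ₗ mulLeft ℂ y) (P.V'.symm (u ⊗ₜ c))
    rw [← H.actR_mul, (P.acts_actR Q.haar c).apply_mul_right] at h1
    have h2 := hψ.sliceLeft_V y u
    rw [LinearEquiv.eq_symm_apply] at h2
    rw [← h2] at h1
    refine h1.symm.trans ?_
    change _ = ψ (y * P.actL Q.rightHaar (Q.antipode.symm c) u)
    rw [(P.acts_actL Q.rightHaar _).apply_mul_left]
    simp [Q.rightHaar_apply, Q.antipode_mul]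

theorem LeftInv.sliceLeft_V_symm_mul (H : P.LeftInv h) (hψ : P.RightInv ψ) (t : X ⊗[ℂ] A)
    (y : X) : h (sliceLeft ψ (P.V.symm t) * y) =
      ψ (sliceRight (Q.haar ∘ₗ Q.antipode.symm.toLinearMap)
        (P.T₁ (lTensor X Q.antipode.toLinearMap t)) * y) := by
  induction t with
  | zero => simp
  | add s t hs ht => simp only [map_add, add_mul, hs, ht]
  | tmul u c =>
    have h1 := apply_sliceRight ψ (h ∘ₗ mulRight ℂ y) (P.V.symm (u ⊗ₜ c))
    rw [← H.mul_actL, (P.acts_actL Q.haar c).apply_mul_left, hψ.sliceLeft_V] at h1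
    refine h1.symm.trans ?_
    change _ = ψ (P.actR (Q.haar ∘ₗ Q.antipode.symm.toLinearMap) (Q.antipode c) u * y)
    rw [(P.acts_actR _ _).apply_mul_right]
    simp [Q.antipode_symm_mul]

theorem sliceLeft_symm_surjective (e : X ⊗[ℂ] X ≃ₗ[ℂ] X ⊗[ℂ] A) (hψ0 : ψ ≠ 0) (v : X) :
    ∃ t, sliceLeft ψ (e.symm t) = v := by
  obtain ⟨u, hu⟩ := exists_eq_one_of_ne_zero hψ0
  exact ⟨e (u ⊗ₜ v), by simp [hu]⟩

theorem sliceRight_T₂_surjective (P : Coact Q X) {ρ : A →ₗ[ℂ] ℂ} (hρ : ρ ≠ 0) (S : A ≃ₗ[ℂ] A)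
    (v : X) : ∃ t, sliceRight ρ (P.T₂ (lTensor X S.toLinearMap t)) = v := by
  obtain ⟨a, ha⟩ := exists_eq_one_of_ne_zero hρ
  obtain ⟨s, hs⟩ := P.T₂_surjective (v ⊗ₜ a)
  obtain ⟨t, ht⟩ := (LinearEquiv.lTensor X S).surjective s
  refine ⟨t, ?_⟩
  have : lTensor X S.toLinearMap t = s := ht
  rw [this, hs, sliceRight_tmul, ha, one_smul]

theorem sliceRight_T₁_surjective (P : Coact Q X) {ρ : A →ₗ[ℂ] ℂ} (hρ : ρ ≠ 0) (S : A ≃ₗ[ℂ] A)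
    (v : X) : ∃ t, sliceRight ρ (P.T₁ (lTensor X S.toLinearMap t)) = v := by
  obtain ⟨a, ha⟩ := exists_eq_one_of_ne_zero hρ
  obtain ⟨s, hs⟩ := P.T₁_surjective (v ⊗ₜ a)
  obtain ⟨t, ht⟩ := (LinearEquiv.lTensor X S).surjective s
  refine ⟨t, ?_⟩
  have : lTensor X S.toLinearMap t = s := ht
  rw [this, hs, sliceRight_tmul, ha, one_smul]

theorem LeftInv.rightInv_left_faithful (H : P.LeftInv h) (hψ : P.RightInv ψ) (hψ0 : ψ ≠ 0) {y : X}
    (hy : ∀ x, ψ (x * y) = 0) : y = 0 := by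
  apply H.left_faithful
  intro x
  obtain ⟨t, rfl⟩ := sliceLeft_symm_surjective P.V hψ0 x
  rw [H.sliceLeft_V_symm_mul hψ, hy]

theorem LeftInv.rightInv_right_faithful (H : P.LeftInv h) (hψ : P.RightInv ψ) (hψ0 : ψ ≠ 0) {y : X}
    (hy : ∀ x, ψ (y * x) = 0) : y = 0 := by
  apply H.right_faithful
  intro x
  obtain ⟨t, rfl⟩ := sliceLeft_symm_surjective P.V' hψ0 x
  rw [H.mul_sliceLeft_V'_symm hψ, hy]

theorem haar_comp_antipode_symm_ne_zero :
    Q.haar ∘ₗ Q.antipode.symm.toLinearMap ≠ 0 := by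
  intro h
  apply Q.haar_ne_zero
  ext a
  simpa using LinearMap.congr_fun h (Q.antipode a)

theorem injective_of_left {ω : X →ₗ[ℂ] ℂ} (hω : ∀ y, (∀ x, ω (x * y) = 0) → y = 0) :
    Function.Injective ((LinearMap.mul ℂ X).flip.compr₂ ω) := by
  rw [← LinearMap.ker_eq_bot, LinearMap.ker_eq_bot']
  intro y hy
  exact hω y fun x => LinearMap.congr_fun hy x

theorem injective_of_right {ω : X →ₗ[ℂ] ℂ} (hω : ∀ y, (∀ x, ω (y * x) = 0) → y = 0) :
    Function.Injective ((LinearMap.mul ℂ X).compr₂ ω) := by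
  rw [← LinearMap.ker_eq_bot, LinearMap.ker_eq_bot']
  intro y hy
  exact hω y fun x => LinearMap.congr_fun hy x

/-- `ψ(xy) = h(x r(y))`. -/
theorem LeftInv.exists_right_modular (H : P.LeftInv h) (hψ : P.RightInv ψ) (hψ0 : ψ ≠ 0) :
    ∃ r : X ≃ₗ[ℂ] X, ∀ x y, h (x * r y) = ψ (x * y) := by
  obtain ⟨r, hr⟩ := exists_equiv_of_range (injective_of_left fun y => H.left_faithful)
    (injective_of_left fun y => H.rightInv_left_faithful hψ hψ0) (fun v => by
      obtain ⟨t, rfl⟩ := sliceLeft_symm_surjective P.V' hψ0 v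
      exact ⟨_, LinearMap.ext fun y => H.mul_sliceLeft_V'_symm hψ t y⟩) (fun v => by
      obtain ⟨t, rfl⟩ := P.sliceRight_T₂_surjective Q.rightHaar_ne_zero Q.antipode.symm v
      exact ⟨_, LinearMap.ext fun y => (H.mul_sliceLeft_V'_symm hψ t y).symm⟩)
  exact ⟨r, fun x y => LinearMap.congr_fun (hr y) x⟩

/-- `ψ(xy) = h(p(x) y)`. -/
theorem LeftInv.exists_left_modular (H : P.LeftInv h) (hψ : P.RightInv ψ) (hψ0 : ψ ≠ 0) :
    ∃ p : X ≃ₗ[ℂ] X, ∀ x y, h (p x * y) = ψ (x * y) := by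
  obtain ⟨r, hr⟩ := exists_equiv_of_range (injective_of_right fun y => H.right_faithful)
    (injective_of_right fun y => H.rightInv_right_faithful hψ hψ0) (fun v => by
      obtain ⟨t, rfl⟩ := sliceLeft_symm_surjective P.V hψ0 v
      exact ⟨_, LinearMap.ext fun y => H.sliceLeft_V_symm_mul hψ t y⟩) (fun v => by
      obtain ⟨t, rfl⟩ := P.sliceRight_T₁_surjective (haar_comp_antipode_symm_ne_zero (Q := Q))
        Q.antipode v
      exact ⟨_, LinearMap.ext fun y => (H.sliceLeft_V_symm_mul hψ t y).symm⟩)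
  exact ⟨r, fun x y => LinearMap.congr_fun (hr x) y⟩

/-- A positive h is hermitian, so applying the involution to `hk` gives the reverse inclusion
between the spaces of functionals h(w ·) and h(· w'). -/
theorem LeftInv.exists_modular_of (H : P.LeftInv h) (hpos : IsPositive h)
    (hk : ∀ w, ∃ w', ∀ y, h (w * y) = h (y * w')) :
    ∃ σ : X ≃ₗ[ℂ] X, ∀ x y, h (y * σ x) = h (x * y) := by
  obtain ⟨σ, hσ⟩ := exists_equiv_of_range (injective_of_left fun y => H.left_faithful)
    (injective_of_right fun y => H.right_faithful) (fun v => by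
      obtain ⟨w, hw⟩ := hk (star v)
      refine ⟨star w, LinearMap.ext fun y => ?_⟩
      have := congrArg star (hw (star y))
      rw [← P.star_apply_of_positive hpos, ← P.star_apply_of_positive hpos] at this
      simpa using this) (fun v => by
      obtain ⟨w, hw⟩ := hk v
      exact ⟨w, LinearMap.ext hw⟩)
  exact ⟨σ, fun x y => LinearMap.congr_fun (hσ x) y⟩

end Coact

namespace StarAlgebraicQuantumGroup

open Coact

variable (Q : StarAlgebraicQuantumGroup A)

/-- Write `u` as the result of an action. Strong invariance moves the action to `y`, and ψ = φ ∘ S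
reverses the order of the product. -/
theorem exists_rightHaar_mul_eq (u : A) : ∃ v, ∀ y, Q.rightHaar (u * y) = Q.haar (y * v) := by
  have := Q.nontrivial
  obtain ⟨t, rfl⟩ := Q.self.sliceRight_T₂_surjective (haar_comp_antipode_symm_ne_zero (Q := Q))
    Q.antipode u
  refine ⟨sliceLeft Q.haar (Q.self.V' (rTensor A Q.antipode.toLinearMap t)), fun y => ?_⟩
  induction t with
  | zero => simp
  | add s t hs ht => simp only [map_add, add_mul, mul_add, hs, ht]
  | tmul x a =>
    change Q.rightHaar (Q.self.actL (Q.haar ∘ₗ Q.antipode.symm.toLinearMap) (Q.antipode a) x * y) =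
      Q.haar (y * sliceLeft Q.haar (Q.self.V' (Q.antipode x ⊗ₜ a)))
    have h1 : Q.self.Acts ((Q.haar ∘ₗ mulRight ℂ a) ∘ₗ Q.antipode.symm.toLinearMap)
        (Q.self.actL (Q.haar ∘ₗ Q.antipode.symm.toLinearMap) (Q.antipode a)) := by
      convert Q.self.acts_actL (Q.haar ∘ₗ Q.antipode.symm.toLinearMap) (Q.antipode a) using 1
      ext b
      simp [Q.antipode_symm_mul]
    rw [← Q.rightInv_rightHaar.act (Q.self.acts_actR Q.haar a) h1, rightHaar_apply, antipode_mul,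
      antipode_actR, (Q.self.acts_actL Q.haar y).apply_mul_right]
    rfl

theorem exists_modular : ∃ σ : A ≃ₗ[ℂ] A, ∀ x y, Q.haar (y * σ x) = Q.haar (x * y) := by
  have := Q.nontrivial
  apply Q.leftInv_haar.exists_modular_of Q.haar_positive
  intro w
  obtain ⟨p, hp⟩ := Q.leftInv_haar.exists_left_modular Q.rightInv_rightHaar Q.rightHaar_ne_zero
  obtain ⟨v, hv⟩ := Q.exists_rightHaar_mul_eq (p.symm w)
  exact ⟨v, fun y => by rw [← hv, ← hp, LinearEquiv.apply_symm_apply]⟩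

/-- The modular automorphism of the left integral. -/
def σ : A ≃ₗ[ℂ] A := Q.exists_modular.choose

theorem haar_mul_σ (x y : A) : Q.haar (y * Q.σ x) = Q.haar (x * y) :=
  Q.exists_modular.choose_spec x y

end StarAlgebraicQuantumGroup

namespace Coact

variable {Q : StarAlgebraicQuantumGroup A} {P : Coact Q X} {h ψ : X →ₗ[ℂ] ℂ}

/-- By definition of σ, the functionals φ(c ·) and φ(· σ(c)) coincide. -/
theorem actL_haar (P : Coact Q X) (c : A) : P.actL Q.haar c = P.actR Q.haar (Q.σ c) := by
  refine (P.acts_actL Q.haar c).unique ?_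
  convert P.acts_actR Q.haar (Q.σ c) using 1
  ext b
  simp [Q.haar_mul_σ]

variable [Nontrivial X]

/-- The modular property passes from A to X: `mul_actL` involves h(· y), `actR_mul` involves h(y ·),
and `actL_haar` identifies their left hand sides. -/
theorem LeftInv.exists_modular (H : P.LeftInv h) (hpos : IsPositive h) :
    ∃ σ : X ≃ₗ[ℂ] X, ∀ x y, h (y * σ x) = h (x * y) := by
  apply H.exists_modular_of hpos
  intro w
  obtain ⟨u, e, hue⟩ : ∃ u e : X, u * e ≠ 0 := by
    by_contra! hne
    obtain ⟨u, hu⟩ := exists_ne (0 : X)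
    exact hu (P.nondegenerate.1 u (hne u))
  obtain ⟨ω, hω⟩ := exists_functional_ne_zero hue
  let Λ : X ⊗[ℂ] A →ₗ[ℂ] X ⊗[ℂ] X := rTensor X (mul' ℂ X) ∘ₗ
    (TensorProduct.assoc ℂ X X X).symm.toLinearMap ∘ₗ
    lTensor X (P.V'.symm.toLinearMap ∘ₗ TensorProduct.mk ℂ X A e ∘ₗ Q.σ.toLinearMap)
  have hΛ : ∀ (g : X →ₗ[ℂ] ℂ) (u : X) (s : X ⊗[ℂ] X), sliceRight g (rTensor X (mul' ℂ X)
      ((TensorProduct.assoc ℂ X X X).symm (u ⊗ₜ s))) = u * sliceRight g s := by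
    intro g u s
    induction s with
    | zero => simp
    | add s t hs ht => simp only [map_add, TensorProduct.tmul_add, mul_add, hs, ht]
    | tmul x y => simp [mul_smul_comm]
  have key : ∀ y t, sliceRight (h ∘ₗ mulRight ℂ y) (P.V.symm t) * e =
      sliceRight (h ∘ₗ mulLeft ℂ y) (Λ t) := by
    intro y t
    induction t with
    | zero => simp
    | add s t hs ht => simp only [map_add, add_mul, hs, ht]
    | tmul u c =>
      rw [← H.mul_actL, actL_haar, mul_assoc, H.actR_mul, ← hΛ]
      rfl
  refine ⟨sliceLeft ω (Λ (P.V (u ⊗ₜ w))), fun y => ?_⟩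
  have h1 := congrArg ω (key y (P.V (u ⊗ₜ w)))
  rw [apply_sliceRight, LinearEquiv.symm_apply_apply, sliceRight_tmul, smul_mul_assoc, map_smul,
    hω] at h1
  simpa using h1

theorem Adm.comp_antipode_symm {f : A →ₗ[ℂ] ℂ} (hf : Adm f) :
    Adm (f ∘ₗ Q.antipode.symm.toLinearMap) := by
  obtain ⟨ρ, b, rfl⟩ | ⟨ρ, b, rfl⟩ := hf
  · refine Or.inr ⟨ρ ∘ₗ Q.antipode.symm.toLinearMap, Q.antipode b, ?_⟩
    ext; simp [Q.antipode_symm_mul]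
  · refine Or.inl ⟨ρ ∘ₗ Q.antipode.symm.toLinearMap, Q.antipode b, ?_⟩
    ext; simp [Q.antipode_symm_mul]

/-- Invariant functionals are unique up to a scalar. -/
theorem LeftInv.rightInv_unique (H : P.LeftInv h) (hψ : P.RightInv ψ) (hψ0 : ψ ≠ 0)
    {ψ' : X →ₗ[ℂ] ℂ} (hψ' : P.RightInv ψ') : ∃ c : ℂ, ψ' = c • ψ := by
  by_cases hψ0' : ψ' = 0
  · exact ⟨0, by simp [hψ0']⟩
  obtain ⟨r, hr⟩ := H.exists_right_modular hψ hψ0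
  obtain ⟨r', hr'⟩ := H.exists_right_modular hψ' hψ0'
  -- The density of ψ' with respect to ψ. It commutes with left multiplication and with the action
  -- of functionals, hence with the expression in `mul_actL`; that makes it a scalar.
  let D : X →ₗ[ℂ] X := r.symm.toLinearMap ∘ₗ r'.toLinearMap
  have hD : ∀ x y, ψ (x * D y) = ψ' (x * y) := by
    intro x y
    rw [← hr, ← hr']
    simp [D]
  have ext : ∀ {y y'}, (∀ x, ψ (x * y) = ψ (x * y')) → y = y' := by
    intro y y' hy
    rw [← sub_eq_zero]
    exact H.rightInv_left_faithful hψ hψ0 fun x => by rw [mul_sub, map_sub, hy, sub_self]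
  have hDmul : ∀ z y, D (z * y) = z * D y := by
    intro z y
    apply ext
    intro x
    rw [hD, ← mul_assoc, ← mul_assoc, hD]
  have hDact : ∀ c y, D (P.actL Q.haar c y) = P.actL Q.haar c (D y) := by
    intro c y
    have h1 := P.acts_actL Q.haar c
    have h2 := P.acts_act (Adm.comp_antipode_symm (Q := Q) (Or.inr ⟨Q.haar, c, rfl⟩))
    apply ext
    intro x
    rw [hD, hψ'.act h1 h2, hψ.act h1 h2, hD]
  obtain ⟨q, y, hqy⟩ := H.exists_mul_eq_one
  have hscal : ∀ p, D p = h (q * D y) • p := by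
    intro p
    have key : ∀ t, D (sliceRight (h ∘ₗ mulRight ℂ y) (P.V.symm t)) =
        sliceRight (h ∘ₗ mulRight ℂ (D y)) (P.V.symm t) := by
      intro t
      induction t with
      | zero => simp
      | add s t hs ht => simp only [map_add, hs, ht]
      | tmul u c => rw [← H.mul_actL, ← H.mul_actL, hDmul, hDact]
    -- For `t = V (p ⊗ q)` the two slices are h(qy)p = p and h(q D y)p.
    simpa [hqy] using key (P.V (p ⊗ₜ q))
  refine ⟨h (q * D y), ?_⟩
  have := Q.nontrivial
  rw [← sub_eq_zero]
  apply P.eq_zero_of_mul_eq_zero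
  intro x z
  simp only [LinearMap.sub_apply, LinearMap.smul_apply]
  rw [← hD, hscal, mul_smul_comm, map_smul, sub_self]

end Coact

namespace StarAlgebraicQuantumGroup

open Coact

variable (Q : StarAlgebraicQuantumGroup A)

/-- Left invariant functionals are unique up to a scalar. -/
theorem leftInv_unique {ρ : A →ₗ[ℂ] ℂ}
    (hρ : ∀ z x, sliceRight ρ (Q.self.V (z ⊗ₜ x)) = ρ x • z) : ∃ c : ℂ, ρ = c • Q.haar := by
  have := Q.nontrivial
  obtain ⟨c, hc⟩ := Q.leftInv_haar.rightInv_unique Q.rightInv_rightHaar Q.rightHaar_ne_zero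
    (Q.invariant_comp_antipode (Q.self.leftInvariant_V'_of_V hρ))
  refine ⟨c, ?_⟩
  ext a
  simpa [rightHaar] using LinearMap.congr_fun hc (Q.antipode.symm a)

end StarAlgebraicQuantumGroup

/-- The existence of an invariant functional. -/
theorem Coact.exists_rightInv {Q : StarAlgebraicQuantumGroup A} (P : Coact Q X) [Nontrivial X] :
    ∃ ψ : X →ₗ[ℂ] ℂ, ψ ≠ 0 ∧ P.RightInv ψ := by
  -- Averaging any functional with the right integral of A gives an invariant functional.
  have hinv : ∀ (ω : X →ₗ[ℂ] ℂ) z, P.RightInv (ω ∘ₗ sliceRight Q.rightHaar ∘ₗ P.Vl z) := by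
    intro ω z x a
    have h1 : ∀ t : X ⊗[ℂ] A, sliceLeft (ω ∘ₗ sliceRight Q.rightHaar ∘ₗ P.Vl z) t =
        sliceLeft ω (lTensor X (sliceLeft Q.rightHaar)
          (TensorProduct.assoc ℂ X A A (rTensor A (P.Vl z) t))) := by
      intro t
      induction t with
      | zero => simp
      | add s t hs ht => simp only [map_add, hs, ht]
      | tmul u c =>
        simp only [sliceLeft_tmul, rTensor_tmul, LinearMap.comp_apply]
        generalize P.Vl z u = s
        induction s with
        | zero => simp
        | add s t hs ht => simp only [map_add, TensorProduct.add_tmul, add_smul, hs, ht]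
        | tmul u c => simp [smul_smul]
    rw [h1, P.assoc_Vl_T₁, ← LinearMap.comp_apply (lTensor X _), ← lTensor_comp,
      show sliceLeft Q.rightHaar ∘ₗ Q.comulR a = Q.rightHaar.smulRight a from
        LinearMap.ext fun p => Q.rightInv_rightHaar p a, sliceLeft_lTensor]
    change Q.rightHaar (sliceLeft ω (P.V (z ⊗ₜ x))) • a =
      ω (sliceRight Q.rightHaar (P.V (z ⊗ₜ x))) • a
    rw [apply_sliceRight]
  by_contra! hne
  obtain ⟨a, ha⟩ := exists_eq_one_of_ne_zero Q.rightHaar_ne_zero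
  obtain ⟨u, hu⟩ := exists_ne (0 : X)
  obtain ⟨ω, hω⟩ := exists_functional_ne_zero hu
  -- If all averages vanished, surjectivity of `V` would force the right integral to vanish.
  have hz : ∀ t, ω (sliceRight Q.rightHaar (P.V t)) = 0 := by
    intro t
    induction t with
    | zero => simp
    | add s t hs ht => simp only [map_add, hs, ht, add_zero]
    | tmul z x =>
      by_contra h0
      refine hne (ω ∘ₗ sliceRight Q.rightHaar ∘ₗ P.Vl z) (fun h1 => h0 ?_) (hinv ω z)
      exact LinearMap.congr_fun h1 x
  have := hz (P.V.symm (u ⊗ₜ a))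
  simp [ha, hω] at this

end StarGalois
end

/-! ### Existence and positivity of φ_X, and the modular element of A -/

noncomputable section
namespace StarGalois
open Multiplier LinearMap

variable {A : Type*} [NonUnitalRing A] [Module ℂ A] [IsScalarTower ℂ A A] [SMulCommClass ℂ A A]
  [StarRing A] [StarModule ℂ A]
  {X : Type*} [NonUnitalRing X] [Module ℂ X] [IsScalarTower ℂ X X] [SMulCommClass ℂ X X]
  [StarRing X] [StarModule ℂ X]

theorem rTensor_mul_of_mul_eq {l r : X →ₗ[ℂ] X} (hlr : ∀ x y, x * l y = r x * y)
    (s t : X ⊗[ℂ] A) : rTensor A r s * t = s * rTensor A l t := by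
  induction s with
  | zero => simp
  | add s s' hs hs' => simp only [map_add, add_mul, hs, hs']
  | tmul x b =>
    induction t with
    | zero => simp
    | add t t' ht ht' => simp only [map_add, mul_add, ht, ht']
    | tmul y c => simp [hlr]

theorem star_rTensor (k : X →ₗ[ℂ] X) (t : X ⊗[ℂ] A) :
    star (rTensor A k t) = rTensor A (Coact.conjM k) (star t) := by
  induction t with
  | zero => simp
  | add s t hs ht => simp only [map_add, star_add, hs, ht]
  | tmul x y => simp [Coact.conjM]

theorem nonneg_of_mul_nonneg_of_pos {a b : ℂ} (ha : 0 < a) (hab : 0 ≤ a * b) : 0 ≤ b := by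
  rw [Complex.pos_iff] at ha
  rw [Complex.nonneg_iff] at hab ⊢
  rw [Complex.mul_re, Complex.mul_im, ← ha.2, zero_mul, zero_mul, sub_zero, add_zero] at hab
  refine ⟨nonneg_of_mul_nonneg_right hab.1 ha.1, ?_⟩
  exact ((mul_eq_zero.mp hab.2.symm).resolve_left ha.1.ne').symm

namespace Coact

variable {Q : StarAlgebraicQuantumGroup A} (P : Coact Q X)

/-- Right multiplication by `(ι ⊗ φ)α(x)`. -/
def haarR (x : X) : X →ₗ[ℂ] X :=
  sliceRight Q.haar ∘ₗ P.V.toLinearMap ∘ₗ (TensorProduct.mk ℂ X X).flip x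

/-- Left multiplication by `(ι ⊗ φ)α(x)`. -/
def haarL (x : X) : X →ₗ[ℂ] X :=
  sliceRight Q.haar ∘ₗ P.V'.toLinearMap ∘ₗ (TensorProduct.mk ℂ X X).flip x

theorem haarR_apply (x z : X) : P.haarR x z = sliceRight Q.haar (P.V (z ⊗ₜ x)) := rfl

theorem haarL_apply (x z : X) : P.haarL x z = sliceRight Q.haar (P.V' (z ⊗ₜ x)) := rfl

theorem mul_haarL (x w z : X) : w * P.haarL x z = P.haarR x w * z := by
  change mulLeft ℂ w _ = mulRight ℂ z _
  rw [haarL_apply, haarR_apply, ← sliceRight_rTensor, lmul_V', sliceRight_rTensor]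

/-- Left invariance of φ on the last leg of (α ⊗ ι)α = (ι ⊗ Δ)α. Together with its conjugate it says
that the multiplier (ι ⊗ φ)α(x) is coinvariant. -/
theorem V_haarR (x v z : X) : P.V (v ⊗ₜ P.haarR x z) = rTensor A (P.haarR x) (P.V (v ⊗ₜ z)) := by
  rw [haarR_apply, V_slice_V]
  generalize P.V (v ⊗ₜ z) = t
  induction t with
  | zero => simp
  | add s t hs ht => simp only [map_add, hs, ht]
  | tmul u c =>
    rw [lTensor_mulVl_tmul, show sliceRight Q.haar ∘ₗ Q.self.Vl c = Q.haar.smulRight c from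
      LinearMap.ext fun b => Q.haar_V c b, rTensor_tmul, haarR_apply]
    generalize P.V (u ⊗ₜ x) = t
    induction t with
    | zero => simp
    | add s t hs ht => simp only [map_add, TensorProduct.add_tmul, hs, ht]
    | tmul u c => simp [TensorProduct.smul_tmul]

theorem conjF_haar : conjF Q.haar = Q.haar := by
  ext a
  simp [conjF, Q.haar_star]

theorem haarL_eq (x : X) : P.haarL x = conjM (P.haarR (star x)) := by
  ext z
  simp only [conjM, LinearMap.coe_mk, AddHom.coe_mk]
  rw [haarL_apply, haarR_apply, V'_tmul, ← conjF_haar, sliceRight_conjF, star_star, conjF_haar]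

theorem V'_haarL (x v z : X) :
    P.V' (v ⊗ₜ P.haarL x z) = rTensor A (P.haarL x) (P.V' (v ⊗ₜ z)) := by
  apply star_injective
  rw [star_rTensor, V'_tmul, star_star, V'_tmul, star_star, haarL_eq]
  have : conjM (conjM (P.haarR (star x))) = P.haarR (star x) := by ext; simp [conjM]
  rw [this, ← V_haarR]
  simp [conjM]

theorem R_haarR (x z : X) (t : X ⊗[ℂ] A) :
    P.R (P.haarR x z) t = rTensor A (P.haarR x) (P.R z t) := by
  induction t with
  | zero => simp
  | add s t hs ht => simp only [map_add, hs, ht]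
  | tmul v c => rw [R_tmul, R_tmul, V_haarR, lTensor_rTensor_comm]

theorem L_haarL (x z : X) (t : X ⊗[ℂ] A) :
    P.L (P.haarL x z) t = rTensor A (P.haarL x) (P.L z t) := by
  induction t with
  | zero => simp
  | add s t hs ht => simp only [map_add, hs, ht]
  | tmul v c => rw [L_tmul, L_tmul, V'_haarL, lTensor_rTensor_comm]

theorem L_haarR (x z : X) (t : X ⊗[ℂ] A) :
    P.L (P.haarR x z) t = P.L z (rTensor A (P.haarL x) t) := by
  apply P.nondeg.eq_of_mul_left
  intro s
  rw [mul_L, mul_L, R_haarR, rTensor_mul_of_mul_eq (P.mul_haarL x)]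

theorem R_haarL (x z : X) (t : X ⊗[ℂ] A) :
    P.R (P.haarL x z) t = P.R z (rTensor A (P.haarR x) t) := by
  apply P.nondeg.eq_of_mul_right
  intro s
  rw [← mul_L, ← mul_L, L_haarL, rTensor_mul_of_mul_eq (P.mul_haarL x)]

end Coact

theorem StarGaloisObject.exists_leftInv {Q : StarAlgebraicQuantumGroup A}
    (G : StarGaloisObject Q X) [Nontrivial X] : ∃ h, G.toCoact.LeftInv h := by
  have key : ∀ x, ∃ c : ℂ, ∀ z, sliceRight Q.haar (G.toCoact.V (z ⊗ₜ x)) = c • z := by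
    intro x
    obtain ⟨c, hc⟩ := G.coinvariants
      (Multiplier.mk (G.toCoact.haarL x) (G.toCoact.haarR x) (G.toCoact.mul_haarL x))
      (fun z => multiplier_ext (fun t => G.toCoact.L_haarL x z t) fun t => G.toCoact.R_haarL x z t)
      (fun z => multiplier_ext (fun t => G.toCoact.L_haarR x z t) fun t => G.toCoact.R_haarR x z t)
    refine ⟨c, fun z => ?_⟩
    have := congrArg (fun m => right m z) hc
    refine Eq.trans this ?_
    rw [Algebra.algebraMap_eq_smul_one]
    rfl
  obtain ⟨u, hu⟩ := exists_ne (0 : X)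
  obtain ⟨ω, hω⟩ := exists_functional_ne_zero hu
  refine ⟨ω ∘ₗ sliceRight Q.haar ∘ₗ G.toCoact.Vl u, fun z x => ?_⟩
  obtain ⟨c, hc⟩ := key x
  rw [hc]
  have : (ω ∘ₗ sliceRight Q.haar ∘ₗ G.toCoact.Vl u) x = c := by
    change ω (sliceRight Q.haar (G.toCoact.V (u ⊗ₜ x))) = c
    rw [hc, map_smul, hω, smul_eq_mul, mul_one]
  rw [this]

namespace Coact

variable {Q : StarAlgebraicQuantumGroup A} {P : Coact Q X} {h ψ : X →ₗ[ℂ] ℂ}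

/-- Otherwise polarization shows that ω vanishes on all products, hence vanishes. -/
theorem exists_pos_of_positive (P : Coact Q X) {ω : X →ₗ[ℂ] ℂ} (hω : IsPositive ω) (h0 : ω ≠ 0) :
    ∃ z, 0 < ω (star z * z) := by
  by_contra! hne
  have hz : ∀ z, ω (star z * z) = 0 := fun z => by
    by_contra h1
    exact hne z (lt_of_le_of_ne (hω z) (Ne.symm h1))
  apply h0
  have := Q.nontrivial
  apply P.eq_zero_of_mul_eq_zero
  have hxy : ∀ x y, ω (star x * y) + ω (star y * x) = 0 := by
    intro x y
    have := hz (x + y)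
    simpa [star_add, add_mul, mul_add, hz, add_comm] using this
  intro x y
  have h1 := hxy (star x) y
  have h2 := hxy (star x) (Complex.I • y)
  simp only [star_star, star_smul, smul_mul_assoc, mul_smul_comm, map_smul, smul_eq_mul,
    Complex.star_def, Complex.conj_I] at h1 h2
  have h3 : ω (x * y) - ω (star y * star x) = 0 := by
    have : Complex.I * (ω (x * y) - ω (star y * star x)) = 0 := by rw [← h2]; ring
    exact (mul_eq_zero.mp this).resolve_left Complex.I_ne_zero
  linear_combination (h1 + h3) / 2

/-- Evaluate ω ⊗ φ on the square of α(x)(z ⊗ 1): invariance gives ω(z⋆z)h(x⋆x), and z can be chosen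
with ω(z⋆z) > 0. -/
theorem LeftInv.positive (H : P.LeftInv h) {ω : X →ₗ[ℂ] ℂ} (hω : IsPositive ω) (h0 : ω ≠ 0) :
    IsPositive h := by
  obtain ⟨z, hz⟩ := P.exists_pos_of_positive hω h0
  intro x
  have h1 := hω.tensor Q.haar_positive (P.V' (z ⊗ₜ x))
  have h2 : star (P.V' (z ⊗ₜ x)) = P.V (star z ⊗ₜ star x) := by rw [V'_tmul, star_star]
  rw [h2, V_mul, L_V', sliceRight_rTensor, H.V', mulLeft_apply, mul_smul_comm, map_smul,
    smul_eq_mul] at h1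
  exact nonneg_of_mul_nonneg_of_pos hz (mul_comm (h _) _ ▸ h1)

end Coact

namespace StarAlgebraicQuantumGroup

open Coact

variable (Q : StarAlgebraicQuantumGroup A)

/-- Right multiplication by the modular element `δ` with `(φ ⊗ ι)Δ(a) = φ(a)δ`. -/
def δr : A →ₗ[ℂ] A :=
  sliceLeft Q.haar ∘ₗ Q.self.T₂ ∘ₗ TensorProduct.mk ℂ A A Q.exists_haar_eq_one.choose

/-- Left multiplication by the modular element. -/
def δl : A →ₗ[ℂ] A :=
  sliceLeft Q.haar ∘ₗ Q.self.T₁ ∘ₗ TensorProduct.mk ℂ A A Q.exists_haar_eq_one.choose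

theorem mul_δl (a b : A) : a * Q.δl b = Q.δr a * b := by
  change mulLeft ℂ a (sliceLeft Q.haar _) = mulRight ℂ b (sliceLeft Q.haar _)
  rw [← sliceLeft_lTensor, ← sliceLeft_lTensor]
  exact congrArg _ (Q.self.lmul_T₁_eq _ b a)

theorem δr_mul (a b : A) : Q.δr (a * b) = a * Q.δr b := by
  apply Q.nondegenerate.eq_of_mul_right
  intro c
  rw [← mul_δl, mul_assoc, mul_assoc, ← mul_δl]

theorem δl_mul (a b : A) : Q.δl (a * b) = Q.δl a * b := by
  apply Q.nondegenerate.eq_of_mul_left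
  intro c
  rw [mul_δl, ← mul_assoc, ← mul_assoc, mul_δl]

end StarAlgebraicQuantumGroup

namespace Coact

variable {Q : StarAlgebraicQuantumGroup A} {P : Coact Q X} {h ψ : X →ₗ[ℂ] ℂ}

/-- On A the functional φ(f ▹ ·) is again left invariant, so it is a multiple of φ, and evaluation
at an element of integral 1 identifies the factor. By colinearity the same factor appears on X. -/
theorem LeftInv.apply_actL [Nontrivial X] (H : P.LeftInv h) (ρ : A →ₗ[ℂ] ℂ) (a : A) (x : X) :
    h (P.actL ρ a x) = ρ (Q.δr a) * h x := by
  obtain ⟨c, hc⟩ := Q.leftInv_unique (ρ := Q.haar ∘ₗ Q.self.actL ρ a) (by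
    intro z x
    rw [← sliceRight_lTensor, ← V_actL, Q.haar_V]
    rfl)
  have hc2 : c = ρ (Q.δr a) := by
    have := LinearMap.congr_fun hc Q.exists_haar_eq_one.choose
    rw [LinearMap.smul_apply, Q.exists_haar_eq_one.choose_spec, smul_eq_mul, mul_one] at this
    rw [← this, LinearMap.comp_apply, actL_apply, apply_sliceRight]
    rfl
  obtain ⟨z, hz⟩ := exists_ne (0 : X)
  have h1 := H z (P.actL ρ a x)
  rw [V_actL, sliceRight_lTensor, hc, hc2] at h1
  have h2 : sliceRight (ρ (Q.δr a) • Q.haar) (P.V (z ⊗ₜ x)) = (ρ (Q.δr a) * h x) • z := by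
    rw [mul_smul, ← H]
    generalize P.V (z ⊗ₜ x) = t
    induction t with
    | zero => simp
    | add s t hs ht => simp only [map_add, smul_add, hs, ht]
    | tmul u c => simp [smul_smul]
  rw [h2] at h1
  exact (smul_left_injective ℂ hz h1).symm

variable [Nontrivial X]

theorem LeftInv.sliceLeft_T₂ (H : P.LeftInv h) (x : X) (a : A) :
    sliceLeft h (P.T₂ (x ⊗ₜ a)) = h x • Q.δr a := by
  rw [← sub_eq_zero]
  apply eq_zero_of_functional
  intro ρ
  rw [map_sub, ← apply_sliceRight, ← actL_apply, H.apply_actL, map_smul, smul_eq_mul, mul_comm,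
    sub_self]

theorem LeftInv.sliceLeft_T₁ (H : P.LeftInv h) (x : X) (a : A) :
    sliceLeft h (P.T₁ (x ⊗ₜ a)) = h x • Q.δl a := by
  apply Q.nondegenerate.eq_of_mul_left
  intro b
  change mulLeft ℂ b _ = _
  rw [← sliceLeft_lTensor, lmul_T₁_eq, sliceLeft_lTensor, H.sliceLeft_T₂, mulRight_apply,
    mul_smul_comm, smul_mul_assoc, Q.mul_δl]

theorem LeftInv.sliceLeft_V (H : P.LeftInv h) (x y : X) :
    sliceLeft h (P.V (x ⊗ₜ y)) = Q.δr (Q.antipode.symm (sliceLeft h (P.V' (y ⊗ₜ x)))) := by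
  apply Q.nondegenerate.eq_of_mul_left
  intro a
  rw [P.mul_sliceLeft_V H.sliceLeft_T₂, Q.δr_mul]

end Coact

namespace StarAlgebraicQuantumGroup

open Coact

variable (Q : StarAlgebraicQuantumGroup A)

theorem star_δr (a : A) : star (Q.δr (star a)) = Q.δl a := by
  have := Q.nontrivial
  have h1 := congrArg star (Q.leftInv_haar.sliceLeft_T₂ Q.exists_haar_eq_one.choose (star a))
  rw [← star_star (Q.self.T₂ _), ← sliceLeft_conjF, conjF_haar, star_T₂, star_star,
    Q.leftInv_haar.sliceLeft_T₁, star_smul, Q.haar_star, Q.exists_haar_eq_one.choose_spec,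
    star_one, one_smul, one_smul] at h1
  exact h1.symm

theorem star_δl (a : A) : star (Q.δl (star a)) = Q.δr a := by
  rw [← star_δr, star_star, star_star]

theorem δr_surjective : Function.Surjective Q.δr := by
  have := Q.nontrivial
  intro a
  obtain ⟨t, ht⟩ : ∃ t, sliceLeft Q.haar (Q.self.V t) = a := by
    obtain ⟨q, hq⟩ := Q.exists_haar_eq_one
    exact ⟨Q.self.V.symm (q ⊗ₜ a), by simp [hq]⟩
  rw [← ht, ← LinearMap.mem_range]
  clear ht
  induction t with
  | zero => simp
  | add s t hs ht => rw [map_add, map_add]; exact Submodule.add_mem _ hs ht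
  | tmul x y => exact ⟨_, (Q.leftInv_haar.sliceLeft_V x y).symm⟩

theorem δl_surjective : Function.Surjective Q.δl := by
  intro a
  obtain ⟨b, hb⟩ := Q.δr_surjective (star a)
  exact ⟨star b, by rw [← star_δr, star_star, hb, star_star]⟩

theorem δr_injective : Function.Injective Q.δr := by
  rw [← LinearMap.ker_eq_bot, LinearMap.ker_eq_bot']
  intro a ha
  apply Q.nondegenerate.1
  intro b
  obtain ⟨c, rfl⟩ := Q.δl_surjective b
  rw [mul_δl, ha, zero_mul]

theorem δl_injective : Function.Injective Q.δl := by
  intro a b hab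
  rw [← star_δr, ← star_δr] at hab
  exact star_injective (Q.δr_injective (star_injective hab))

/-- The modular element of A is positive: φ ⊗ φ on the square of Δ(x)(1 ⊗ b) equals φ(x⋆x)φ(b⋆δb).
-/
theorem haar_star_mul_δl_nonneg (b : A) : 0 ≤ Q.haar (star b * Q.δl b) := by
  have := Q.nontrivial
  obtain ⟨x, hx⟩ := Q.self.exists_pos_of_positive Q.haar_positive Q.haar_ne_zero
  have h1 := Q.haar_positive.tensor Q.haar_positive (Q.self.T₁ (x ⊗ₜ b))
  rw [star_T₁, T₂_mul, L_T₁, sliceRight_lTensor, apply_sliceRight, Q.leftInv_haar.sliceLeft_T₁,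
    map_smul, smul_eq_mul] at h1
  exact nonneg_of_mul_nonneg_of_pos hx h1

end StarAlgebraicQuantumGroup

end StarGalois
end

/-! ### The modular element and the modular automorphisms of X -/

noncomputable section
namespace StarGalois
open Multiplier LinearMap

variable {A : Type*} [NonUnitalRing A] [Module ℂ A] [IsScalarTower ℂ A A] [SMulCommClass ℂ A A]
  [StarRing A] [StarModule ℂ A]
  {X : Type*} [NonUnitalRing X] [Module ℂ X] [IsScalarTower ℂ X X] [SMulCommClass ℂ X X]
  [StarRing X] [StarModule ℂ X]

namespace Coact

/-- A left and a right invariant functional, with the modular automorphism `σ` of the first, and the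
modular element, whose left and right multiplication are `l` and `r`. -/
structure Modular {Q : StarAlgebraicQuantumGroup A} (P : Coact Q X) where
  h : X →ₗ[ℂ] ℂ
  ψ : X →ₗ[ℂ] ℂ
  leftInv : P.LeftInv h
  pos : IsPositive h
  rightInv : P.RightInv ψ
  ψ_ne_zero : ψ ≠ 0
  l : X ≃ₗ[ℂ] X
  r : X ≃ₗ[ℂ] X
  σ : X ≃ₗ[ℂ] X
  mul_l : ∀ x y, x * l y = r x * y
  h_r : ∀ x, h (r x) = ψ x
  h_mul_σ : ∀ x y, h (y * σ x) = h (x * y)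

variable {Q : StarAlgebraicQuantumGroup A} {P : Coact Q X} [Nontrivial X]

theorem LeftInv.exists_modularData {h ψ : X →ₗ[ℂ] ℂ} (H : P.LeftInv h) (hpos : IsPositive h)
    (hψ : P.RightInv ψ) (hψ0 : ψ ≠ 0) : ∃ D : P.Modular, D.h = h ∧ D.ψ = ψ := by
  obtain ⟨r, hr⟩ := H.exists_right_modular hψ hψ0
  obtain ⟨p, hp⟩ := H.exists_left_modular hψ hψ0
  obtain ⟨σ, hσ⟩ := H.exists_modular hpos
  have hσ' : ∀ x y, h (y * x) = h (σ.symm x * y) := fun x y => by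
    rw [← hσ (σ.symm x) y, LinearEquiv.apply_symm_apply]
  have := Q.nontrivial
  have hr_mul : ∀ z y, r (z * y) = z * r y := by
    intro z y
    apply H.ext_left
    intro x
    rw [hr, ← mul_assoc, ← mul_assoc, hr]
  -- Left multiplication by δ_X is the conjugate of `p` by σ: moving the left factor around with σ
  -- gives h(zx σ(p(σ⁻¹y))) = h(p(σ⁻¹y)zx) = ψ(σ⁻¹(y)zx) = h(z r(x)y).
  refine ⟨⟨h, ψ, H, hpos, hψ, hψ0, σ.symm ≪≫ₗ p ≪≫ₗ σ, r, σ, ?_, ?_, hσ⟩, rfl, rfl⟩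
  · intro x y
    apply H.ext_left
    intro z
    simp only [LinearEquiv.trans_apply]
    rw [← mul_assoc, hσ, hp, ← mul_assoc z (r x) y, hσ' y, ← mul_assoc _ z (r x), hr, mul_assoc]
  · intro x
    have : h ∘ₗ r.toLinearMap - ψ = 0 := by
      apply P.eq_zero_of_mul_eq_zero
      intro x y
      simp [hr_mul, hr]
    exact LinearMap.congr_fun (sub_eq_zero.mp this) x

namespace Modular

variable (D : P.Modular)

theorem r_mul (x y : X) : D.r (x * y) = x * D.r y := by
  apply P.nondegenerate.eq_of_mul_right
  intro c
  rw [← mul_l, mul_assoc, mul_assoc, ← mul_l]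

theorem l_mul (x y : X) : D.l (x * y) = D.l x * y := by
  apply P.nondegenerate.eq_of_mul_left
  intro c
  rw [mul_l, ← mul_assoc, ← mul_assoc, mul_l]

theorem l_r (x : X) : D.l (D.r x) = D.r (D.l x) := by
  apply P.nondegenerate.eq_of_mul_right
  intro c
  rw [← D.l_mul, ← D.mul_l, D.l_mul, D.mul_l]

theorem h_mul_r (x y : X) : D.h (x * D.r y) = D.ψ (x * y) := by rw [← r_mul, h_r]

theorem h_star (x : X) : D.h (star x) = star (D.h x) := P.star_apply_of_positive D.pos x

theorem σ_mul (x y : X) : D.σ (x * y) = D.σ x * D.σ y := by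
  apply D.leftInv.ext_left
  intro z
  rw [h_mul_σ, mul_assoc, ← D.h_mul_σ x, mul_assoc y, ← D.h_mul_σ y, mul_assoc]

theorem star_σ (x : X) : star (D.σ (star x)) = D.σ.symm x := by
  apply D.leftInv.ext_right
  intro y
  have h1 := D.h_mul_σ (D.σ.symm x) y
  have h2 := congrArg star (D.h_mul_σ (star x) (star y))
  rw [← D.h_star, ← D.h_star] at h2
  simp only [star_mul, star_star] at h2
  rw [LinearEquiv.apply_symm_apply] at h1
  rw [← h1, h2]

/-- `α(xδ) = α(x)(δ ⊗ δ)`. -/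
theorem V_r (z w : X) : P.V (z ⊗ₜ D.r w) =
    rTensor A D.r.toLinearMap (lTensor X Q.δr (P.V (z ⊗ₜ w))) := by
  apply eq_of_sliceLeft (f := fun u => D.h ∘ₗ mulLeft ℂ u)
    (fun v hv => D.leftInv.left_faithful hv)
  intro u
  -- Strong invariance expresses the left slices through `V'` for both h and ψ. There h(· δ_X) = ψ,
  -- and the only remaining discrepancy is `Q.δr`.
  have key : ∀ z, sliceLeft D.h (P.V (z ⊗ₜ D.r w)) =
      Q.δr (sliceLeft D.ψ (P.V (z ⊗ₜ w))) := by
    intro z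
    have h1 : sliceLeft D.h (P.V' (D.r w ⊗ₜ z)) = sliceLeft D.ψ (P.V' (w ⊗ₜ z)) := by
      have h2 : ∀ b, sliceLeft D.h (rTensor A (mulRight ℂ (D.r w)) (P.T₁ (z ⊗ₜ b))) =
          sliceLeft D.ψ (rTensor A (mulRight ℂ w) (P.T₁ (z ⊗ₜ b))) := by
        intro b
        rw [sliceLeft_rTensor, sliceLeft_rTensor,
          show D.h ∘ₗ mulRight ℂ (D.r w) = D.ψ ∘ₗ mulRight ℂ w from
            LinearMap.ext fun x => D.h_mul_r x w]
      apply Q.nondegenerate.eq_of_mul_right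
      intro b
      have h3 := h2 b
      rwa [T₁_rmul, T₁_rmul, sliceLeft_lTensor, sliceLeft_lTensor] at h3
    rw [D.leftInv.sliceLeft_V, D.rightInv.sliceLeft_V, h1]
  rw [← sliceLeft_rTensor, ← sliceLeft_rTensor, ← V_mul_left, key, V_mul_left, sliceLeft_rTensor,
    sliceLeft_rTensor, sliceLeft_rTensor, sliceLeft_lTensor]
  congr 3
  ext x
  simp [h_mul_r]

/-- Follows from `V_r` by moving δ_X across a product, x(δ_X w) = (xδ_X)w, since `V` is surjective.
-/
theorem V_l (u w : X) : P.V (u ⊗ₜ D.l w) = lTensor X Q.δl (P.V (D.r u ⊗ₜ w)) := by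
  have key : ∀ t : X ⊗[ℂ] A, P.R (D.l w) t =
      P.R w (rTensor A D.r.toLinearMap (lTensor X Q.δr t)) := by
    intro t
    obtain ⟨s, rfl⟩ := P.V.surjective t
    induction s with
    | zero => simp
    | add s t hs ht => simp only [map_add, hs, ht]
    | tmul z y => rw [R_V, ← V_r, R_V, mul_l]
  apply eq_of_lTensor Q.nondegenerate.mulLeft_sep
  intro c
  have := key (u ⊗ₜ c)
  rw [R_tmul] at this
  rw [this]
  simp only [lTensor_tmul, rTensor_tmul, LinearEquiv.coe_coe]
  rw [R_tmul, ← LinearMap.comp_apply, ← lTensor_comp]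
  congr 2
  ext b
  simp [Q.mul_δl]

theorem V'_l (u v : X) : P.V' (u ⊗ₜ D.l v) =
    rTensor A D.l.toLinearMap (lTensor X Q.δl (P.V' (u ⊗ₜ v))) := by
  apply eq_of_rTensor P.nondegenerate.mulLeft_sep
  intro w
  rw [lmul_V', V_l, ← lTensor_rTensor_comm, ← lmul_V', ← lTensor_rTensor_comm,
    ← lTensor_rTensor_comm, ← LinearMap.comp_apply (rTensor A _), ← rTensor_comp]
  congr 3
  ext x
  simp [D.mul_l]

theorem T₁_l (x : X) (a : A) : P.T₁ (D.l x ⊗ₜ a) =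
    rTensor A D.l.toLinearMap (lTensor X Q.δl (P.T₁ (x ⊗ₜ a))) := by
  apply eq_of_rTensor P.nondegenerate.mulLeft_sep
  intro w
  rw [lmul_T₁, V_l, ← lTensor_rTensor_comm, ← lTensor_rTensor_comm,
    ← LinearMap.comp_apply (rTensor A _), ← rTensor_comp]
  have : mulLeft ℂ w ∘ₗ D.l.toLinearMap = mulLeft ℂ (D.r w) := by
    ext x
    simp [D.mul_l]
  rw [this, lmul_T₁, ← LinearMap.comp_apply, ← lTensor_comp, ← LinearMap.comp_apply,
    ← lTensor_comp]
  congr 2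
  ext b
  simp [Q.δl_mul]

/-- In α(δ_X x) = (δ_X ⊗ δ)α(x) the slice by h contributes another factor δ, which cancels. -/
theorem rightInv_h_l : P.RightInv (D.h ∘ₗ D.l.toLinearMap) := by
  intro x a
  apply Q.δl_injective
  rw [← sliceLeft_rTensor, ← sliceLeft_lTensor, lTensor_rTensor_comm, ← T₁_l,
    D.leftInv.sliceLeft_T₁, map_smul]
  rfl

theorem exists_h_l : ∃ ν : ℂ, ν ≠ 0 ∧ ∀ x, D.h (D.l x) = ν * D.h (D.r x) := by
  obtain ⟨ν, hν⟩ := D.leftInv.rightInv_unique D.rightInv D.ψ_ne_zero D.rightInv_h_l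
  refine ⟨ν, ?_, fun x => ?_⟩
  · rintro rfl
    obtain ⟨x, y, hxy⟩ := D.leftInv.exists_mul_eq_one
    have := LinearMap.congr_fun hν (D.l.symm (x * y))
    simp [hxy] at this
  · rw [h_r]
    exact LinearMap.congr_fun hν x

/-- δ_X⋆ is a multiple of δ_X: the conjugate of ψ is invariant, hence a multiple of ψ, and
`exists_h_l` compares h(xδ_X) with h(δ_X x). -/
theorem exists_star_r : ∃ c : ℂ, c ≠ 0 ∧ ∀ x, star (D.r (star x)) = c • D.l x := by
  obtain ⟨ν, hν0, hν⟩ := D.exists_h_l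
  obtain ⟨c, hc⟩ := D.leftInv.rightInv_unique D.rightInv D.ψ_ne_zero D.rightInv.conj
  have h1 : ∀ x, D.h (star (D.r (star x))) = (c / ν) * D.h (D.l x) := by
    intro x
    have := LinearMap.congr_fun hc x
    rw [hν, h_star, h_r, h_r]
    simp only [conjF, LinearMap.coe_mk, AddHom.coe_mk, LinearMap.smul_apply, smul_eq_mul] at this
    rw [this]
    field_simp
  have h2 : ∀ x, star (D.r (star x)) = (c / ν) • D.l x := by
    intro x
    apply D.leftInv.ext_right
    intro y
    have := h1 (x * y)
    rw [star_mul, r_mul, star_mul, star_star, l_mul] at this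
    rw [this, smul_mul_assoc, map_smul, smul_eq_mul]
  refine ⟨c / ν, ?_, h2⟩
  intro h0
  obtain ⟨u, hu⟩ := exists_ne (0 : X)
  have h3 := h2 (star u)
  rw [h0, zero_smul, star_star, star_eq_zero] at h3
  exact hu (D.r.injective (by rw [h3, map_zero]))

variable {D}

theorem σ_l {ν : ℂ} (hν : ∀ x, D.h (D.l x) = ν * D.h (D.r x)) (x : X) :
    D.σ (D.l x) = ν • D.l (D.σ x) := by
  apply D.leftInv.ext_left
  intro y
  rw [h_mul_σ, ← l_mul, hν, mul_smul_comm, map_smul, smul_eq_mul, D.mul_l, h_mul_σ, r_mul]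

theorem σ_r {ν : ℂ} (hν : ∀ x, D.h (D.l x) = ν * D.h (D.r x)) (x : X) :
    D.σ (D.r x) = ν • D.r (D.σ x) := by
  apply D.leftInv.ext_left
  intro y
  rw [h_mul_σ, ← D.mul_l, ← h_mul_σ, ← l_mul, hν, r_mul, mul_smul_comm, map_smul, smul_eq_mul]

variable (D)

/-- The modular automorphism of `ψ`. -/
def σψ : X ≃ₗ[ℂ] X := D.σ ≪≫ₗ D.l ≪≫ₗ D.r.symm

theorem r_σψ (x : X) : D.r (D.σψ x) = D.l (D.σ x) := by simp [σψ]

theorem ψ_mul_σψ (x y : X) : D.ψ (y * D.σψ x) = D.ψ (x * y) := by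
  rw [← h_mul_r, r_σψ, ← h_mul_r, D.mul_l, h_mul_σ]

theorem ψ_ext_left {y y' : X} (hy : ∀ x, D.ψ (x * y) = D.ψ (x * y')) : y = y' := by
  apply D.r.injective
  apply D.leftInv.ext_left
  intro x
  rw [h_mul_r, h_mul_r, hy]

theorem _root_.StarGalois.Coact.LeftInv.act {h : X →ₗ[ℂ] ℂ} (H : P.LeftInv h) {f : A →ₗ[ℂ] ℂ}
    {K K' : X →ₗ[ℂ] X} (hK : P.Acts f K)
    (hK' : P.Acts (f ∘ₗ Q.δr ∘ₗ Q.antipode.symm.toLinearMap) K') (x y : X) :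
    h (x * K y) = h (K' x * y) := by
  rw [hK.apply_mul_left, hK'.apply_mul_right, H.sliceLeft_V]
  rfl

/-- Move f across the product with strong invariance, rotate with σψ, and do so again; each passage
costs S⁻¹. The proof of `act_σ` is the same, with δr ∘ S⁻¹ in place of S⁻¹. -/
theorem act_σψ {f : A →ₗ[ℂ] ℂ} (hf : Adm f) (x : X) :
    P.act f (D.σψ x) = D.σψ (P.act (f ∘ₗ Q.antipode.symm.toLinearMap ∘ₗ
      Q.antipode.symm.toLinearMap) x) := by
  have h1 := hf.comp_antipode_symm (Q := Q)
  have h2 := h1.comp_antipode_symm (Q := Q)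
  apply D.ψ_ext_left
  intro y
  rw [D.rightInv.act (P.acts_act hf) (P.acts_act h1), ψ_mul_σψ,
    D.rightInv.act (P.acts_act h1) (P.acts_act h2), ψ_mul_σψ]
  rfl

theorem _root_.StarGalois.Coact.Adm.comp_δr {f : A →ₗ[ℂ] ℂ} (hf : Adm f) :
    Adm (f ∘ₗ Q.δr) := by
  obtain ⟨ρ, b, rfl⟩ | ⟨ρ, b, rfl⟩ := hf
  · refine Or.inl ⟨ρ, Q.δl b, ?_⟩
    ext; simp [Q.mul_δl]
  · refine Or.inr ⟨ρ ∘ₗ Q.δr, b, ?_⟩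
    ext; simp [Q.δr_mul]

/-- The map `(δr ∘ S⁻¹)²`. -/
def _root_.StarGalois.StarAlgebraicQuantumGroup.γ (Q : StarAlgebraicQuantumGroup A) : A →ₗ[ℂ] A :=
  (Q.δr ∘ₗ Q.antipode.symm.toLinearMap) ∘ₗ Q.δr ∘ₗ Q.antipode.symm.toLinearMap

theorem act_σ {f : A →ₗ[ℂ] ℂ} (hf : Adm f) (x : X) :
    P.act f (D.σ x) = D.σ (P.act (f ∘ₗ Q.γ) x) := by
  have h1 : Adm (f ∘ₗ Q.δr ∘ₗ Q.antipode.symm.toLinearMap) :=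
    (hf.comp_δr (Q := Q)).comp_antipode_symm (Q := Q)
  have h2 : Adm ((f ∘ₗ Q.δr ∘ₗ Q.antipode.symm.toLinearMap) ∘ₗ Q.δr ∘ₗ
    Q.antipode.symm.toLinearMap) := (h1.comp_δr (Q := Q)).comp_antipode_symm (Q := Q)
  apply D.leftInv.ext_left
  intro y
  rw [D.leftInv.act (P.acts_act hf) (P.acts_act h1), h_mul_σ,
    D.leftInv.act (P.acts_act h1) (P.acts_act h2), h_mul_σ]
  rfl

theorem _root_.StarGalois.Coact.Adm.comp_γ {f : A →ₗ[ℂ] ℂ} (hf : Adm f) : Adm (f ∘ₗ Q.γ) :=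
  ((((hf.comp_δr (Q := Q)).comp_antipode_symm (Q := Q)).comp_δr (Q := Q)).comp_antipode_symm
    (Q := Q))

end Modular
end Coact
end StarGalois
end

/-! ### The modular element of the dual and its action on X -/

noncomputable section
namespace StarGalois
open Multiplier LinearMap

variable {A : Type*} [NonUnitalRing A] [Module ℂ A] [IsScalarTower ℂ A A] [SMulCommClass ℂ A A]
  [StarRing A] [StarModule ℂ A]
  {X : Type*} [NonUnitalRing X] [Module ℂ X] [IsScalarTower ℂ X X] [SMulCommClass ℂ X X]
  [StarRing X] [StarModule ℂ X]

namespace StarAlgebraicQuantumGroup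

open Coact

variable (Q : StarAlgebraicQuantumGroup A)

theorem exists_modularData :
    ∃ D : Q.self.Modular, D.h = Q.haar ∧ D.ψ = Q.rightHaar ∧ D.σ = Q.σ := by
  have := Q.nontrivial
  obtain ⟨D, h1, h2⟩ := Q.leftInv_haar.exists_modularData Q.haar_positive Q.rightInv_rightHaar
    Q.rightHaar_ne_zero
  refine ⟨D, h1, h2, ?_⟩
  ext x
  apply Q.leftInv_haar.ext_left
  intro y
  have := D.h_mul_σ x y
  rw [h1] at this
  rw [this, haar_mul_σ]

/-- The modular data of the quantum group itself. -/
def modular : Q.self.Modular := Q.exists_modularData.choose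

theorem modular_ψ : Q.modular.ψ = Q.rightHaar := Q.exists_modularData.choose_spec.2.1

theorem modular_σ : Q.modular.σ = Q.σ := Q.exists_modularData.choose_spec.2.2

theorem σ_mul (x y : A) : Q.σ (x * y) = Q.σ x * Q.σ y := by
  have := Q.nontrivial
  rw [← modular_σ]
  exact Q.modular.σ_mul x y

theorem star_σ (x : A) : star (Q.σ (star x)) = Q.σ.symm x := by
  have := Q.nontrivial
  rw [← modular_σ]
  exact Q.modular.star_σ x

theorem σ_symm_mul (x y : A) : Q.σ.symm (x * y) = Q.σ.symm x * Q.σ.symm y := by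
  apply Q.σ.injective
  simp [σ_mul]

/-- The square of the antipode. -/
def S2 : A ≃ₗ[ℂ] A := Q.antipode ≪≫ₗ Q.antipode

theorem S2_apply (x : A) : Q.S2 x = Q.antipode (Q.antipode x) := rfl

theorem S2_mul (x y : A) : Q.S2 (x * y) = Q.S2 x * Q.S2 y := by
  simp [S2_apply, antipode_mul]

theorem actL_σ (a y : A) : Q.self.actL Q.haar a (Q.σ y) = Q.S2 (Q.self.actR Q.haar a y) := by
  rw [S2_apply, antipode_actR, actL_haar Q.self y, antipode_actR]

/-- Δ(σ(y)) = (S² ⊗ σ)Δ(y), tested on the separating functionals φ(a ·), where it is `actL_σ`. -/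
theorem V_S2_σ (z y : A) : Q.self.V (Q.S2 z ⊗ₜ Q.σ y) =
    rTensor A Q.S2.toLinearMap (lTensor A Q.σ.toLinearMap (Q.self.V (z ⊗ₜ y))) := by
  apply eq_of_sliceRight (f := fun c => Q.haar ∘ₗ mulLeft ℂ c)
    (fun v hv => Q.eq_zero_of_haar_mul_left hv)
  intro a
  rw [← Q.self.acts_actL, actL_σ, ← S2_mul, Q.self.acts_actR, sliceRight_rTensor,
    sliceRight_lTensor, show (Q.haar ∘ₗ mulLeft ℂ a) ∘ₗ Q.σ.toLinearMap = Q.haar ∘ₗ mulRight ℂ a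
      from LinearMap.ext fun x => Q.haar_mul_σ x a]
  rfl

theorem exists_counit_eq_one : ∃ b, Q.counit b = 1 := by
  apply exists_eq_one_of_ne_zero
  intro h0
  have := Q.nontrivial
  obtain ⟨q, hq⟩ := exists_ne (0 : A)
  have h1 := Q.counit_V
  simp only [h0] at h1
  exact hq (Q.nondegenerate.1 q fun y => by rw [← h1]; simp [sliceRight])

/-- The modular element of the dual, as a functional: `ε ∘ σ⁻¹`. -/
def dualMod : A →ₗ[ℂ] ℂ := Q.counit ∘ₗ Q.σ.symm.toLinearMap

theorem dualMod_apply (a : A) : Q.dualMod a = Q.counit (Q.σ.symm a) := rfl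

theorem dualMod_mul (a b : A) : Q.dualMod (a * b) = Q.dualMod a * Q.dualMod b := by
  simp [dualMod_apply, σ_symm_mul, counit_mul]

theorem exists_dualMod_eq_one : ∃ b, Q.dualMod b = 1 := by
  obtain ⟨b, hb⟩ := Q.exists_counit_eq_one
  exact ⟨Q.σ b, by simp [dualMod_apply, hb]⟩

theorem adm_of_mul {d : A →ₗ[ℂ] ℂ} (hd : ∀ a b, d (a * b) = d a * d b) {b : A} (hb : d b = 1) :
    d = d ∘ₗ mulLeft ℂ b := by
  ext a
  simp [hd, hb]

theorem adm_dualMod : Adm Q.dualMod := by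
  obtain ⟨b, hb⟩ := Q.exists_dualMod_eq_one
  exact Or.inr ⟨Q.dualMod, b, adm_of_mul Q.dualMod_mul hb⟩

/-- The action of the modular element of the dual on the quantum group. -/
def κ : A →ₗ[ℂ] A := Q.S2.toLinearMap ∘ₗ Q.σ.symm.toLinearMap

theorem κ_apply (a : A) : Q.κ a = Q.S2 (Q.σ.symm a) := rfl

theorem acts_κ : Q.self.Acts Q.dualMod Q.κ := by
  intro z y
  obtain ⟨z, rfl⟩ := Q.S2.surjective z
  obtain ⟨y, rfl⟩ := Q.σ.surjective y
  rw [V_S2_σ, sliceRight_rTensor, sliceRight_lTensor,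
    show Q.dualMod ∘ₗ Q.σ.toLinearMap = Q.counit by ext; simp [dualMod_apply], counit_V, κ_apply]
  simp [S2_mul]

/-- The map S²σ⁻¹ is the action of a functional, hence colinear; comparing with `V_S2_σ` gives Δ ∘
S² = (S² ⊗ S²) ∘ Δ. -/
theorem V_S2 (z y : A) : Q.self.V (Q.S2 z ⊗ₜ Q.S2 y) =
    rTensor A Q.S2.toLinearMap (lTensor A Q.S2.toLinearMap (Q.self.V (z ⊗ₜ y))) := by
  have h1 := Q.self.V_act Q.adm_dualMod (Q.S2 z) (Q.σ y)
  rw [Q.acts_κ.act_eq, κ_apply, LinearEquiv.symm_apply_apply, V_S2_σ, lTensor_rTensor_comm,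
    ← LinearMap.comp_apply (lTensor A _), ← lTensor_comp] at h1
  rw [h1]
  congr 3
  ext a
  simp [κ_apply]

theorem exists_haar_S2 : ∃ τ : ℂ, ∀ a, Q.haar (Q.S2 a) = τ * Q.haar a := by
  obtain ⟨τ, hτ⟩ := Q.leftInv_unique (ρ := Q.haar ∘ₗ Q.S2.toLinearMap) (by
    intro z x
    apply Q.S2.injective
    rw [← sliceRight_lTensor]
    change Q.S2.toLinearMap (sliceRight _ _) = _
    rw [← sliceRight_rTensor, ← V_S2, haar_V, map_smul]
    rfl)
  exact ⟨τ, fun a => LinearMap.congr_fun hτ a⟩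

theorem σ_S2 (a : A) : Q.σ (Q.S2 a) = Q.S2 (Q.σ a) := by
  have := Q.nontrivial
  obtain ⟨τ, hτ⟩ := Q.exists_haar_S2
  apply Q.leftInv_haar.ext_left
  intro y
  obtain ⟨y, rfl⟩ := Q.S2.surjective y
  rw [haar_mul_σ, ← S2_mul, ← S2_mul, hτ, hτ, haar_mul_σ]

theorem counit_antipode (a : A) : Q.counit (Q.antipode a) = Q.counit a := by
  obtain ⟨b, hb⟩ := Q.exists_counit_eq_one
  have h1 := congrArg Q.counit (Q.isAntipode_antipode.2.1 a b)
  have h2 : ∀ t : A ⊗[ℂ] A, Q.counit (mul' ℂ A (rTensor A Q.antipode.toLinearMap t)) =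
      Q.counit (Q.antipode (sliceRight Q.counit t)) := by
    intro t
    induction t with
    | zero => simp
    | add s t hs ht => simp only [map_add, hs, ht]
    | tmul p q => simp [counit_mul, mul_comm]
  have h3 : sliceRight Q.counit (Q.TΔ2 (a ⊗ₜ b)) = a := by
    change Q.self.actR Q.counit b a = a
    apply Q.nondegenerate.eq_of_mul_left
    intro z
    rw [Q.self.acts_actR, show Q.counit ∘ₗ mulRight ℂ b = Q.counit by ext; simp [counit_mul, hb],
      counit_V]
  rw [h2, h3, map_smul, hb] at h1
  simpa using h1

theorem counit_S2 (a : A) : Q.counit (Q.S2 a) = Q.counit a := by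
  rw [S2_apply, counit_antipode, counit_antipode]

theorem conjF_dualMod (a : A) : conjF Q.dualMod a = Q.counit (Q.σ a) := by
  simp only [conjF, LinearMap.coe_mk, AddHom.coe_mk, dualMod_apply]
  rw [← star_σ, star_star, counit_star, star_star]

/-- In the dual, `dualMod` is invertible with inverse its conjugate. The proof rests on σ commuting
with S² and on ε ∘ S² = ε. -/
theorem conjF_dualMod_comp_κ : conjF Q.dualMod ∘ₗ Q.κ = Q.counit := by
  ext a
  rw [LinearMap.comp_apply, conjF_dualMod, κ_apply, σ_S2, counit_S2,
    LinearEquiv.apply_symm_apply]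

theorem dualMod_act {f : A →ₗ[ℂ] ℂ} (hf : Adm f) (b : A) :
    Q.dualMod (Q.self.act f b) = f (Q.γ (Q.σ.symm b)) := by
  have := Q.nontrivial
  have h1 := Q.modular.act_σ hf (Q.σ.symm b)
  rw [modular_σ, LinearEquiv.apply_symm_apply] at h1
  have hγ : Adm (f ∘ₗ Q.γ) := hf.comp_γ
  have h2 : ∀ {g : A →ₗ[ℂ] ℂ}, Adm g → ∀ a, Q.counit (Q.self.act g a) = g a := by
    intro g hg a
    obtain ⟨z, hz⟩ := Q.exists_counit_eq_one
    have h3 := congrArg Q.counit (Q.self.acts_act hg z a)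
    rw [counit_mul, hz, one_mul, apply_sliceRight] at h3
    rw [h3]
    congr 1
    apply Q.nondegenerate.eq_of_mul_right
    intro c
    change mulRight ℂ c _ = _
    rw [← sliceLeft_lTensor, ← lmul_T₁, sliceLeft_rTensor, ← adm_of_mul Q.counit_mul hz, counit_T₁]
  rw [h1, dualMod_apply, LinearEquiv.symm_apply_apply, h2 hγ]
  rfl

/-- A character extends to multipliers; `c` is its value on the multiplier (l, r). -/
theorem exists_dualMod_modular {l r : A →ₗ[ℂ] A} (hlr : ∀ a b, a * l b = r a * b) :
    ∃ c, (∀ a, Q.dualMod (l a) = c * Q.dualMod a) ∧ (∀ a, Q.dualMod (r a) = c * Q.dualMod a) := by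
  obtain ⟨b, hb⟩ := Q.exists_dualMod_eq_one
  have h1 : ∀ x y, Q.dualMod x * Q.dualMod (l y) = Q.dualMod (r x) * Q.dualMod y := by
    intro x y
    rw [← dualMod_mul, hlr, dualMod_mul]
  have h2 := h1 b b
  rw [hb, one_mul, mul_one] at h2
  refine ⟨Q.dualMod (l b), fun a => ?_, fun a => ?_⟩
  · rw [h2, ← h1, hb, one_mul]
  · have := h1 a b
    rw [hb, mul_one] at this
    rw [← this, mul_comm]

theorem dualMod_σψ (a : A) : Q.dualMod (Q.modular.σψ a) = Q.counit a := by
  have := Q.nontrivial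
  obtain ⟨c, hl, hr⟩ := Q.exists_dualMod_modular (l := Q.modular.l.toLinearMap)
    (r := Q.modular.r.toLinearMap) Q.modular.mul_l
  have hc : c ≠ 0 := by
    rintro rfl
    obtain ⟨b, hb⟩ := Q.exists_dualMod_eq_one
    have := hr (Q.modular.r.symm b)
    simp [hb] at this
  have h1 := hr (Q.modular.σψ a)
  rw [LinearEquiv.coe_coe, Q.modular.r_σψ] at h1
  have h2 := hl (Q.modular.σ a)
  rw [LinearEquiv.coe_coe, h1] at h2
  rw [mul_left_cancel₀ hc h2, modular_σ, dualMod_apply, LinearEquiv.symm_apply_apply]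

theorem rightHaar_mul_σψ (x y : A) :
    Q.rightHaar (y * Q.modular.σψ x) = Q.rightHaar (x * y) := by
  have := Q.nontrivial
  rw [← modular_ψ]
  exact Q.modular.ψ_mul_σψ x y

theorem rightHaar_mem_dual (a : A) : (LinearMap.mul ℂ A).compr₂ Q.rightHaar a ∈ Q.dual := by
  obtain ⟨v, hv⟩ := Q.exists_rightHaar_mul_eq a
  exact ⟨v, LinearMap.ext fun y => (hv y).symm⟩

theorem exists_rightHaar_of_mem_dual (ω : Q.dual) : ∃ a, ∀ x, ω.1 x = Q.rightHaar (a * x) := by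
  have := Q.nontrivial
  obtain ⟨p, hp⟩ := Q.leftInv_haar.exists_left_modular Q.rightInv_rightHaar Q.rightHaar_ne_zero
  obtain ⟨_, b, rfl⟩ := ω
  refine ⟨p.symm (Q.σ.symm b), fun x => ?_⟩
  rw [← hp, LinearEquiv.apply_symm_apply, ← haar_mul_σ, LinearEquiv.apply_symm_apply]
  rfl

theorem exists_dualIntegral : ∃ Φ, Q.IsDualIntegral Q.counit Q.antipode Φ := by
  have := Q.nontrivial
  have hinj : Function.Injective ((LinearMap.mul ℂ A).compr₂ Q.rightHaar) :=
    injective_of_right fun y hy =>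
      Q.leftInv_haar.rightInv_right_faithful Q.rightInv_rightHaar Q.rightHaar_ne_zero hy
  let β : A →ₗ[ℂ] Q.dual := LinearMap.codRestrict Q.dual ((LinearMap.mul ℂ A).compr₂ Q.rightHaar)
    Q.rightHaar_mem_dual
  have hβ : Function.Bijective β := by
    refine ⟨fun a b hab => hinj (congrArg Subtype.val hab), fun ω => ?_⟩
    obtain ⟨a, ha⟩ := Q.exists_rightHaar_of_mem_dual ω
    exact ⟨a, Subtype.ext (LinearMap.ext fun x => (ha x).symm)⟩
  refine ⟨Q.counit ∘ₗ (LinearEquiv.ofBijective β hβ).symm.toLinearMap, fun a ω hω => ?_⟩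
  have h1 : ω = LinearEquiv.ofBijective β hβ a := Subtype.ext (LinearMap.ext hω)
  rw [h1]
  simp

/-- For ω = ψ(a ·), the functional ω(· y) is ψ(σψ⁻¹(y)a ·). The dual integral therefore gives
ε(σψ⁻¹(y))ε(a), and `dualMod_σψ` identifies the first factor. -/
theorem IsDualIntegral.isDualModularElement {Q : StarAlgebraicQuantumGroup A}
    {Φ : Q.dual →ₗ[ℂ] ℂ} (hΦ : Q.IsDualIntegral Q.counit Q.antipode Φ) :
    Q.IsDualModularElement Φ Q.dualMod := by
  intro ω ω' y hω'
  obtain ⟨a, ha⟩ := Q.exists_rightHaar_of_mem_dual ω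
  obtain ⟨y, rfl⟩ := Q.modular.σψ.surjective y
  rw [hΦ a ω ha, hΦ (y * a) ω', counit_mul, dualMod_σψ, mul_comm]
  intro x
  rw [hω', ha, ← mul_assoc, rightHaar_mul_σψ, ← mul_assoc]
  rfl

theorem IsDualModularElement.eq_dualMod {Q : StarAlgebraicQuantumGroup A}
    {Φ : Q.dual →ₗ[ℂ] ℂ} (hΦ : Q.IsDualIntegral Q.counit Q.antipode Φ) {d : A →ₗ[ℂ] ℂ}
    (hd : Q.IsDualModularElement Φ d) : d = Q.dualMod := by
  obtain ⟨a, ha⟩ := Q.exists_counit_eq_one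
  ext y
  let ω : Q.dual := ⟨_, Q.rightHaar_mem_dual a⟩
  let ω' : Q.dual := ⟨_, Q.rightHaar_mem_dual (Q.modular.σψ.symm y * a)⟩
  have hω : ∀ x, ω'.1 x = ω.1 (x * y) := by
    intro x
    change Q.rightHaar (Q.modular.σψ.symm y * a * x) = Q.rightHaar (a * (x * y))
    rw [mul_assoc, ← rightHaar_mul_σψ, LinearEquiv.apply_symm_apply, mul_assoc]
  have h1 : Φ ω = 1 := by rw [hΦ a ω fun x => rfl, ha]
  have h2 := hd ω ω' y hω
  have h3 := hΦ.isDualModularElement ω ω' y hω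
  rw [h1, one_mul] at h2 h3
  rw [← h2, h3]

end StarAlgebraicQuantumGroup

namespace Coact

namespace Modular

variable {Q : StarAlgebraicQuantumGroup A} {P : Coact Q X} [Nontrivial X] (D : P.Modular)

theorem conjM_act_act (P : Coact Q X) (x : X) :
    conjM (P.act Q.dualMod) (P.act Q.dualMod x) = x := by
  have h1 := (P.acts_act Q.adm_dualMod).conj.comp Q.adm_dualMod
  rw [Q.acts_κ.act_eq, Q.conjF_dualMod_comp_κ] at h1
  exact LinearMap.congr_fun (h1.unique P.acts_counit) x

/-- The action of the modular element of the dual. -/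
def _root_.StarGalois.Coact.K (P : Coact Q X) : X ≃ₗ[ℂ] X where
  toFun := P.act Q.dualMod
  map_add' := map_add _
  map_smul' := map_smul _
  invFun := conjM (P.act Q.dualMod)
  left_inv := conjM_act_act P
  right_inv x := by
    have := conjM_act_act P (star x)
    apply star_injective
    rw [← this]
    simp [conjM]

theorem acts_K (P : Coact Q X) : P.Acts Q.dualMod P.K.toLinearMap := P.acts_act Q.adm_dualMod

theorem K_mul (P : Coact Q X) (x y : X) : P.K (x * y) = P.K x * P.K y :=
  P.act_multiplicative Q.dualMod_mul (acts_K P) x y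

theorem K_symm (P : Coact Q X) (x : X) : P.K.symm x = star (P.K (star x)) := rfl

theorem exists_τ (Q : StarAlgebraicQuantumGroup A) : ∃ τ : ℂ, τ ≠ 0 ∧
    (∀ a, Q.dualMod (Q.δl a) = τ * Q.dualMod a) ∧ (∀ a, Q.dualMod (Q.δr a) = τ * Q.dualMod a) := by
  obtain ⟨c, hl, hr⟩ := Q.exists_dualMod_modular Q.mul_δl
  refine ⟨c, ?_, hl, hr⟩
  rintro rfl
  obtain ⟨b, hb⟩ := Q.exists_dualMod_eq_one
  obtain ⟨a, rfl⟩ := Q.δr_surjective b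
  rw [hr, zero_mul] at hb
  exact zero_ne_one hb

theorem h_K {h : X →ₗ[ℂ] ℂ} (H : P.LeftInv h) {τ : ℂ}
    (hτ : ∀ a, Q.dualMod (Q.δr a) = τ * Q.dualMod a) (x : X) : h (P.K x) = τ * h x := by
  obtain ⟨b, hb⟩ := Q.exists_dualMod_eq_one
  have h1 : P.Acts Q.dualMod (P.actL Q.dualMod b) := by
    conv_lhs => rw [StarAlgebraicQuantumGroup.adm_of_mul Q.dualMod_mul hb]
    exact P.acts_actL Q.dualMod b
  have h2 := LinearMap.congr_fun ((acts_K P).unique h1) x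
  rw [LinearEquiv.coe_coe] at h2
  rw [h2, H.apply_actL, hτ, hb, mul_one]

theorem sliceRight_smul (c : ℂ) (f : A →ₗ[ℂ] ℂ) (t : X ⊗[ℂ] A) :
    sliceRight (c • f) t = c • sliceRight f t := by
  induction t with
  | zero => simp
  | add s t hs ht => simp only [map_add, smul_add, hs, ht]
  | tmul u a => simp [smul_smul]

theorem K_l {τ : ℂ} (hτ : ∀ a, Q.dualMod (Q.δl a) = τ * Q.dualMod a) (x : X) :
    P.K (D.l x) = τ • D.l (P.K x) := by
  apply P.nondegenerate.eq_of_mul_left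
  intro z
  have h1 := acts_K P z (D.l x)
  rw [D.V_l, sliceRight_lTensor, show Q.dualMod ∘ₗ Q.δl = τ • Q.dualMod from LinearMap.ext hτ,
    sliceRight_smul, ← acts_K P] at h1
  rw [mul_smul_comm, D.mul_l]
  exact h1

theorem K_r {τ : ℂ} (hτ : ∀ a, Q.dualMod (Q.δr a) = τ * Q.dualMod a) (x : X) :
    P.K (D.r x) = τ • D.r (P.K x) := by
  apply P.nondegenerate.eq_of_mul_left
  intro z
  have h1 := acts_K P z (D.r x)
  rw [D.V_r, sliceRight_rTensor, sliceRight_lTensor,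
    show Q.dualMod ∘ₗ Q.δr = τ • Q.dualMod from LinearMap.ext hτ,
    sliceRight_smul, ← acts_K P, map_smul] at h1
  rw [mul_smul_comm, ← D.r_mul]
  exact h1

theorem K_act (P : Coact Q X) {f : A →ₗ[ℂ] ℂ} (hf : Adm f) :
    P.Acts (f ∘ₗ Q.γ ∘ₗ Q.σ.symm.toLinearMap) (P.K.toLinearMap ∘ₗ P.act f) := by
  have h1 := (acts_K P).comp hf
  rwa [show Q.dualMod ∘ₗ Q.self.act f = f ∘ₗ Q.γ ∘ₗ Q.σ.symm.toLinearMap from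
    LinearMap.ext fun b => Q.dualMod_act hf b] at h1

/-- The map `σ ∘ σψ ∘ K`, which commutes with the action of functionals. -/
def N : X ≃ₗ[ℂ] X := P.K ≪≫ₗ D.σψ ≪≫ₗ D.σ

/-- The three factors twist f by γ, by S⁻² and by the action of `dualMod`. On A the latter action is
S²σ⁻¹, so the total twist γσ⁻¹ is the one K itself produces in `K_act`. -/
theorem act_N {f : A →ₗ[ℂ] ℂ} (hf : Adm f) (x : X) : P.act f (D.N x) = D.N (P.act f x) := by
  have h1 : Adm (f ∘ₗ Q.γ) := hf.comp_γ
  have h2 : Adm ((f ∘ₗ Q.γ) ∘ₗ Q.antipode.symm.toLinearMap ∘ₗ Q.antipode.symm.toLinearMap) :=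
    (h1.comp_antipode_symm (Q := Q)).comp_antipode_symm (Q := Q)
  have h3 := (P.acts_act h2).comp Q.adm_dualMod
  rw [Q.acts_κ.act_eq, show ((f ∘ₗ Q.γ) ∘ₗ Q.antipode.symm.toLinearMap ∘ₗ
    Q.antipode.symm.toLinearMap) ∘ₗ Q.κ = f ∘ₗ Q.γ ∘ₗ Q.σ.symm.toLinearMap by
      ext a; simp [Q.κ_apply, Q.S2_apply]] at h3
  change P.act f (D.σ (D.σψ (P.K x))) = D.σ (D.σψ (P.K (P.act f x)))
  rw [D.act_σ hf, D.act_σψ h1]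
  congr 2
  exact LinearMap.congr_fun (h3.unique (K_act P hf)) x

end Modular
end Coact
end StarGalois
end

/-! ### Symmetric locally finite maps are diagonalizable -/

noncomputable section
namespace StarGalois
open Multiplier LinearMap

variable {A : Type*} [NonUnitalRing A] [Module ℂ A] [IsScalarTower ℂ A A] [SMulCommClass ℂ A A]
  [StarRing A] [StarModule ℂ A]
  {X : Type*} [NonUnitalRing X] [Module ℂ X] [IsScalarTower ℂ X X] [SMulCommClass ℂ X X]
  [StarRing X] [StarModule ℂ X]

theorem IsPositive.apply_eq_zero {ω : X →ₗ[ℂ] ℂ} (hω : IsPositive ω) {x : X}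
    (hx : ω (star x * x) = 0) (y : X) : ω (star y * x) = 0 := by
  by_contra hne
  have key : ∀ t : ℝ, 0 ≤ (ω (star y * y)).re - 2 * t * Complex.normSq (ω (star y * x)) := by
    intro t
    have h1 := (Complex.nonneg_iff.mp (hω (y + (-(t : ℂ) * star (ω (star y * x))) • x))).1
    have h2 : ω (star (y + (-(t : ℂ) * star (ω (star y * x))) • x) *
        (y + (-(t : ℂ) * star (ω (star y * x))) • x)) =
        ω (star y * y) - 2 * t * (ω (star y * x) * star (ω (star y * x))) := by
      simp only [star_add, star_smul, add_mul, mul_add, smul_mul_assoc, mul_smul_comm, map_add,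
        map_smul, hx, smul_eq_mul, hω.conj_apply y x]
      simp only [star_mul', star_neg, Complex.star_def, Complex.conj_ofReal, Complex.conj_conj]
      ring
    rw [h2, Complex.star_def, Complex.mul_conj] at h1
    have h3 : (ω (star y * y) - 2 * t * (Complex.normSq (ω (star y * x)) : ℂ)).re =
        (ω (star y * y)).re - 2 * t * Complex.normSq (ω (star y * x)) := by
      rw [Complex.sub_re]
      congr 1
      have : (2 * (t : ℂ) * (Complex.normSq (ω (star y * x)) : ℂ)) =
          ((2 * t * Complex.normSq (ω (star y * x)) : ℝ) : ℂ) := by push_cast; ring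
      rw [this, Complex.ofReal_re]
    rwa [h3] at h1
  have hpos : 0 < Complex.normSq (ω (star y * x)) := Complex.normSq_pos.mpr hne
  -- This choice of `t` makes the lower bound equal to -1.
  have h4 := key (((ω (star y * y)).re + 1) / (2 * Complex.normSq (ω (star y * x))))
  have h5 : 2 * (((ω (star y * y)).re + 1) / (2 * Complex.normSq (ω (star y * x)))) *
      Complex.normSq (ω (star y * x)) = (ω (star y * y)).re + 1 := by
    field_simp
  rw [h5] at h4
  linarith

section Spectral

/-- `h` is a positive definite functional. -/
def IsDefinite (h : X →ₗ[ℂ] ℂ) : Prop := ∀ x, x ≠ 0 → 0 < h (star x * x)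

/-- `W` is symmetric for the inner product of `h`, up to the factor `μ`. -/
def IsSymm (h : X →ₗ[ℂ] ℂ) (μ : ℂ) (W : X →ₗ[ℂ] X) : Prop :=
  ∀ x y, h (star y * W x) = μ * h (star (W y) * x)

/-- The even powers of `W`, applied to a vector, stay in a finite-dimensional subspace. -/
def IsLocallyFinite (W : X →ₗ[ℂ] X) : Prop :=
  ∀ x, ∃ F : Submodule ℂ X, FiniteDimensional ℂ F ∧ ∀ m : ℕ, ((W : Module.End ℂ X) ^ (2 * m)) x ∈ F

variable {h : X →ₗ[ℂ] ℂ} {μ : ℂ} {W : X →ₗ[ℂ] X}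

theorem IsSymm.eigenvalue (hW : IsSymm h μ W) (hh : IsDefinite h) {x : X} {lam : ℂ} (hx : x ≠ 0)
    (hx' : W x = lam • x) : lam = μ * star lam := by
  have h1 := hW x x
  rw [hx', mul_smul_comm, map_smul, star_smul, smul_mul_assoc, map_smul, smul_eq_mul, smul_eq_mul,
    ← mul_assoc] at h1
  exact mul_right_cancel₀ (hh x hx).ne' h1

theorem IsSymm.orthogonal (hW : IsSymm h μ W) (hh : IsDefinite h) {x y : X} {lam lam' : ℂ}
    (hx : W x = lam • x) (hy : W y = lam' • y) (hne : lam ≠ lam') : h (star y * x) = 0 := by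
  by_cases hy0 : y = 0
  · simp [hy0]
  have h1 := hW x y
  rw [hx, hy, mul_smul_comm, map_smul, star_smul, smul_mul_assoc, map_smul, smul_eq_mul,
    smul_eq_mul, ← mul_assoc, ← hW.eigenvalue hh hy0 hy] at h1
  by_contra h0
  exact hne (mul_right_cancel₀ h0 h1)

/-- There are no Jordan blocks of size two: symmetry makes the eigenvector (W - λ)v orthogonal to
itself. -/
theorem IsSymm.sub_sub_eq_zero (hW : IsSymm h μ W) (hh : IsDefinite h) {v : X} {lam : ℂ}
    (hv : W (W v - lam • v) = lam • (W v - lam • v)) : W v - lam • v = 0 := by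
  by_contra hne
  have h1 := hh _ hne
  have h2 := hW.eigenvalue hh hne hv
  set w := W v - lam • v
  have h3 : h (star w * w) = 0 := by
    have h4 : h (star w * w) = h (star w * W v) - lam * h (star w * v) := by
      rw [show star w * w = star w * W v - lam • (star w * v) by
        rw [← mul_smul_comm, ← mul_sub], map_sub, map_smul, smul_eq_mul]
    rw [h4, hW, hv, star_smul, smul_mul_assoc, map_smul, smul_eq_mul, ← mul_assoc, ← h2, sub_self]
  exact h1.ne' h3

theorem IsSymm.mem_eigenspace (hW : IsSymm h μ W) (hh : IsDefinite h) {v : X} {lam : ℂ} (k : ℕ)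
    (hv : (((W : Module.End ℂ X) - lam • 1) ^ k) v = 0) :
    v ∈ Module.End.eigenspace (W : Module.End ℂ X) lam := by
  induction k with
  | zero => simp at hv; simp [hv]
  | succ k ih =>
    cases k with
    | zero =>
      rw [Module.End.mem_eigenspace_iff, ← sub_eq_zero]
      simpa using hv
    | succ k =>
      apply ih
      rw [pow_succ', Module.End.mul_apply]
      have h1 := hW.sub_sub_eq_zero hh
        (v := (((W : Module.End ℂ X) - lam • 1) ^ k) v) (lam := lam) (by
          rw [← sub_eq_zero]
          rw [pow_succ', pow_succ', Module.End.mul_apply, Module.End.mul_apply] at hv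
          simpa using hv)
      simpa using h1

/-- An invariant subspace of a locally finite symmetric map is spanned by eigenvectors. -/
theorem IsSymm.le_iSup_eigenspace (hW : IsSymm h μ W) (hh : IsDefinite h)
    (hf : IsLocallyFinite W) (E : Submodule ℂ X) (hE : ∀ x ∈ E, W x ∈ E) :
    E ≤ ⨆ lam : ℂ, E ⊓ Module.End.eigenspace (W : Module.End ℂ X) lam := by
  intro x hx
  obtain ⟨F₀, hF₀, hxF⟩ := hf x
  let F : Submodule ℂ X := Submodule.span ℂ (Set.range fun n : ℕ => ((W : Module.End ℂ X) ^ n) x)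
  -- Even powers lie in `F₀` and odd powers in its image, so control of the even powers suffices.
  have hF : F ≤ F₀ ⊔ F₀.map W := by
    rw [Submodule.span_le]
    rintro _ ⟨n, rfl⟩
    obtain ⟨m, rfl | rfl⟩ := n.even_or_odd'
    · exact Submodule.mem_sup_left (hxF m)
    · refine Submodule.mem_sup_right ⟨_, hxF m, ?_⟩
      simp only [pow_succ', Module.End.mul_apply]
  have : FiniteDimensional ℂ F := Submodule.finiteDimensional_of_le hF
  have hFE : F ≤ E := by
    rw [Submodule.span_le]
    rintro _ ⟨n, rfl⟩
    induction n with
    | zero => simpa using hx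
    | succ n ih =>
      simp only [pow_succ', Module.End.mul_apply]
      exact hE _ ih
  have hFW : ∀ y ∈ F, W y ∈ F := by
    intro y hy
    have : F.map W ≤ F := by
      rw [Submodule.map_span, Submodule.span_le]
      rintro _ ⟨_, ⟨n, rfl⟩, rfl⟩
      apply Submodule.subset_span
      refine ⟨n + 1, ?_⟩
      simp only [pow_succ', Module.End.mul_apply]
    exact this ⟨y, hy, rfl⟩
  have hxF' : x ∈ F := Submodule.subset_span ⟨0, by simp⟩
  have htop := Module.End.iSup_maxGenEigenspace_eq_top (LinearMap.restrict W hFW)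
  have hmem : (⟨x, hxF'⟩ : F) ∈
      ⨆ lam, Module.End.maxGenEigenspace (LinearMap.restrict W hFW) lam := by
    rw [htop]
    trivial
  have h2 := Submodule.mem_map_of_mem (f := F.subtype) hmem
  rw [Submodule.map_iSup] at h2
  refine SetLike.le_def.mp (iSup_mono fun lam => ?_) h2
  rintro _ ⟨v, hv, rfl⟩
  refine ⟨hFE v.2, ?_⟩
  have h3 : Module.End.maxGenEigenspace (LinearMap.restrict W hFW) lam =
      Submodule.comap F.subtype (Module.End.maxGenEigenspace (W : Module.End ℂ X) lam) :=
    Module.End.genEigenspace_restrict (W : Module.End ℂ X) F ⊤ lam hFW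
  have h4 : v ∈ Submodule.comap F.subtype (Module.End.maxGenEigenspace (W : Module.End ℂ X) lam) :=
    h3 ▸ hv
  rw [Submodule.mem_comap, Module.End.mem_maxGenEigenspace] at h4
  obtain ⟨k, hk⟩ := h4
  exact hW.mem_eigenspace hh k hk

theorem IsSymm.iSup_eigenspace (hW : IsSymm h μ W) (hh : IsDefinite h)
    (hf : IsLocallyFinite W) : ⨆ lam : ℂ, Module.End.eigenspace (W : Module.End ℂ X) lam = ⊤ := by
  have := hW.le_iSup_eigenspace hh hf ⊤ (fun _ _ => trivial)
  simpa [top_inf_eq, top_le_iff] using this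

theorem IsSymm.pow (hW : IsSymm h μ W) (n : ℕ) (x y : X) :
    h (star y * ((W : Module.End ℂ X) ^ n) x) =
      μ ^ n * h (star (((W : Module.End ℂ X) ^ n) y) * x) := by
  induction n generalizing x y with
  | zero => simp
  | succ n ih =>
    rw [pow_succ' (W : Module.End ℂ X), Module.End.mul_apply, hW, ih]
    rw [← Module.End.mul_apply, ← pow_succ', ← pow_succ]
    ring

theorem injective_pow (hinj : Function.Injective W) (n : ℕ) :
    Function.Injective ((W : Module.End ℂ X) ^ n) := by
  rw [Module.End.coe_pow]
  exact hinj.iterate n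

theorem IsSymm.pow_even_ne_zero (hW : IsSymm h μ W) (hh : IsDefinite h) (hμ : μ ≠ 0)
    (hinj : Function.Injective W) {x : X} (hx : x ≠ 0) (m : ℕ) :
    h (star x * ((W : Module.End ℂ X) ^ (2 * m)) x) ≠ 0 := by
  rw [two_mul, pow_add, Module.End.mul_apply, hW.pow]
  apply mul_ne_zero (pow_ne_zero m hμ)
  refine (hh _ ?_).ne'
  intro h0
  exact hx (injective_pow hinj m (by rw [h0, map_zero]))

end Spectral

namespace Coact

variable {Q : StarAlgebraicQuantumGroup A} {P : Coact Q X} [Nontrivial X]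

theorem LeftInv.isDefinite {h : X →ₗ[ℂ] ℂ} (H : P.LeftInv h) (hpos : IsPositive h) :
    IsDefinite h := by
  intro x hx
  refine lt_of_le_of_ne (hpos x) fun h0 => hx ?_
  apply H.left_faithful
  intro y
  have := hpos.apply_eq_zero h0.symm (star y)
  rwa [star_star] at this

end Coact

theorem StarAlgebraicQuantumGroup.isDefinite_haar (Q : StarAlgebraicQuantumGroup A) :
    IsDefinite Q.haar := by
  have := Q.nontrivial
  exact Q.leftInv_haar.isDefinite Q.haar_positive

namespace Coact.Modular

variable {Q : StarAlgebraicQuantumGroup A} {P : Coact Q X} [Nontrivial X] (D : P.Modular)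

theorem isDefinite : IsDefinite D.h := D.leftInv.isDefinite D.pos

theorem exists_isSymm_l : ∃ μ, μ ≠ 0 ∧ IsSymm D.h μ D.l.toLinearMap := by
  obtain ⟨c, hc0, hc⟩ := D.exists_star_r
  refine ⟨star c, star_ne_zero.mpr hc0, fun x y => ?_⟩
  rw [LinearEquiv.coe_coe, D.mul_l]
  have := congrArg star (hc y)
  rw [star_star, star_smul] at this
  rw [this, smul_mul_assoc, map_smul, smul_eq_mul]

theorem exists_isSymm_r : ∃ μ, μ ≠ 0 ∧ IsSymm D.h μ D.r.toLinearMap := by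
  obtain ⟨c, hc0, hc⟩ := D.exists_star_r
  obtain ⟨ν, hν0, hν⟩ := D.exists_h_l
  refine ⟨(c * ν)⁻¹, inv_ne_zero (mul_ne_zero hc0 hν0), fun x y => ?_⟩
  have h1 := hc (star y)
  rw [star_star] at h1
  rw [LinearEquiv.coe_coe, h1, smul_mul_assoc, map_smul, smul_eq_mul, ← D.l_mul, hν, D.r_mul]
  field_simp

theorem σ_isSymm : IsSymm D.h 1 D.σ.toLinearMap := by
  intro x y
  rw [LinearEquiv.coe_coe, D.h_mul_σ, one_mul]
  have h1 := D.star_σ (star y)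
  rw [star_star] at h1
  rw [h1, ← D.h_mul_σ (D.σ.symm (star y)), LinearEquiv.apply_symm_apply]

/-- K is multiplicative with inverse x ↦ K(x⋆)⋆, and it scales h by τ. -/
theorem K_isSymm {τ : ℂ} (hτ : ∀ a, Q.dualMod (Q.δr a) = τ * Q.dualMod a) :
    IsSymm D.h τ P.K.toLinearMap := by
  intro x y
  have h1 := K_symm P (star y)
  rw [star_star] at h1
  rw [LinearEquiv.coe_coe, ← h1, ← h_K D.leftInv hτ, K_mul, LinearEquiv.apply_symm_apply]

theorem K_σ (x : X) : P.K (D.σ x) = D.σ (P.K x) := by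
  obtain ⟨τ, hτ0, hτl, hτ⟩ := exists_τ Q
  apply D.leftInv.ext_left
  intro y
  obtain ⟨y, rfl⟩ := P.K.surjective y
  rw [← K_mul, h_K D.leftInv hτ, D.h_mul_σ, D.h_mul_σ, ← K_mul, h_K D.leftInv hτ]

theorem σψ_mul (x y : X) : D.σψ (x * y) = D.σψ x * D.σψ y := by
  apply D.ψ_ext_left
  intro z
  rw [ψ_mul_σψ, mul_assoc, ← D.ψ_mul_σψ x, mul_assoc y, ← D.ψ_mul_σψ y, mul_assoc]

theorem N_mul (x y : X) : D.N (x * y) = D.N x * D.N y := by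
  change D.σ (D.σψ (P.K (x * y))) = D.σ (D.σψ (P.K x)) * D.σ (D.σψ (P.K y))
  rw [K_mul, σψ_mul, σ_mul]

end Coact.Modular
end StarGalois
end

/-! ### Local finiteness of the structure maps -/

noncomputable section
namespace StarGalois
open Multiplier LinearMap

variable {A : Type*} [NonUnitalRing A] [Module ℂ A] [IsScalarTower ℂ A A] [SMulCommClass ℂ A A]
  [StarRing A] [StarModule ℂ A]
  {X : Type*} [NonUnitalRing X] [Module ℂ X] [IsScalarTower ℂ X X] [SMulCommClass ℂ X X]
  [StarRing X] [StarModule ℂ X]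

theorem mem_of_smul_mem' {F : Submodule ℂ X} {c : ℂ} (hc : c ≠ 0) {x : X} (h : c • x ∈ F) :
    x ∈ F := by
  have := F.smul_mem c⁻¹ h
  rwa [smul_smul, inv_mul_cancel₀ hc, one_smul] at this

namespace StarAlgebraicQuantumGroup

open Coact

variable (Q : StarAlgebraicQuantumGroup A)

theorem isSymm_δl : IsSymm Q.haar 1 Q.δl := by
  intro x y
  rw [mul_δl, one_mul]
  have := Q.star_δl (star y)
  rw [star_star] at this
  rw [this]

theorem haar_δr_pow_ne_zero {a : A} (ha : a ≠ 0) (m : ℕ) :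
    Q.haar (((Q.δr : Module.End ℂ A) ^ (2 * m)) a * star a) ≠ 0 := by
  have h1 : ∀ (m : ℕ) x y, ((Q.δr : Module.End ℂ A) ^ m) x * y =
      x * ((Q.δl : Module.End ℂ A) ^ m) y := by
    intro m
    induction m with
    | zero => simp
    | succ m ih =>
      intro x y
      rw [pow_succ, pow_succ', Module.End.mul_apply, Module.End.mul_apply, ih, mul_δl]
  have h2 : ∀ (m : ℕ) x, ((Q.δl : Module.End ℂ A) ^ m) (star x) =
      star (((Q.δr : Module.End ℂ A) ^ m) x) := by
    intro m x
    induction m with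
    | zero => simp
    | succ m ih =>
      rw [pow_succ', pow_succ', Module.End.mul_apply, Module.End.mul_apply, ih, ← star_δr, star_star]
  rw [two_mul, pow_add, Module.End.mul_apply, h1, h2]
  have h3 : ((Q.δr : Module.End ℂ A) ^ m) a ≠ 0 := by
    intro h0
    exact ha (injective_pow Q.δr_injective m (by rw [h0, map_zero]))
  have := Q.isDefinite_haar (star (((Q.δr : Module.End ℂ A) ^ m) a)) (star_ne_zero.mpr h3)
  rw [star_star] at this
  exact ne_of_gt this

/-- The left action `b ↦ (d ⊗ ι)Δ(b)` of the modular element of the dual. -/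
def dualModLeft : A →ₗ[ℂ] A := Q.γ ∘ₗ Q.σ.symm.toLinearMap

theorem adm_comp_dualModLeft {f : A →ₗ[ℂ] ℂ} (hf : Adm f) : Adm (f ∘ₗ Q.dualModLeft) := by
  have h1 : Adm (f ∘ₗ Q.γ) := hf.comp_γ
  change Adm ((f ∘ₗ Q.γ) ∘ₗ Q.σ.symm.toLinearMap)
  obtain ⟨ρ, b, h⟩ | ⟨ρ, b, h⟩ := h1
  · refine Or.inl ⟨ρ ∘ₗ Q.σ.symm.toLinearMap, Q.σ b, ?_⟩
    rw [h]
    ext; simp [σ_symm_mul]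
  · refine Or.inr ⟨ρ ∘ₗ Q.σ.symm.toLinearMap, Q.σ b, ?_⟩
    rw [h]
    ext; simp [σ_symm_mul]

theorem dualMod_act_left {f : A →ₗ[ℂ] ℂ} (hf : Adm f) (b : A) :
    Q.dualMod (Q.self.act f b) = f (Q.dualModLeft b) := Q.dualMod_act hf b

theorem eq_of_adm (Q : StarAlgebraicQuantumGroup A) {a b : A} (h : ∀ f : A →ₗ[ℂ] ℂ, Adm f → f a = f b) : a = b := by
  rw [← sub_eq_zero]
  apply Q.eq_zero_of_haar_mul_left
  intro c
  have := h (Q.haar ∘ₗ mulLeft ℂ c) (Or.inr ⟨_, _, rfl⟩)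
  rw [mul_sub, map_sub, sub_eq_zero]
  exact this

theorem sliceLeft_dualMod_V' (z b : A) :
    sliceLeft Q.dualMod (Q.self.V' (z ⊗ₜ b)) = Q.dualMod z • Q.dualModLeft b := by
  apply Q.eq_of_adm
  intro f hf
  rw [← apply_sliceRight, ← (Q.self.acts_act hf).mul_right, dualMod_mul, dualMod_act_left Q hf,
    map_smul, smul_eq_mul, mul_comm]

theorem haar_dualModLeft (b : A) : Q.haar (Q.dualModLeft b) = Q.haar b := by
  obtain ⟨z, hz⟩ := Q.exists_dualMod_eq_one
  have h1 := Q.sliceLeft_dualMod_V' z b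
  rw [hz, one_smul] at h1
  rw [← h1, ← apply_sliceRight, haar_V', map_smul, hz, smul_eq_mul, mul_one]

theorem dualModLeft_mul (x y : A) :
    Q.dualModLeft (x * y) = Q.dualModLeft x * Q.dualModLeft y := by
  obtain ⟨z, hz⟩ := Q.exists_dualMod_eq_one
  have h1 := Q.sliceLeft_dualMod_V' z (x * y)
  have h2 : ∀ t, sliceLeft Q.dualMod (Q.self.L x t) =
      Q.dualModLeft x * sliceLeft Q.dualMod t := by
    intro t
    induction t with
    | zero => simp
    | add s t hs ht => simp only [map_add, mul_add, hs, ht]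
    | tmul u c =>
      rw [L_tmul, sliceLeft_lTensor, sliceLeft_dualMod_V', sliceLeft_tmul]
      simp [mul_smul_comm]
  rw [hz, one_smul, ← L_V', h2, sliceLeft_dualMod_V', hz, one_smul] at h1
  exact h1.symm

theorem Adm.conj {f : A →ₗ[ℂ] ℂ} (hf : Adm f) : Adm (conjF f) := by
  obtain ⟨ρ, b, rfl⟩ | ⟨ρ, b, rfl⟩ := hf
  · refine Or.inr ⟨conjF ρ, star b, ?_⟩
    ext; simp [conjF]
  · refine Or.inl ⟨conjF ρ, star b, ?_⟩
    ext; simp [conjF]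

theorem conjF_conjF (f : A →ₗ[ℂ] ℂ) : conjF (conjF f) = f := by
  ext; simp [conjF]

theorem conjF_dualMod_act {f : A →ₗ[ℂ] ℂ} (hf : Adm f) (b : A) :
    conjF Q.dualMod (Q.self.act f b) = f (conjM Q.dualModLeft b) := by
  have h1 := (Q.self.acts_act (Adm.conj hf)).conj
  rw [conjF_conjF] at h1
  rw [h1.act_eq]
  change star (Q.dualMod (star (star (Q.self.act (conjF f) (star b))))) = _
  rw [star_star, dualMod_act_left Q (Adm.conj hf)]
  simp [conjF, conjM]

/-- The inverse of the left action of `dualMod` is the left action of its convolution inverse, which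
is the conjugate functional. -/
theorem dualModLeft_conjM (b : A) : Q.dualModLeft (conjM Q.dualModLeft b) = b := by
  have := Q.nontrivial
  apply Q.eq_of_adm
  intro f hf
  have h1 := Q.conjF_dualMod_act (Q.adm_comp_dualModLeft hf) b
  rw [LinearMap.comp_apply] at h1
  rw [← h1]
  have h2 := (Modular.K_act Q.self hf).act_eq
  change Q.self.act (f ∘ₗ Q.dualModLeft) = _ at h2
  have h3 : Q.self.K.toLinearMap = Q.κ := Q.acts_κ.act_eq
  have h4 : Q.counit (Q.self.act f b) = f b := by
    obtain ⟨z, hz⟩ := Q.exists_counit_eq_one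
    have h7 := congrArg Q.counit (Q.self.acts_act hf z b)
    rw [counit_mul, hz, one_mul, apply_sliceRight] at h7
    rw [h7]
    congr 1
    apply Q.nondegenerate.eq_of_mul_right
    intro c
    change mulRight ℂ c _ = _
    rw [← sliceLeft_lTensor, ← lmul_T₁, sliceLeft_rTensor, ← adm_of_mul Q.counit_mul hz, counit_T₁]
  rw [h2, h3, LinearMap.comp_apply, ← LinearMap.comp_apply (conjF Q.dualMod), conjF_dualMod_comp_κ,
    h4]

theorem conjM_dualModLeft (b : A) : conjM Q.dualModLeft (Q.dualModLeft b) = b := by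
  have h1 := Q.dualModLeft_conjM (star b)
  apply star_injective
  rw [← h1]
  simp [conjM]

theorem isSymm_dualModLeft : IsSymm Q.haar 1 Q.dualModLeft := by
  intro x y
  have h1 := Q.dualModLeft_conjM (star y)
  rw [← h1, ← dualModLeft_mul, haar_dualModLeft, one_mul]
  simp [conjM]

theorem dualModLeft_injective : Function.Injective Q.dualModLeft :=
  Function.LeftInverse.injective Q.conjM_dualModLeft

end StarAlgebraicQuantumGroup

namespace Coact

variable {Q : StarAlgebraicQuantumGroup A} {P : Coact Q X}

/-- For s = u ⊗ v the vector is a slice of V'⁻¹(u ⊗ σ(c)) along h(W v ·). Only the functional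
depends on `W`, so one finite-dimensional space serves all `W`. -/
theorem LeftInv.exists_finiteDimensional_V' {h : X →ₗ[ℂ] ℂ} (H : P.LeftInv h) (s : X ⊗[ℂ] X)
    (c : A) : ∃ F : Submodule ℂ X, FiniteDimensional ℂ F ∧
      ∀ W : X →ₗ[ℂ] X, sliceRight (Q.haar ∘ₗ mulLeft ℂ c) (P.V' (lTensor X W s)) ∈ F := by
  induction s with
  | zero => exact ⟨⊥, inferInstance, by simp⟩
  | add s t hs ht =>
    obtain ⟨F, hF, h⟩ := hs
    obtain ⟨F', hF', h'⟩ := ht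
    refine ⟨F ⊔ F', inferInstance, fun W => ?_⟩
    rw [map_add, map_add, map_add]
    exact Submodule.add_mem_sup (h W) (h' W)
  | tmul u v =>
    obtain ⟨F, hF, hm⟩ := exists_finiteDimensional_sliceRight (P.V'.symm (u ⊗ₜ Q.σ c))
    refine ⟨F, hF, fun W => ?_⟩
    rw [lTensor_tmul, ← (P.acts_actL Q.haar c).mul_right, actL_haar, H.actR_mul]
    exact hm _

theorem LeftInv.exists_finiteDimensional_V {h : X →ₗ[ℂ] ℂ} (H : P.LeftInv h) (s : X ⊗[ℂ] X)
    (c : A) : ∃ F : Submodule ℂ X, FiniteDimensional ℂ F ∧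
      ∀ W : X →ₗ[ℂ] X, sliceRight (Q.haar ∘ₗ mulRight ℂ c) (P.V (lTensor X W s)) ∈ F := by
  induction s with
  | zero => exact ⟨⊥, inferInstance, by simp⟩
  | add s t hs ht =>
    obtain ⟨F, hF, h⟩ := hs
    obtain ⟨F', hF', h'⟩ := ht
    refine ⟨F ⊔ F', inferInstance, fun W => ?_⟩
    rw [map_add, map_add, map_add]
    exact Submodule.add_mem_sup (h W) (h' W)
  | tmul u v =>
    obtain ⟨F, hF, hm⟩ := exists_finiteDimensional_sliceRight (P.V.symm (u ⊗ₜ Q.σ.symm c))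
    refine ⟨F, hF, fun W => ?_⟩
    have h1 := actL_haar P (Q.σ.symm c)
    rw [LinearEquiv.apply_symm_apply] at h1
    rw [lTensor_tmul, ← P.acts_actR, ← h1, H.mul_actL]
    exact hm _

namespace Modular

variable [Nontrivial X] (D : P.Modular)

theorem V'_l_pow (n : ℕ) (x : X) (a : A) :
    P.V' (lTensor X ((D.l.toLinearMap : Module.End ℂ X) ^ n) (P.V'.symm (x ⊗ₜ a))) =
      ((D.l.toLinearMap : Module.End ℂ X) ^ n) x ⊗ₜ ((Q.δl : Module.End ℂ A) ^ n) a := by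
  have h1 : ∀ s, P.V' (lTensor X D.l.toLinearMap s) =
      rTensor A D.l.toLinearMap (lTensor X Q.δl (P.V' s)) := by
    intro s
    induction s with
    | zero => simp
    | add s t hs ht => simp only [map_add, hs, ht]
    | tmul u v => exact D.V'_l u v
  induction n with
  | zero =>
    rw [pow_zero, pow_zero, Module.End.one_eq_id, lTensor_id]
    simp
  | succ n ih =>
    rw [pow_succ', pow_succ', Module.End.mul_eq_comp, Module.End.mul_eq_comp, lTensor_comp,
      LinearMap.comp_apply, h1, ih]
    simp

theorem V_r_pow (n : ℕ) (x : X) (a : A) :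
    P.V (lTensor X ((D.r.toLinearMap : Module.End ℂ X) ^ n) (P.V.symm (x ⊗ₜ a))) =
      ((D.r.toLinearMap : Module.End ℂ X) ^ n) x ⊗ₜ ((Q.δr : Module.End ℂ A) ^ n) a := by
  have h1 : ∀ s, P.V (lTensor X D.r.toLinearMap s) =
      rTensor A D.r.toLinearMap (lTensor X Q.δr (P.V s)) := by
    intro s
    induction s with
    | zero => simp
    | add s t hs ht => simp only [map_add, hs, ht]
    | tmul u v => exact D.V_r u v
  induction n with
  | zero =>
    rw [pow_zero, pow_zero, Module.End.one_eq_id, lTensor_id]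
    simp
  | succ n ih =>
    rw [pow_succ', pow_succ', Module.End.mul_eq_comp, Module.End.mul_eq_comp, lTensor_comp,
      LinearMap.comp_apply, h1, ih]
    simp

theorem isLocallyFinite_l : IsLocallyFinite D.l.toLinearMap := by
  intro x
  have := Q.nontrivial
  obtain ⟨a, ha⟩ := exists_ne (0 : A)
  obtain ⟨F, hF, h⟩ := D.leftInv.exists_finiteDimensional_V' (P.V'.symm (x ⊗ₜ a)) (star a)
  refine ⟨F, hF, fun m => ?_⟩
  have h1 := h ((D.l.toLinearMap : Module.End ℂ X) ^ (2 * m))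
  -- The slice is φ(a⋆δ²ᵐa) times the vector in question, with a non-zero factor.
  rw [V'_l_pow, sliceRight_tmul] at h1
  exact mem_of_smul_mem' (Q.isSymm_δl.pow_even_ne_zero Q.isDefinite_haar one_ne_zero
    Q.δl_injective ha m) h1

theorem isLocallyFinite_r : IsLocallyFinite D.r.toLinearMap := by
  intro x
  have := Q.nontrivial
  obtain ⟨a, ha⟩ := exists_ne (0 : A)
  obtain ⟨F, hF, h⟩ := D.leftInv.exists_finiteDimensional_V (P.V.symm (x ⊗ₜ a)) (star a)
  refine ⟨F, hF, fun m => ?_⟩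
  have h1 := h ((D.r.toLinearMap : Module.End ℂ X) ^ (2 * m))
  rw [V_r_pow, sliceRight_tmul] at h1
  exact mem_of_smul_mem' (Q.haar_δr_pow_ne_zero ha m) h1

theorem exists_acts_K_symm_pow (P : Coact Q X) (n : ℕ) :
    ∃ f, P.Acts f ((P.K.symm.toLinearMap : Module.End ℂ X) ^ n) := by
  have hadm : Adm (conjF Q.dualMod) := StarAlgebraicQuantumGroup.Adm.conj Q.adm_dualMod
  have hK : P.act (conjF Q.dualMod) = P.K.symm.toLinearMap := (acts_K P).conj.act_eq
  induction n with
  | zero => exact ⟨Q.counit, P.acts_counit⟩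
  | succ n ih =>
    obtain ⟨f, hf⟩ := ih
    refine ⟨f ∘ₗ Q.self.act (conjF Q.dualMod), ?_⟩
    have h1 := hf.comp hadm
    rw [hK] at h1
    exact h1

/-- K carries g ▹ y to (g ∘ D) ▹ y, where D is `dualModLeft`; powers of K are thereby shifted onto
the second leg. -/
theorem acts_K_pow_act (P : Coact Q X) {g : A →ₗ[ℂ] ℂ} (hg : Adm g) (n : ℕ) :
    Adm (g ∘ₗ ((Q.dualModLeft : Module.End ℂ A) ^ n)) ∧
      P.Acts (g ∘ₗ ((Q.dualModLeft : Module.End ℂ A) ^ n))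
        (((P.K.toLinearMap : Module.End ℂ X) ^ n) ∘ₗ P.act g) := by
  induction n with
  | zero => exact ⟨hg, P.acts_act hg⟩
  | succ n ih =>
    obtain ⟨h1, h2⟩ := ih
    have h3 := K_act P h1
    rw [h2.act_eq] at h3
    rw [pow_succ (Q.dualModLeft : Module.End ℂ A), pow_succ' (P.K.toLinearMap : Module.End ℂ X)]
    exact ⟨Q.adm_comp_dualModLeft h1, h3⟩

theorem K_pow_mul (P : Coact Q X) (n : ℕ) (x y : X) :
    ((P.K.toLinearMap : Module.End ℂ X) ^ n) (x * y) =
      ((P.K.toLinearMap : Module.End ℂ X) ^ n) x * ((P.K.toLinearMap : Module.End ℂ X) ^ n) y := by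
  induction n with
  | zero => rfl
  | succ n ih =>
    simp only [pow_succ', Module.End.mul_apply, ih, LinearEquiv.coe_coe, K_mul]

theorem K_pow_symm_pow (P : Coact Q X) (n : ℕ) (x : X) :
    ((P.K.toLinearMap : Module.End ℂ X) ^ n)
      (((P.K.symm.toLinearMap : Module.End ℂ X) ^ n) x) = x := by
  induction n generalizing x with
  | zero => rfl
  | succ n ih =>
    rw [pow_succ, pow_succ', Module.End.mul_apply, Module.End.mul_apply]
    simp [ih]

theorem K_symm_pow_pow (P : Coact Q X) (n : ℕ) (x : X) :
    ((P.K.symm.toLinearMap : Module.End ℂ X) ^ n)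
      (((P.K.toLinearMap : Module.End ℂ X) ^ n) x) = x := by
  induction n generalizing x with
  | zero => rfl
  | succ n ih =>
    rw [pow_succ, pow_succ', Module.End.mul_apply, Module.End.mul_apply]
    simp [ih]

/-- `K⁻ⁿ(g(Dⁿ a)u)` stays in a finite-dimensional space. -/
theorem exists_finiteDimensional_K (P : Coact Q X) {g : A →ₗ[ℂ] ℂ} (hg : Adm g) (s : X ⊗[ℂ] X) :
    ∃ F : Submodule ℂ X, FiniteDimensional ℂ F ∧ ∀ n : ℕ,
      ((P.K.symm.toLinearMap : Module.End ℂ X) ^ n)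
        (sliceRight (g ∘ₗ ((Q.dualModLeft : Module.End ℂ A) ^ n)) (P.V' s)) ∈ F := by
  induction s with
  | zero => exact ⟨⊥, inferInstance, by simp⟩
  | add s t hs ht =>
    obtain ⟨F, hF, h⟩ := hs
    obtain ⟨F', hF', h'⟩ := ht
    refine ⟨F ⊔ F', inferInstance, fun n => ?_⟩
    rw [map_add, map_add, map_add]
    exact Submodule.add_mem_sup (h n) (h' n)
  | tmul w y =>
    obtain ⟨F, hF, hm⟩ := exists_finiteDimensional_sliceRight (P.V (P.act g y ⊗ₜ w))
    refine ⟨F, hF, fun n => ?_⟩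
    obtain ⟨f, hf⟩ := exists_acts_K_symm_pow P n
    -- Since (g ∘ Dⁿ) ▹ y = Kⁿ(g ▹ y) and K is multiplicative, applying K⁻ⁿ to its product with `w`
    -- leaves (g ▹ y)K⁻ⁿ(w). As K⁻ⁿ is the action of some functional, this is a slice of a tensor
    -- independent of `n`.
    have h1 : ((P.K.symm.toLinearMap : Module.End ℂ X) ^ n)
        (sliceRight (g ∘ₗ ((Q.dualModLeft : Module.End ℂ A) ^ n)) (P.V' (w ⊗ₜ y))) =
        P.act g y * ((P.K.symm.toLinearMap : Module.End ℂ X) ^ n) w := by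
      rw [← (acts_K_pow_act P hg n).2.mul_right, LinearMap.comp_apply]
      conv_lhs => rw [← K_pow_symm_pow P n w]
      rw [← K_pow_mul, K_symm_pow_pow]
    rw [h1, hf]
    exact hm f

theorem isLocallyFinite_K_symm (P : Coact Q X) : IsLocallyFinite P.K.symm.toLinearMap := by
  intro x
  have := Q.nontrivial
  obtain ⟨a, ha⟩ := exists_ne (0 : A)
  obtain ⟨F, hF, h⟩ := exists_finiteDimensional_K P (g := Q.haar ∘ₗ mulLeft ℂ (star a))
    (Or.inr ⟨_, _, rfl⟩) (P.V'.symm (x ⊗ₜ a))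
  refine ⟨F, hF, fun m => ?_⟩
  have h1 := h (2 * m)
  rw [LinearEquiv.apply_symm_apply, sliceRight_tmul, map_smul] at h1
  exact mem_of_smul_mem' (Q.isSymm_dualModLeft.pow_even_ne_zero Q.isDefinite_haar one_ne_zero
    Q.dualModLeft_injective ha m) h1

/-- N is multiplicative and commutes with the action, so it affects only the first leg. -/
theorem V_N (z x : X) : P.V (D.N z ⊗ₜ D.N x) = rTensor A D.N.toLinearMap (P.V (z ⊗ₜ x)) := by
  apply eq_of_sliceRight (f := fun c => Q.haar ∘ₗ mulLeft ℂ c)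
    (fun v hv => Q.eq_zero_of_haar_mul_left hv)
  intro c
  have hadm : Adm (Q.haar ∘ₗ mulLeft ℂ c) := Or.inr ⟨_, _, rfl⟩
  rw [sliceRight_rTensor, ← P.acts_act hadm, ← P.acts_act hadm, D.act_N hadm, ← D.N_mul]
  rfl

theorem V_N_pow (n : ℕ) (c p q : X) :
    P.V ((c * ((D.N.toLinearMap : Module.End ℂ X) ^ n) p) ⊗ₜ
      ((D.N.toLinearMap : Module.End ℂ X) ^ n) q) =
      rTensor A (mulLeft ℂ c ∘ₗ ((D.N.toLinearMap : Module.End ℂ X) ^ n)) (P.V (p ⊗ₜ q)) := by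
  have h1 : P.V (((D.N.toLinearMap : Module.End ℂ X) ^ n) p ⊗ₜ
      ((D.N.toLinearMap : Module.End ℂ X) ^ n) q) =
      rTensor A ((D.N.toLinearMap : Module.End ℂ X) ^ n) (P.V (p ⊗ₜ q)) := by
    induction n with
    | zero => rw [pow_zero, Module.End.one_eq_id, rTensor_id]; simp
    | succ n ih =>
      rw [pow_succ', Module.End.mul_eq_comp, rTensor_comp, LinearMap.comp_apply (rTensor A _), ← ih]
      exact D.V_N _ _
  rw [V_mul_left, h1, rTensor_comp, LinearMap.comp_apply]

/-- For z = φ(a ·) ▹ y the power Nⁿ passes to `y`, and `mul_actL` gives slices of V⁻¹(c ⊗ a). Such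
`z` span X. -/
theorem exists_finiteDimensional_mul_N (c z : X) : ∃ F : Submodule ℂ X, FiniteDimensional ℂ F ∧
    ∀ n : ℕ, c * ((D.N.toLinearMap : Module.End ℂ X) ^ n) z ∈ F := by
  have hN : ∀ (n : ℕ) a z, ((D.N.toLinearMap : Module.End ℂ X) ^ n) (P.actL Q.haar a z) =
      P.actL Q.haar a (((D.N.toLinearMap : Module.End ℂ X) ^ n) z) := by
    intro n a z
    have hadm : Adm (Q.haar ∘ₗ mulLeft ℂ a) := Or.inr ⟨_, _, rfl⟩
    rw [← (P.acts_actL Q.haar a).act_eq]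
    induction n with
    | zero => rfl
    | succ n ih =>
      rw [pow_succ', Module.End.mul_apply, Module.End.mul_apply, ih, LinearEquiv.coe_coe,
        D.act_N hadm]
  obtain ⟨t, ht⟩ := P.sliceRight_T₂_surjective Q.haar_ne_zero (LinearEquiv.refl ℂ A) z
  rw [show (LinearEquiv.refl ℂ A).toLinearMap = LinearMap.id from rfl, lTensor_id,
    LinearMap.id_apply] at ht
  rw [← ht]
  clear ht
  induction t with
  | zero => exact ⟨⊥, inferInstance, by simp⟩
  | add s t hs ht =>
    obtain ⟨F, hF, h⟩ := hs
    obtain ⟨F', hF', h'⟩ := ht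
    refine ⟨F ⊔ F', inferInstance, fun n => ?_⟩
    rw [map_add, map_add, map_add, mul_add]
    exact Submodule.add_mem_sup (h n) (h' n)
  | tmul y a =>
    obtain ⟨F, hF, hm⟩ := exists_finiteDimensional_sliceRight (P.V.symm (c ⊗ₜ a))
    refine ⟨F, hF, fun n => ?_⟩
    rw [← actL_apply, hN, D.leftInv.mul_actL]
    exact hm _

theorem exists_finiteDimensional_N (c : X) (t : X ⊗[ℂ] A) :
    ∃ F : Submodule ℂ X, FiniteDimensional ℂ F ∧ ∀ n : ℕ, sliceLeft D.h (P.V.symm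
      (rTensor A (mulLeft ℂ c ∘ₗ ((D.N.toLinearMap : Module.End ℂ X) ^ n)) t)) ∈ F := by
  induction t with
  | zero => exact ⟨⊥, inferInstance, by simp⟩
  | add s t hs ht =>
    obtain ⟨F, hF, h⟩ := hs
    obtain ⟨F', hF', h'⟩ := ht
    refine ⟨F ⊔ F', inferInstance, fun n => ?_⟩
    rw [map_add, map_add, map_add]
    exact Submodule.add_mem_sup (h n) (h' n)
  | tmul z a =>
    obtain ⟨F, hF, hm⟩ := D.exists_finiteDimensional_mul_N c z
    exact ⟨F.map (sliceLeft D.h ∘ₗ P.V.symm.toLinearMap ∘ₗ (TensorProduct.mk ℂ X A).flip a),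
      inferInstance, fun n => ⟨_, hm n, rfl⟩⟩

theorem isLocallyFinite_N {μ : ℂ} (hμ : μ ≠ 0) (hN : IsSymm D.h μ D.N.toLinearMap) :
    IsLocallyFinite D.N.toLinearMap := by
  intro x
  obtain ⟨p, hp⟩ := exists_ne (0 : X)
  obtain ⟨F, hF, h⟩ := D.exists_finiteDimensional_N (star p) (P.V (p ⊗ₜ x))
  refine ⟨F, hF, fun m => ?_⟩
  -- For the tensor V(p ⊗ x), slicing with h leaves h(p⋆N²ᵐp) N²ᵐx.
  have h1 := h (2 * m)
  rw [← V_N_pow, LinearEquiv.symm_apply_apply, sliceLeft_tmul] at h1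
  exact mem_of_smul_mem' (hN.pow_even_ne_zero D.isDefinite hμ D.N.injective hp m) h1

end Modular
end Coact
end StarGalois
end

/-! ### Signs, commutation and joint eigenvectors -/

noncomputable section
namespace StarGalois
open Multiplier LinearMap

variable {A : Type*} [NonUnitalRing A] [Module ℂ A] [IsScalarTower ℂ A A] [SMulCommClass ℂ A A]
  [StarRing A] [StarModule ℂ A]
  {X : Type*} [NonUnitalRing X] [Module ℂ X] [IsScalarTower ℂ X X] [SMulCommClass ℂ X X]
  [StarRing X] [StarModule ℂ X]

section Spectral

variable {h : X →ₗ[ℂ] ℂ} {μ μ' : ℂ} {W W' : X →ₗ[ℂ] X}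

theorem IsSymm.comp (hW : IsSymm h μ W) (hW' : IsSymm h μ' W') (hc : ∀ x, W (W' x) = W' (W x)) :
    IsSymm h (μ * μ') (W ∘ₗ W') := by
  intro x y
  rw [LinearMap.comp_apply, hW, hW', LinearMap.comp_apply, hc, mul_assoc]

theorem IsSymm.symm {e : X ≃ₗ[ℂ] X} (he : IsSymm h μ e.toLinearMap) (hμ : μ ≠ 0) :
    IsSymm h μ⁻¹ e.symm.toLinearMap := by
  intro x y
  have h1 := he (e.symm x) (e.symm y)
  simp only [LinearEquiv.coe_coe, LinearEquiv.apply_symm_apply] at h1 ⊢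
  rw [h1]
  field_simp

/-- Using the symmetry twice together with hermitian symmetry multiplies a non-zero square norm by μ
times its conjugate. -/
theorem IsSymm.mul_star_eq_one [Nontrivial X] (hW : IsSymm h μ W) (hh : IsDefinite h)
    (hpos : IsPositive h) (hs : Function.Surjective W) : μ * star μ = 1 := by
  obtain ⟨y, hy⟩ := exists_ne (0 : X)
  obtain ⟨x, rfl⟩ := hs y
  have h1 := hW x (W x)
  have h2 := hpos.conj_apply x (W (W x))
  rw [hW (W x) x, star_mul', ← hpos.conj_apply] at h2
  rw [h2, ← mul_assoc] at h1
  refine mul_right_cancel₀ (hh _ hy).ne' ?_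
  rw [← h1, one_mul]

theorem IsSymm.exists_eigenvector [Nontrivial X] (hW : IsSymm h μ W) (hh : IsDefinite h)
    (hf : IsLocallyFinite W) : ∃ (lam : ℂ) (x : X), x ≠ 0 ∧ W x = lam • x := by
  by_contra! hne
  have h1 := hW.iSup_eigenspace hh hf
  have h2 : ∀ lam, Module.End.eigenspace (W : Module.End ℂ X) lam = ⊥ := by
    intro lam
    rw [Submodule.eq_bot_iff]
    intro x hx
    by_contra h0
    exact hne lam x h0 (Module.End.mem_eigenspace_iff.mp hx)
  simp [h2] at h1

/-- A diagonalizable symmetric map whose eigenvalues are non-negative is positive. -/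
theorem IsSymm.nonneg_of_eigenvalues (hW : IsSymm h μ W) (hh : IsDefinite h)
    (hf : IsLocallyFinite W) {c : ℂ} (hc : ∀ lam x, x ≠ 0 → W x = lam • x → 0 ≤ c * lam) (x : X) :
    0 ≤ c * h (star x * W x) := by
  have hx : x ∈ ⨆ lam : ℂ, Module.End.eigenspace (W : Module.End ℂ X) lam := by
    rw [hW.iSup_eigenspace hh hf]
    trivial
  rw [Submodule.mem_iSup_iff_exists_finsupp] at hx
  obtain ⟨f, hf, rfl⟩ := hx
  have hf' : ∀ lam, W (f lam) = lam • f lam := fun lam => Module.End.mem_eigenspace_iff.mp (hf lam)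
  rw [Finsupp.sum, map_sum, star_sum, Finset.sum_mul_sum, map_sum, Finset.mul_sum]
  apply Finset.sum_nonneg
  intro i hi
  rw [map_sum, Finset.sum_eq_single i]
  · rw [hf', mul_smul_comm, map_smul, smul_eq_mul, ← mul_assoc]
    exact mul_nonneg (hc i (f i) (Finsupp.mem_support_iff.mp hi) (hf' i))
      (hh _ (Finsupp.mem_support_iff.mp hi)).le
  · intro j _ hj
    rw [hf', mul_smul_comm, map_smul, hW.orthogonal hh (hf' j) (hf' i) hj, smul_zero]
  · intro h0
    exact absurd hi h0

end Spectral

namespace Coact.Modular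

variable {Q : StarAlgebraicQuantumGroup A} {P : Coact Q X} [Nontrivial X] (D : P.Modular)

/-- By `V_l`, every slice of (u ⊗ 1)α(w) is an eigenvector of the modular element of A with
eigenvalue λ/ζ, and that element is positive. The injectivity of `V` provides a non-zero slice. -/
theorem div_pos_of_eigenvectors {lam ζ : ℂ} {u w : X} (hu : u ≠ 0) (hw : w ≠ 0)
    (hr : D.r u = ζ • u) (hl : D.l w = lam • w) : 0 < lam / ζ := by
  have hζ : ζ ≠ 0 := by
    rintro rfl
    exact hu (D.r.injective (by rw [hr, zero_smul, map_zero]))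
  have hlam : lam ≠ 0 := by
    rintro rfl
    exact hw (D.l.injective (by rw [hl, zero_smul, map_zero]))
  have h1 := D.V_l u w
  rw [hl, hr, TensorProduct.tmul_smul, ← TensorProduct.smul_tmul', map_smul, map_smul,
    map_smul] at h1
  have h2 : P.V (u ⊗ₜ w) ≠ 0 := by
    intro h0
    have := P.V.injective (h0.trans (map_zero P.V).symm)
    obtain ⟨f, hf⟩ := Module.Projective.exists_dual_ne_zero ℂ hu
    have h3 := congrArg (sliceLeft f) this
    rw [sliceLeft_tmul, map_zero] at h3
    exact (smul_ne_zero hf hw) h3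
  obtain ⟨f, hf⟩ : ∃ f : X →ₗ[ℂ] ℂ, sliceLeft f (P.V (u ⊗ₜ w)) ≠ 0 := by
    by_contra! h0
    exact h2 (eq_zero_of_sliceLeft h0)
  have h3 := congrArg (sliceLeft f) h1
  rw [map_smul, map_smul, sliceLeft_lTensor] at h3
  set b := sliceLeft f (P.V (u ⊗ₜ w))
  have h4 : Q.δl b = (lam / ζ) • b := by
    rw [div_eq_inv_mul, mul_smul, h3, smul_smul, inv_mul_cancel₀ hζ, one_smul]
  have h5 := Q.haar_star_mul_δl_nonneg b
  rw [h4, mul_smul_comm, map_smul, smul_eq_mul, mul_comm] at h5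
  have h6 := nonneg_of_mul_nonneg_of_pos (Q.isDefinite_haar b hf) h5
  exact lt_of_le_of_ne h6 (div_ne_zero hlam hζ).symm

theorem exists_eigenvector_l : ∃ (lam : ℂ) (x : X), x ≠ 0 ∧ D.l x = lam • x := by
  obtain ⟨μ, _, hμ⟩ := D.exists_isSymm_l
  exact hμ.exists_eigenvector D.isDefinite D.isLocallyFinite_l

theorem exists_eigenvector_r : ∃ (lam : ℂ) (x : X), x ≠ 0 ∧ D.r x = lam • x := by
  obtain ⟨μ, _, hμ⟩ := D.exists_isSymm_r
  exact hμ.exists_eigenvector D.isDefinite D.isLocallyFinite_r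

/-- ψ(x⋆x) = h(x⋆ r(x)), and the eigenvalues of `r` become positive after division by one fixed
eigenvalue of `l`. -/
theorem exists_smul_positive : ∃ c : ℂ, c ≠ 0 ∧ IsPositive (c • D.ψ) := by
  obtain ⟨μ, _, hμ⟩ := D.exists_isSymm_r
  obtain ⟨lam, w, hw, hl⟩ := D.exists_eigenvector_l
  have hlam : lam ≠ 0 := by
    rintro rfl
    exact hw (D.l.injective (by rw [hl, zero_smul, map_zero]))
  refine ⟨lam⁻¹, inv_ne_zero hlam, fun x => ?_⟩
  rw [LinearMap.smul_apply, smul_eq_mul, ← D.h_mul_r]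
  refine hμ.nonneg_of_eigenvalues D.isDefinite D.isLocallyFinite_r (fun ζ u hu hr => ?_) x
  have := (inv_pos.mpr (D.div_pos_of_eigenvectors hu hw hr hl)).le
  rwa [inv_div, div_eq_inv_mul] at this

theorem h_mul_σ_pos {w : X} (hw : w ≠ 0) : 0 < D.h (star w * D.σ w) := by
  have := D.isDefinite (star w) (star_ne_zero.mpr hw)
  rwa [star_star, ← D.h_mul_σ] at this

/-- K sends eigenvectors of `l` to eigenvectors, dividing the eigenvalue by τ. Both ratios to an
eigenvalue of `r` are positive, so τ > 0; symmetry of the bijection K gives |τ| = 1. -/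
theorem dualMod_δ (D : P.Modular) : (∀ a, Q.dualMod (Q.δl a) = 1 * Q.dualMod a) ∧
    (∀ a, Q.dualMod (Q.δr a) = 1 * Q.dualMod a) := by
  obtain ⟨τ, hτ0, hτl, hτr⟩ := exists_τ Q
  suffices τ = 1 by
    rw [this] at hτl hτr
    exact ⟨hτl, hτr⟩
  obtain ⟨lam, w, hw, hl⟩ := D.exists_eigenvector_l
  obtain ⟨ζ, u, hu, hr⟩ := D.exists_eigenvector_r
  have h1 : D.l (P.K w) = (τ⁻¹ * lam) • P.K w := by
    have := D.K_l hτl w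
    rw [hl, map_smul] at this
    rw [mul_smul, this, smul_smul, inv_mul_cancel₀ hτ0, one_smul]
  have h2 := D.div_pos_of_eigenvectors hu hw hr hl
  have h3 := D.div_pos_of_eigenvectors hu (P.K.map_ne_zero_iff.mpr hw) hr h1
  have h4 : 0 < τ := by
    have := div_pos h2 h3
    have hne := h2.ne'
    rw [div_ne_zero_iff] at hne
    obtain ⟨hlam, hζ⟩ := hne
    have h5 : lam / ζ / (τ⁻¹ * lam / ζ) = τ := by field_simp
    rwa [h5] at this
  have h5 := (D.K_isSymm hτr).mul_star_eq_one D.isDefinite D.pos P.K.surjective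
  obtain ⟨t, rfl⟩ : ∃ t : ℝ, τ = t := ⟨τ.re, (Complex.eq_re_of_ofReal_le (r := 0) (by
    simpa using h4.le))⟩
  rw [Complex.star_def, Complex.conj_ofReal] at h5
  norm_cast at h4 h5 ⊢
  nlinarith

/-- σ divides eigenvalues of `l` by ν. If ν ≠ 1, then w and σ(w) would be orthogonal, whereas
h(w⋆σ(w)) = h(ww⋆) > 0. -/
theorem h_l (x : X) : D.h (D.l x) = 1 * D.h (D.r x) := by
  obtain ⟨ν, hν0, hν⟩ := D.exists_h_l
  suffices ν = 1 by rw [hν, this]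
  by_contra hne
  obtain ⟨lam, w, hw, hl⟩ := D.exists_eigenvector_l
  have hlam : lam ≠ 0 := by
    rintro rfl
    exact hw (D.l.injective (by rw [hl, zero_smul, map_zero]))
  have h1 : D.l (D.σ w) = (ν⁻¹ * lam) • D.σ w := by
    have := σ_l hν w
    rw [hl, map_smul] at this
    rw [mul_smul, this, smul_smul, inv_mul_cancel₀ hν0, one_smul]
  obtain ⟨μ, _, hμ⟩ := D.exists_isSymm_l
  refine (D.h_mul_σ_pos hw).ne' (hμ.orthogonal D.isDefinite h1 hl ?_)
  intro h2
  apply hne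
  rw [inv_mul_eq_iff_eq_mul₀ hν0] at h2
  exact (mul_right_cancel₀ hlam (by rw [one_mul, ← h2])).symm

theorem σ_comm_l (x : X) : D.σ (D.l x) = D.l (D.σ x) := by
  rw [σ_l D.h_l, one_smul]

theorem σ_comm_r (x : X) : D.σ (D.r x) = D.r (D.σ x) := by
  rw [σ_r D.h_l, one_smul]

theorem K_comm_l (x : X) : P.K (D.l x) = D.l (P.K x) := by
  rw [D.K_l D.dualMod_δ.1, one_smul]

theorem K_comm_r (x : X) : P.K (D.r x) = D.r (P.K x) := by
  rw [D.K_r D.dualMod_δ.2, one_smul]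

theorem symm_comm {e f : X ≃ₗ[ℂ] X} (h : ∀ x, e (f x) = f (e x)) (x : X) :
    e.symm (f x) = f (e.symm x) := by
  rw [LinearEquiv.symm_apply_eq, h, LinearEquiv.apply_symm_apply]

theorem N_apply (x : X) : D.N x = D.σ (D.r.symm (D.l (D.σ (P.K x)))) := rfl

theorem exists_isSymm_N : ∃ μ, μ ≠ 0 ∧ IsSymm D.h μ D.N.toLinearMap := by
  obtain ⟨μ, hμ0, hμ⟩ := D.exists_isSymm_l
  obtain ⟨ρ, hρ0, hρ⟩ := D.exists_isSymm_r
  have h1 := D.σ_isSymm.comp (D.K_isSymm D.dualMod_δ.2) fun x => (D.K_σ x).symm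
  have h2 := hμ.comp h1 fun x => by
    simp [D.σ_comm_l, D.K_comm_l]
  have h3 := (hρ.symm hρ0).comp h2 fun x => by
    have e1 := fun x => symm_comm (fun x => (D.l_r x).symm) x
    have e2 := fun x => symm_comm (fun x => (D.σ_comm_r x).symm) x
    have e3 := fun x => symm_comm (fun x => (D.K_comm_r x).symm) x
    simp [e1, e2, e3]
  have h4 := D.σ_isSymm.comp h3 fun x => by
    have e2 := fun x => symm_comm (fun x => (D.σ_comm_r x).symm) x
    simp [D.σ_comm_l, ← e2, D.K_σ]
  refine ⟨_, ?_, h4⟩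
  simp [hμ0, hρ0]

theorem N_comm_l (x : X) : D.N (D.l x) = D.l (D.N x) := by
  have e1 := fun x => symm_comm (fun x => (D.l_r x).symm) x
  simp [N_apply, D.K_comm_l, D.σ_comm_l, e1]

theorem N_comm_r (x : X) : D.N (D.r x) = D.r (D.N x) := by
  rw [N_apply, N_apply, D.K_comm_r, D.σ_comm_r, D.l_r, LinearEquiv.symm_apply_apply, ← D.σ_comm_r,
    LinearEquiv.apply_symm_apply]

theorem N_comm_K (x : X) : D.N (P.K x) = P.K (D.N x) := by
  have e3 := fun x => symm_comm (fun x => (D.K_comm_r x).symm) x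
  simp only [N_apply, ← D.K_σ, ← D.K_comm_l, e3]

/-- A joint eigenvector of `l`, `r`, `K⁻¹` and `N`. -/
structure IsJointEigenvector (v : X) : Prop where
  ne_zero : v ≠ 0
  l : ∃ c : ℂ, D.l v = c • v
  r : ∃ c : ℂ, D.r v = c • v
  K_symm : ∃ c : ℂ, P.K.symm v = c • v
  N : ∃ c : ℂ, D.N v = c • v

theorem span_isJointEigenvector : ⊤ ≤ Submodule.span ℂ {v | D.IsJointEigenvector v} := by
  obtain ⟨μ, hμ0, hμ⟩ := D.exists_isSymm_l
  obtain ⟨ρ, hρ0, hρ⟩ := D.exists_isSymm_r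
  have hK := (D.K_isSymm D.dualMod_δ.2).symm one_ne_zero
  obtain ⟨η, hη0, hη⟩ := D.exists_isSymm_N
  have hKl := fun x => symm_comm D.K_comm_l x
  have hKr := fun x => symm_comm D.K_comm_r x
  have hNK := fun x => symm_comm (fun x => (D.N_comm_K x).symm) x
  -- The maps commute, so each one preserves the joint eigenspaces of the preceding ones and is
  -- diagonalized there.
  refine (hμ.le_iSup_eigenspace D.isDefinite D.isLocallyFinite_l ⊤ fun _ _ => trivial).trans
    (iSup_le fun a => ?_)
  refine (hρ.le_iSup_eigenspace D.isDefinite D.isLocallyFinite_r _ ?_).trans (iSup_le fun b => ?_)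
  · rintro x ⟨-, hx⟩
    refine ⟨trivial, ?_⟩
    rw [SetLike.mem_coe, Module.End.mem_eigenspace_iff] at hx ⊢
    simp only [LinearEquiv.coe_coe] at hx ⊢
    rw [D.l_r, hx, map_smul]
  refine (hK.le_iSup_eigenspace D.isDefinite (isLocallyFinite_K_symm P) _ ?_).trans
    (iSup_le fun c => ?_)
  · rintro x ⟨⟨-, hx⟩, hx'⟩
    refine ⟨⟨trivial, ?_⟩, ?_⟩
    all_goals
      rw [SetLike.mem_coe, Module.End.mem_eigenspace_iff] at hx hx' ⊢
      simp only [LinearEquiv.coe_coe] at hx hx' ⊢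
    · rw [← hKl, hx, map_smul]
    · rw [← hKr, hx', map_smul]
  refine (hη.le_iSup_eigenspace D.isDefinite (D.isLocallyFinite_N hη0 hη) _ ?_).trans
    (iSup_le fun d => ?_)
  · rintro x ⟨⟨⟨-, hx⟩, hx'⟩, hx''⟩
    refine ⟨⟨⟨trivial, ?_⟩, ?_⟩, ?_⟩
    all_goals
      rw [SetLike.mem_coe, Module.End.mem_eigenspace_iff] at hx hx' hx'' ⊢
      simp only [LinearEquiv.coe_coe] at hx hx' hx'' ⊢
    · rw [← D.N_comm_l, hx, map_smul]
    · rw [← D.N_comm_r, hx', map_smul]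
    · rw [hNK, hx'', map_smul]
  rintro x ⟨⟨⟨⟨-, h1⟩, h2⟩, h3⟩, h4⟩
  by_cases hx : x = 0
  · rw [hx]
    exact zero_mem _
  rw [SetLike.mem_coe, Module.End.mem_eigenspace_iff] at h1 h2 h3 h4
  exact Submodule.subset_span ⟨hx, ⟨a, h1⟩, ⟨b, h2⟩, ⟨c, h3⟩, ⟨d, h4⟩⟩

/-- The positive map `σ` is the square root of a product of the other maps. -/
theorem IsJointEigenvector.σ {D : P.Modular} {v : X} (hv : D.IsJointEigenvector v) :
    ∃ c : ℂ, D.σ v = c • v := by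
  obtain ⟨hv0, ⟨a, ha⟩, ⟨b, hb⟩, ⟨c, hc⟩, ⟨d, hd⟩⟩ := hv
  have ha0 : a ≠ 0 := by
    rintro rfl
    exact hv0 (D.l.injective (by rw [ha, zero_smul, map_zero]))
  have h1 : D.σ (D.σ v) = (a⁻¹ * (c * d * b)) • v := by
    have e1 : D.l (D.σ (D.σ v)) = (c * d * b) • v := by
      -- From N = σ r⁻¹ l σ K and commutation, σ² = l⁻¹ r N K⁻¹.
      have e2 : D.r (D.N (P.K.symm v)) = D.l (D.σ (D.σ v)) := by
        rw [N_apply, LinearEquiv.apply_symm_apply, ← D.σ_comm_r, LinearEquiv.apply_symm_apply,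
          D.σ_comm_l]
      rw [← e2, hc, map_smul, map_smul, hd, map_smul, hb, smul_smul, smul_smul, mul_assoc]
    rw [← D.σ_comm_l, ← D.σ_comm_l, ha, map_smul, map_smul] at e1
    rw [mul_smul, ← e1, smul_smul, inv_mul_cancel₀ ha0, one_smul]
  generalize a⁻¹ * (c * d * b) = s at h1
  have h2 : 0 < s := by
    have e1 := D.σ_isSymm (D.σ v) v
    simp only [LinearEquiv.coe_coe] at e1
    rw [h1, mul_smul_comm, map_smul, smul_eq_mul, one_mul] at e1
    have e2 := D.isDefinite (D.σ v) (D.σ.map_ne_zero_iff.mpr hv0)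
    rw [← e1] at e2
    exact (pos_iff_pos_of_mul_pos e2).mpr (D.isDefinite v hv0)
  obtain ⟨s, rfl⟩ : ∃ t : ℝ, s = t := ⟨s.re, (Complex.eq_re_of_ofReal_le (r := 0) (by
    simpa using h2.le))⟩
  have hs : 0 < s := by exact_mod_cast h2
  refine ⟨(√s : ℝ), ?_⟩
  rw [← sub_eq_zero]
  by_contra hw
  -- If non-zero, this vector is an eigenvector of σ with eigenvalue -√s, which contradicts the
  -- positivity of σ.
  set w := D.σ v - ((√s : ℝ) : ℂ) • v with hwdef
  have h3 : D.σ w = (-((√s : ℝ) : ℂ)) • w := by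
    have e1 : (s : ℂ) = ((√s : ℝ) : ℂ) * ((√s : ℝ) : ℂ) := by
      rw [← Complex.ofReal_mul, Real.mul_self_sqrt hs.le]
    rw [hwdef, map_sub, map_smul, h1, e1, neg_smul, smul_sub, smul_smul]
    abel
  have h4 := D.h_mul_σ_pos hw
  rw [h3, mul_smul_comm, map_smul, smul_eq_mul] at h4
  have h5 := (pos_iff_pos_of_mul_pos h4).mpr (D.isDefinite w hw)
  rw [← Complex.ofReal_neg] at h5
  have h6 : 0 < -√s := by exact_mod_cast h5
  linarith [Real.sqrt_nonneg s]

theorem IsJointEigenvector.K {D : P.Modular} {v : X} (hv : D.IsJointEigenvector v) :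
    ∃ c : ℂ, P.K v = c • v := by
  obtain ⟨c, hc⟩ := hv.K_symm
  rw [LinearEquiv.symm_apply_eq, map_smul] at hc
  have hc0 : c ≠ 0 := by
    rintro rfl
    exact hv.ne_zero (by rw [hc, zero_smul])
  refine ⟨c⁻¹, ?_⟩
  conv_rhs => rw [hc, smul_smul, inv_mul_cancel₀ hc0, one_smul]

theorem exists_basis : ∃ (s : Set X) (b : Module.Basis s ℂ X), ∀ i,
    (∃ μ : ℂ, Module.End.HasEigenvector D.σ.toLinearMap μ (b i)) ∧
    (∃ μ : ℂ, Module.End.HasEigenvector (D.σ.toLinearMap ∘ₗ P.K.toLinearMap) μ (b i)) ∧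
    (∃ μ : ℂ, Module.End.HasEigenvector D.l.toLinearMap μ (b i)) ∧
    (∃ μ : ℂ, Module.End.HasEigenvector D.r.toLinearMap μ (b i)) := by
  refine ⟨_, Module.Basis.ofSpan D.span_isJointEigenvector, fun i => ?_⟩
  have hv : D.IsJointEigenvector (Module.Basis.ofSpan D.span_isJointEigenvector i) :=
    Module.Basis.ofSpan_subset D.span_isJointEigenvector (Set.mem_range_self i)
  generalize Module.Basis.ofSpan D.span_isJointEigenvector i = v at hv
  obtain ⟨a, ha⟩ := hv.σ
  obtain ⟨k, hk⟩ := hv.K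
  obtain ⟨l, hl⟩ := hv.l
  obtain ⟨r, hr⟩ := hv.r
  refine ⟨⟨a, Module.End.mem_eigenspace_iff.mpr ha, hv.ne_zero⟩,
    ⟨k * a, Module.End.mem_eigenspace_iff.mpr ?_, hv.ne_zero⟩,
    ⟨l, Module.End.mem_eigenspace_iff.mpr hl, hv.ne_zero⟩,
    ⟨r, Module.End.mem_eigenspace_iff.mpr hr, hv.ne_zero⟩⟩
  change D.σ (P.K v) = _
  rw [hk, map_smul, ha, smul_smul]

end Coact.Modular
end StarGalois
end

/-! ### Translation to the structure maps and conclusion -/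

noncomputable section
namespace StarGalois
open Multiplier LinearMap

variable {A : Type*} [NonUnitalRing A] [Module ℂ A] [IsScalarTower ℂ A A] [SMulCommClass ℂ A A]
  [StarRing A] [StarModule ℂ A]
  {X : Type*} [NonUnitalRing X] [Module ℂ X] [IsScalarTower ℂ X X] [SMulCommClass ℂ X X]
  [StarRing X] [StarModule ℂ X]

namespace Multiplier

/-- The left multiplication by an invertible multiplier. -/
def leftEquiv (u : (Multiplier X)ˣ) : X ≃ₗ[ℂ] X where
  __ := left u.1
  invFun := left u.2
  left_inv x := congrArg (fun m => left m x) u.inv_mul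
  right_inv x := congrArg (fun m => left m x) u.mul_inv

/-- The right multiplication by an invertible multiplier. -/
def rightEquiv (u : (Multiplier X)ˣ) : X ≃ₗ[ℂ] X where
  __ := right u.1
  invFun := right u.2
  left_inv x := congrArg (fun m => right m x) u.mul_inv
  right_inv x := congrArg (fun m => right m x) u.inv_mul

/-- The invertible multiplier with given bijective left and right multiplication. -/
def unitMk (l r : X ≃ₗ[ℂ] X) (h : ∀ x y, x * l y = r x * y) : (Multiplier X)ˣ where
  val := mk l.toLinearMap r.toLinearMap h
  inv := mk l.symm.toLinearMap r.symm.toLinearMap fun x y => by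
    have := h (r.symm x) (l.symm y)
    simp only [LinearEquiv.apply_symm_apply] at this
    exact this.symm
  val_inv := Subtype.ext (Prod.ext (LinearMap.ext fun x => l.apply_symm_apply x)
    (MulOpposite.unop_injective (LinearMap.ext fun x => r.symm_apply_apply x)))
  inv_val := Subtype.ext (Prod.ext (LinearMap.ext fun x => l.symm_apply_apply x)
    (MulOpposite.unop_injective (LinearMap.ext fun x => r.apply_symm_apply x)))

end Multiplier

namespace StarGaloisObject

open StarAlgebraicQuantumGroup

variable {Q : StarAlgebraicQuantumGroup A} {G : StarGaloisObject Q X} [Nontrivial X]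

theorem nonempty_structureMaps (D : G.toCoact.Modular) : Nonempty (G.StructureMaps D.ψ) := by
  obtain ⟨Φ, hΦ⟩ := Q.exists_dualIntegral
  exact ⟨{
    φX := D.h
    φX_spec := D.leftInv
    δX := Multiplier.unitMk D.l D.r D.mul_l
    δX_spec := D.h_r
    σX := D.σ
    σX_mul := D.σ_mul
    σX_spec := D.h_mul_σ
    ε := Q.counit
    ε_spec := Q.isCounit_counit
    S := Q.antipode
    S_spec := Q.isAntipode_antipode
    dualIntegral := Φ
    dualIntegral_spec := hΦ
    dualδ := Q.dualMod
    dualδ_spec := hΦ.isDualModularElement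
    dualδAct := G.toCoact.K.toLinearMap
    dualδAct_spec := Coact.Modular.acts_K G.toCoact }⟩

namespace StructureMaps

variable {ψX : X →ₗ[ℂ] ℂ} (D : G.StructureMaps ψX)

/-- The structure maps of a Galois object as modular data. -/
def toModular (hpos : IsPositive D.φX) (hψ : G.IsInvariant ψX) (hψ0 : ψX ≠ 0) :
    G.toCoact.Modular where
  h := D.φX
  ψ := ψX
  leftInv := D.φX_spec
  pos := hpos
  rightInv := hψ
  ψ_ne_zero := hψ0
  l := leftEquiv D.δX
  r := rightEquiv D.δX
  σ := D.σX
  mul_l := mul_left_eq D.δX.1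
  h_r := D.δX_spec
  h_mul_σ := D.σX_spec

/-- Counit, antipode, dual modular element and its action are determined by their defining
properties, so any choice agrees with the one constructed above. -/
theorem dualδAct_eq : D.dualδAct = G.toCoact.K.toLinearMap := by
  obtain ⟨φX, _, δX, _, σX, _, _, ε, hε, S, hS, Φ, hΦ, d, hd, E, hE⟩ := D
  obtain rfl := hε.eq_counit
  obtain rfl := hS.eq_antipode
  obtain rfl := hd.eq_dualMod hΦ
  exact Coact.Acts.unique (P := G.toCoact) hE (Coact.Modular.acts_K G.toCoact)

end StructureMaps
end StarGaloisObject
end StarGalois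
end


theorem mainTheorem8 {A : Type*} [NonUnitalRing A] [Module ℂ A] [IsScalarTower ℂ A A]
    [SMulCommClass ℂ A A] [StarRing A] [StarModule ℂ A]
    {X : Type*} [NonUnitalRing X] [Nontrivial X] [Module ℂ X] [IsScalarTower ℂ X X]
    [SMulCommClass ℂ X X] [StarRing X] [StarModule ℂ X]
    (Q : StarGalois.StarAlgebraicQuantumGroup A) (G : StarGalois.StarGaloisObject Q X)
    (hX : ∃ ω : X →ₗ[ℂ] ℂ, ω ≠ 0 ∧ StarGalois.IsPositive ω) :
    (∃ ψX : X →ₗ[ℂ] ℂ, ψX ≠ 0 ∧ G.IsInvariant ψX ∧ StarGalois.IsPositive ψX) ∧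
    ∀ ψX : X →ₗ[ℂ] ℂ, ψX ≠ 0 → G.IsInvariant ψX →
      (∃ c : ℂ, c ≠ 0 ∧ StarGalois.IsPositive (c • ψX)) ∧
      Nonempty (G.StructureMaps ψX) ∧
      ∀ D : G.StructureMaps ψX,
        StarGalois.IsPositive D.φX ∧
        ∃ (s : Set X) (b : Module.Basis s ℂ X), ∀ i,
          (∃ μ : ℂ, Module.End.HasEigenvector D.σX.toLinearMap μ (b i)) ∧
          (∃ μ : ℂ, Module.End.HasEigenvector D.θX μ (b i)) ∧
          (∃ μ : ℂ, Module.End.HasEigenvector (StarGalois.Multiplier.left D.δX.1) μ (b i)) ∧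
          (∃ μ : ℂ, Module.End.HasEigenvector (StarGalois.Multiplier.right D.δX.1) μ (b i)) := by
  obtain ⟨ω, hω0, hω⟩ := hX
  obtain ⟨h, H⟩ := G.exists_leftInv
  have hpos := H.positive hω hω0
  have key : ∀ ψX : X →ₗ[ℂ] ℂ, ψX ≠ 0 → G.IsInvariant ψX →
      ∃ D : G.toCoact.Modular, D.ψ = ψX := fun ψX h0 hψ => by
    obtain ⟨D, -, hD⟩ := H.exists_modularData hpos hψ h0
    exact ⟨D, hD⟩
  refine ⟨?_, fun ψX h0 hψ => ⟨?_, ?_, fun D => ?_⟩⟩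
  · obtain ⟨ψ, h0, hψ⟩ := G.toCoact.exists_rightInv
    obtain ⟨D, rfl⟩ := key ψ h0 hψ
    obtain ⟨c, hc0, hc⟩ := D.exists_smul_positive
    refine ⟨c • D.ψ, smul_ne_zero hc0 h0, fun x a => ?_, hc⟩
    have h1 : StarGalois.sliceLeft (V := A) (c • D.ψ) = c • StarGalois.sliceLeft D.ψ := by
      ext
      simp [StarGalois.sliceLeft_tmul, smul_smul]
    rw [h1, LinearMap.smul_apply, LinearMap.smul_apply, smul_assoc]
    exact congrArg _ (hψ x a)
  · obtain ⟨D, rfl⟩ := key ψX h0 hψ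
    exact D.exists_smul_positive
  · obtain ⟨D, rfl⟩ := key ψX h0 hψ
    exact StarGalois.StarGaloisObject.nonempty_structureMaps D
  · have hφ : StarGalois.IsPositive D.φX :=
      -- `D.φX` is itself left invariant, so the argument with ω applies to it without comparison to
      -- `h`.
      StarGalois.Coact.LeftInv.positive (P := G.toCoact) D.φX_spec hω hω0
    refine ⟨hφ, ?_⟩
    rw [StarGalois.StarGaloisObject.StructureMaps.θX, D.dualδAct_eq]
    exact (D.toModular hφ hψ h0).exists_basis
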